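/- Let $n\ge 2$ and $c\in\mathbb R$, and let $(N,\langle\cdot,\cdot\rangle,J)$ be a Kähler manifold of complex dimension $n$ with constant holomorphic sectional curvature $4c$ (in particular, the complete simply connected complex space form $N^n(4c)$). Let $M$ be a smooth $n$-dimensional manifold immersed in $N$ as a Lagrangian submanifold, i.e. $J$ maps each tangent space of $M$ onto the corresponding normal space; equip $M$ with the induced metric $g$ and its Levi-Civita connection $\nabla$. Let $h$ be the second fundamental form, $H=\frac1n\operatorname{tr}_g h$ the mean curvature vector, and let $$\tilde h(X,Y)=h(X,Y)-\frac{n}{n+2}\big\{\langle X,Y\rangle H+\langle JX,H\rangle JY+\langle JY,H\rangle JX\big\}$$ be the Lagrangian trace-free second fundamental form. Let $\nabla\tilde h$ be its covariant derivative, formed with $\nabla$ and the normal connection. In a local orthonormal frame $\{e_i\}$ of $M$ put $\tilde h^{m^*}_{ij}=\langle\tilde h(e_i,e_j),Je_m\rangle$ and $\tilde h^{m^*}_{ij,k}=\langle(\nabla_{e_k}\tilde h)(e_i,e_j),Je_m\rangle$, and define the $(0,2)$-tensor $T$ by $T_{ij}=\frac1n\sum_m\tilde h^{m^*}_{ij,m}$.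 Let $T_{ij,m}=(\nabla_{e_m}T)(e_i,e_j)$ and $\langle\tilde h,\nabla T\rangle=\sum_{i,j,m}\tilde h^{m^*}_{ij}T_{ij,m}$, let $|\tilde h|^2=\sum_{i,j,m}(\tilde h^{m^*}_{ij})^2$ and $|\nabla\tilde h|^2=\sum_{i,j,k,m}(\tilde h^{m^*}_{ij,k})^2$, and let $\Delta=\operatorname{tr}_g\nabla^2$ be the Laplace–Beltrami operator of $(M,g)$. Then, at every point of $M$, $$\tfrac12\Delta|\tilde h|^2\;\ge\;(n+2)\langle\tilde h,\nabla T\rangle+|\nabla\tilde h|^2+(n+1)c\,|\tilde h|^2+\frac{n^2}{n+2}|\tilde h|^2|H|^2-\frac{n+3}{2}|\tilde h|^4 .$$ -/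

import Mathlib

open scoped Manifold ContDiff

noncomputable section

namespace LagrangianSimons

/-- Coordinate space `ℝᵐ`. -/
abbrev Coord (m : ℕ) : Type := EuclideanSpace ℝ (Fin m)

/-- The `i`-th coordinate vector `∂ᵢ`. -/
def basisVec {m : ℕ} (i : Fin m) : Coord m := EuclideanSpace.single i 1

/-! ### Riemannian geometry of a metric given in local coordinates

`g x u v` is the value at `x` of the metric on the vectors `u`, `v`. Vectors are identified with
constant-coefficient vector fields in the coordinates. -/

section Coordinates

variable {m : ℕ} (g : Coord m → Coord m →L[ℝ] Coord m →L[ℝ] ℝ)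

/-- The Gram matrix `(g_{ij})` at `x`. -/
def gram (x : Coord m) : Matrix (Fin m) (Fin m) ℝ :=
  Matrix.of fun i j => g x (basisVec i) (basisVec j)

/-- The coefficients `g^{ij}` of the inverse metric at `x`. -/
def invMetric (x : Coord m) (i j : Fin m) : ℝ := (gram g x)⁻¹ i j

/-- `g(∇_u v, w) = ½ (∂_u g(v, w) + ∂_v g(u, w) - ∂_w g(u, v))` for constant-coefficient fields. -/
def koszul (x u v w : Coord m) : ℝ :=
  (1 / 2) * (fderiv ℝ g x u v w + fderiv ℝ g x v u w - fderiv ℝ g x w u v)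

/-- The Levi-Civita connection on constant-coefficient fields:
`∇_u v = Γ(u, v) = Γ^k_{ij} u^i v^j ∂_k`. -/
def christoffel (x u v : Coord m) : Coord m :=
  ∑ k, ∑ l, (invMetric g x k l * koszul g x u v (basisVec l)) • basisVec k

/-- The curvature tensor `R(u, v) w = ∇_u ∇_v w - ∇_v ∇_u w - ∇_{[u, v]} w`. -/
def curvature (x u v w : Coord m) : Coord m :=
  fderiv ℝ (fun y => christoffel g y v w) x u - fderiv ℝ (fun y => christoffel g y u w) x v
    + christoffel g x u (christoffel g x v w) - christoffel g x v (christoffel g x u w)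

/-- The covariant derivative `(∇_u J) v` of a field `J` of endomorphisms. -/
def covEnd (J : Coord m → Coord m →L[ℝ] Coord m) (x u v : Coord m) : Coord m :=
  fderiv ℝ (fun y => J y v) x u + christoffel g x u (J x v) - J x (christoffel g x u v)

/-- The Laplace–Beltrami operator `Δ φ = g^{ij} (∂_i ∂_j φ - Γ^k_{ij} ∂_k φ)`. -/
def laplacian (φ : Coord m → ℝ) (x : Coord m) : ℝ :=
  ∑ i, ∑ j, invMetric g x i j *
    (fderiv ℝ (fun y => fderiv ℝ φ y (basisVec j)) x (basisVec i)
      - fderiv ℝ φ x (christoffel g x (basisVec i) (basisVec j)))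

/-- The covariant derivative `(∇_u S)(v, w)` of a `(0, 2)`-tensor field `S`. -/
def covTwoTensor (S : Coord m → Coord m → Coord m → ℝ) (x u v w : Coord m) : ℝ :=
  fderiv ℝ (fun y => S y v w) x u - S x (christoffel g x u v) w - S x v (christoffel g x u w)

end Coordinates

/-! ### Submanifold geometry in local coordinates

`G` and `J` are the ambient metric and almost complex structure in coordinates of the ambient
manifold, and `F` is the coordinate expression of the immersion. -/

section Immersion

variable {n m : ℕ} (G : Coord m → Coord m →L[ℝ] Coord m →L[ℝ] ℝ)
  (J : Coord m → Coord m →L[ℝ] Coord m) (F : Coord n → Coord m)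

/-- The induced metric `g(u, v) = ⟨dF u, dF v⟩`. -/
def indMetric (x : Coord n) : Coord n →L[ℝ] Coord n →L[ℝ] ℝ :=
  (G (F x)).bilinearComp (fderiv ℝ F x) (fderiv ℝ F x)

/-- The normal component of an ambient vector `w` at `F x`. -/
def normalProj (x : Coord n) (w : Coord m) : Coord m :=
  w - ∑ k, ∑ l, (invMetric (indMetric G F) x k l * G (F x) w (fderiv ℝ F x (basisVec l))) •
    fderiv ℝ F x (basisVec k)

/-- The ambient Levi-Civita derivative `∇̄_u Y` of a vector field `Y` along `F`. -/
def covAlong (Y : Coord n → Coord m) (x u : Coord n) : Coord m :=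
  fderiv ℝ Y x u + christoffel G (F x) (fderiv ℝ F x u) (Y x)

/-- The normal connection `∇^⊥_u Y`, for `Y` a normal field along `F`. -/
def normalCov (Y : Coord n → Coord m) (x u : Coord n) : Coord m :=
  normalProj G F x (covAlong G F Y x u)

/-- The second fundamental form `h(u, v)`: the normal component of `∇̄_u v`. -/
def secondFF (x u v : Coord n) : Coord m :=
  normalProj G F x (covAlong G F (fun y => fderiv ℝ F y v) x u)

/-- The mean curvature vector `H = (1 / n) trace h`. -/
def meanCurv (x : Coord n) : Coord m :=
  (1 / (n : ℝ)) • ∑ i, ∑ j,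
    invMetric (indMetric G F) x i j • secondFF G F x (basisVec i) (basisVec j)

/-- The Lagrangian trace-free second fundamental form
`h̃(u, v) = h(u, v) - n / (n + 2) (⟨u, v⟩ H + ⟨J u, H⟩ J v + ⟨J v, H⟩ J u)`. -/
def tfSecondFF (x u v : Coord n) : Coord m :=
  secondFF G F x u v - ((n : ℝ) / ((n : ℝ) + 2)) •
    (indMetric G F x u v • meanCurv G F x
      + G (F x) (J (F x) (fderiv ℝ F x u)) (meanCurv G F x) • J (F x) (fderiv ℝ F x v)
      + G (F x) (J (F x) (fderiv ℝ F x v)) (meanCurv G F x) • J (F x) (fderiv ℝ F x u))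

/-- The covariant derivative `(∇_u h̃)(v, w)`, formed with the normal connection and the
Levi-Civita connection of the induced metric. -/
def covTfSecondFF (x u v w : Coord n) : Coord m :=
  normalCov G F (fun y => tfSecondFF G J F y v w) x u
    - tfSecondFF G J F x (christoffel (indMetric G F) x u v) w
    - tfSecondFF G J F x v (christoffel (indMetric G F) x u w)

/-- `|H|²`. -/
def normSqMeanCurv (x : Coord n) : ℝ := G (F x) (meanCurv G F x) (meanCurv G F x)

/-- `|h̃|²`. -/
def normSqTf (x : Coord n) : ℝ :=
  ∑ i, ∑ i', ∑ j, ∑ j', invMetric (indMetric G F) x i i' * invMetric (indMetric G F) x j j' *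
    G (F x) (tfSecondFF G J F x (basisVec i) (basisVec j))
      (tfSecondFF G J F x (basisVec i') (basisVec j'))

/-- `|∇h̃|²`. -/
def normSqCovTf (x : Coord n) : ℝ :=
  ∑ k, ∑ k', ∑ i, ∑ i', ∑ j, ∑ j',
    invMetric (indMetric G F) x k k' * invMetric (indMetric G F) x i i' *
      invMetric (indMetric G F) x j j' *
    G (F x) (covTfSecondFF G J F x (basisVec k) (basisVec i) (basisVec j))
      (covTfSecondFF G J F x (basisVec k') (basisVec i') (basisVec j'))

/-- The tensor `T`; in an orthonormal frame `T(v, w) = (1 / n) ∑_m ⟨(∇_{e_m} h̃)(v, w), J e_m⟩`. -/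
def tensorT (x v w : Coord n) : ℝ :=
  (1 / (n : ℝ)) * ∑ k, ∑ l, invMetric (indMetric G F) x k l *
    G (F x) (covTfSecondFF G J F x (basisVec k) v w) (J (F x) (fderiv ℝ F x (basisVec l)))

/-- `⟨h̃, ∇T⟩`; in an orthonormal frame it is
`∑_{i, j, m} ⟨h̃(e_i, e_j), J e_m⟩ (∇_{e_m} T)(e_i, e_j)`. -/
def innerTfCovT (x : Coord n) : ℝ :=
  ∑ k, ∑ k', ∑ i, ∑ i', ∑ j, ∑ j',
    invMetric (indMetric G F) x k k' * invMetric (indMetric G F) x i i' *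
      invMetric (indMetric G F) x j j' *
    G (F x) (tfSecondFF G J F x (basisVec i) (basisVec j)) (J (F x) (fderiv ℝ F x (basisVec k))) *
    covTwoTensor (indMetric G F) (tensorT G J F) x (basisVec k') (basisVec i') (basisVec j')

end Immersion

/-! ### Complex space forms and Lagrangian immersions -/

section Manifolds

variable {m : ℕ} {N : Type*} [TopologicalSpace N] [ChartedSpace (Coord m) N]

/-- The differential at `y` of the inverse `ψ⁻¹` of the chart `ψ`. -/
def chartSymmDeriv (ψ : OpenPartialHomeomorph N (Coord m)) (y : Coord m) :
    Coord m →L[ℝ] TangentSpace (𝓡 m) (ψ.symm y) :=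
  mfderiv 𝓘(ℝ, Coord m) (𝓡 m) ψ.symm y

/-- The differential at `q` of the chart `ψ`. -/
def chartDeriv (ψ : OpenPartialHomeomorph N (Coord m)) (q : N) :
    TangentSpace (𝓡 m) q →L[ℝ] Coord m :=
  mfderiv (𝓡 m) 𝓘(ℝ, Coord m) ψ q

/-- The coordinate expression `(u, v) ↦ ⟨dψ⁻¹ u, dψ⁻¹ v⟩` of a Riemannian metric in the
chart `ψ`. -/
def metricInChart [IsManifold (𝓡 m) ∞ N]
    (g : Bundle.ContMDiffRiemannianMetric (𝓡 m) ∞ (Coord m)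
      (fun q : N => TangentSpace (𝓡 m) q))
    (ψ : OpenPartialHomeomorph N (Coord m)) (y : Coord m) : Coord m →L[ℝ] Coord m →L[ℝ] ℝ :=
  ContinuousLinearMap.bilinearComp
    (E := Coord m) (F := Coord m) (E' := Coord m) (F' := Coord m)
    (g.inner (ψ.symm y)) (chartSymmDeriv ψ y) (chartSymmDeriv ψ y)

/-- The coordinate expression `dψ ∘ J ∘ dψ⁻¹` of a field `J` of endomorphisms of the tangent
bundle in the chart `ψ`. -/
def endInChart (J : ∀ q : N, TangentSpace (𝓡 m) q →L[ℝ] TangentSpace (𝓡 m) q)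
    (ψ : OpenPartialHomeomorph N (Coord m)) (y : Coord m) : Coord m →L[ℝ] Coord m :=
  (chartDeriv ψ (ψ.symm y)).comp ((J (ψ.symm y)).comp (chartSymmDeriv ψ y))

variable (n : ℕ) (c : ℝ) (N : Type*) [TopologicalSpace N] [ChartedSpace (Coord (2 * n)) N]
  [IsManifold (𝓡 (2 * n)) ∞ N]

/-- The structure of a Kähler manifold of complex dimension `n` and constant holomorphic sectional
curvature `4c` on a smooth manifold of real dimension `2n`: a Riemannian metric and an orthogonal
almost complex structure that is parallel for the Levi-Civita connection, such that
`⟨R(v, Jv)Jv, v⟩ = 4c |v|⁴` for all tangent vectors `v`. The two tensorial conditions that involve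
the connection are expressed in local coordinates. -/
structure ComplexSpaceForm where
  /-- the Riemannian metric -/
  metric : Bundle.ContMDiffRiemannianMetric (𝓡 (2 * n)) ∞ (Coord (2 * n))
    (fun q : N => TangentSpace (𝓡 (2 * n)) q)
  /-- the complex structure -/
  J : ∀ q : N, TangentSpace (𝓡 (2 * n)) q →L[ℝ] TangentSpace (𝓡 (2 * n)) q
  J_smooth : ContMDiff (𝓡 (2 * n))
    ((𝓡 (2 * n)).prod 𝓘(ℝ, Coord (2 * n) →L[ℝ] Coord (2 * n))) ∞
    (fun q : N => Bundle.TotalSpace.mk' (Coord (2 * n) →L[ℝ] Coord (2 * n))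
      (E := fun q : N => TangentSpace (𝓡 (2 * n)) q →L[ℝ] TangentSpace (𝓡 (2 * n)) q) q (J q))
  J_sq : ∀ (q : N) (v : TangentSpace (𝓡 (2 * n)) q), J q (J q v) = -v
  J_orthogonal : ∀ (q : N) (v w : TangentSpace (𝓡 (2 * n)) q),
    metric.inner q (J q v) (J q w) = metric.inner q v w
  J_parallel : ∀ ψ ∈ IsManifold.maximalAtlas (𝓡 (2 * n)) ∞ N, ∀ y ∈ ψ.target,
    ∀ u v : Coord (2 * n), covEnd (metricInChart metric ψ) (endInChart J ψ) y u v = 0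
  holomorphic_sectional_curvature : ∀ ψ ∈ IsManifold.maximalAtlas (𝓡 (2 * n)) ∞ N, ∀ y ∈ ψ.target,
    ∀ v : Coord (2 * n),
      metricInChart metric ψ y
        (curvature (metricInChart metric ψ) y v (endInChart J ψ y v) (endInChart J ψ y v)) v
      = 4 * c * (metricInChart metric ψ y v v) ^ 2

variable {n c N}

/-- A smooth immersion `f` of an `n`-manifold is Lagrangian if `J` maps each tangent space
`df(T_pM)` (isometrically, as `J` is orthogonal) onto the normal space `df(T_pM)^⊥`. -/
structure IsLagrangianImmersion (S : ComplexSpaceForm n c N)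
    {M : Type*} [TopologicalSpace M] [ChartedSpace (Coord n) M] (f : M → N) : Prop where
  smooth : ContMDiff (𝓡 n) (𝓡 (2 * n)) ∞ f
  immersion : ∀ p : M, Function.Injective (mfderiv (𝓡 n) (𝓡 (2 * n)) f p)
  lagrangian : ∀ (p : M) (w : TangentSpace (𝓡 (2 * n)) (f p)),
    (∃ v : TangentSpace (𝓡 n) p, S.J (f p) (mfderiv (𝓡 n) (𝓡 (2 * n)) f p v) = w) ↔
      ∀ u : TangentSpace (𝓡 n) p,
        S.metric.inner (f p) (mfderiv (𝓡 n) (𝓡 (2 * n)) f p u) w = 0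

end Manifolds

end LagrangianSimons

end

noncomputable section

namespace LagrangianSimons

set_option maxSynthPendingDepth 5

/-! ### Metrics in coordinates -/

section MetricCalculus

variable {m : ℕ}

/-! Pairing the second fundamental form with J dF turns it into a trilinear form C on M,
`cubicForm`. C is totally symmetric: the first two slots commute because the ambient connection is
torsion-free, the last two because the isotropy of dF can be differentiated and J is parallel. Under
this pairing h̃ becomes the trace-free part t of C, and the normal connection becomes the
Levi-Civita connection of M, since J is parallel. Every quantity in the inequality is thus a
contraction of t, C and their covariant derivatives on M. The ambient space enters only through the
Gauss and Codazzi equations, and these need its full curvature tensor, which is recovered from the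
holomorphic sectional curvature by `IsKaehlerCurvature.eq_model`.

Bochner's formula `IsMetricOn.laplacian_cubicInner` gives ½Δ|t|² = |∇t|² + ⟨t, Δt⟩. The trace-free
projection is parallel and pure trace forms are orthogonal to t, so Δt may be replaced by ΔC. By
Codazzi, (∇²_{u,v} C)(i, j, k) is symmetric in v, i, j, k, so (ΔC)_{ijm} = Σ_k (∇²_{k,m} C)_{ijk}.
The Ricci identity `IsMetricOn.cubicHess_comm` exchanges k and m. What remains is the gradient of
the divergence of C, which `simons_second_order` identifies with (n+2)⟨t, ∇T⟩, minus the curvature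
term `curvContraction`.

For the curvature term, C is t plus the symmetric product of the metric with a covector b, where b_a
= n/(n+2) ⟨H, Je_a⟩. By Gauss the curvature of M is the quadratic Gauss expression of t plus the
Kulkarni–Nomizu product of the metric δ with P = B + b⊗b + ½(c + |b|²)δ, where B = t(·, ·, b). With
A_m the slices of t and S their Gram matrix, the contraction equals Σ|[A_m, A_k]|² + |S|² − (n+2)⟨S,
P⟩ − (tr P)|t|². Its terms in c|t|² and |b|²|t|² are exactly those of the inequality. The others are
controlled by |[A_m, A_k]|² ≤ 2(|A_m|²|A_k|² − S_mk²), by ⟨S, b⊗b⟩ = |B|² together with |S + 2B|² ≥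
0, and by |S|² ≤ |t|⁴. This is `IsTracefree.curvContraction_bound`; its argument leaves room, since
it yields the constant (n+6)/4 in place of (n+3)/2. -/

/-- `g` is a smooth Riemannian metric on the open set `V` of coordinate space. -/
structure IsMetricOn (g : Coord m → Coord m →L[ℝ] Coord m →L[ℝ] ℝ) (V : Set (Coord m)) :
    Prop where
  isOpen : IsOpen V
  smooth : ContDiffOn ℝ ∞ g V
  symm : ∀ y ∈ V, ∀ u v, g y u v = g y v u
  pos : ∀ y ∈ V, ∀ u, u ≠ 0 → 0 < g y u u

/-- Bilinearity of a real-valued function of two vectors. -/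
structure IsBilin (β : Coord m → Coord m → ℝ) : Prop where
  add_left : ∀ u u' v, β (u + u') v = β u v + β u' v
  smul_left : ∀ (r : ℝ) u v, β (r • u) v = r * β u v
  add_right : ∀ u v v', β u (v + v') = β u v + β u v'
  smul_right : ∀ (r : ℝ) u v, β u (r • v) = r * β u v

lemma IsBilin.sum_left {β : Coord m → Coord m → ℝ} (h : IsBilin β) {ι : Type*} (s : Finset ι)
    (r : ι → ℝ) (f : ι → Coord m) (v : Coord m) :
    β (∑ i ∈ s, r i • f i) v = ∑ i ∈ s, r i * β (f i) v := by
  let L : Coord m →ₗ[ℝ] ℝ :=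
    { toFun := fun u => β u v
      map_add' := fun a b => h.add_left a b v
      map_smul' := fun a b => h.smul_left a b v }
  have : L (∑ i ∈ s, r i • f i) = ∑ i ∈ s, r i * L (f i) := by simp
  exact this

lemma IsBilin.sum_right {β : Coord m → Coord m → ℝ} (h : IsBilin β) {ι : Type*} (s : Finset ι)
    (r : ι → ℝ) (f : ι → Coord m) (u : Coord m) :
    β u (∑ i ∈ s, r i • f i) = ∑ i ∈ s, r i * β u (f i) := by
  let L : Coord m →ₗ[ℝ] ℝ :=
    { toFun := fun v => β u v
      map_add' := fun a b => h.add_right u a b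
      map_smul' := fun a b => h.smul_right a u b }
  have : L (∑ i ∈ s, r i • f i) = ∑ i ∈ s, r i * L (f i) := by simp
  exact this

lemma isBilin_clm (b : Coord m →L[ℝ] Coord m →L[ℝ] ℝ) : IsBilin (fun u v => b u v) :=
  ⟨by simp, by simp, by simp, by simp⟩

lemma coord_eq_sum (v : Coord m) : v = ∑ i, v i • basisVec i := by
  ext j
  simp [basisVec, Finset.sum_apply, Pi.single_apply]

variable {g : Coord m → Coord m →L[ℝ] Coord m →L[ℝ] ℝ} {V : Set (Coord m)} {x : Coord m}

lemma IsMetricOn.posDef_gram (h : IsMetricOn g V) (hx : x ∈ V) : (gram g x).PosDef := by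
  refine Matrix.PosDef.of_dotProduct_mulVec_pos ?_ ?_
  · ext i j
    simp [gram, h.symm x hx (basisVec j)]
  · intro v hv
    have hne : (WithLp.toLp 2 v : Coord m) ≠ 0 := by
      intro h0
      apply hv
      ext i
      have := congrArg (fun w : Coord m => w i) h0
      simpa using this
    have := h.pos x hx _ hne
    have hb := isBilin_clm (g x)
    rw [coord_eq_sum (WithLp.toLp 2 v : Coord m), hb.sum_left] at this
    simp only [hb.sum_right] at this
    simp only [dotProduct, Matrix.mulVec, gram, star_trivial, Matrix.of_apply]
    refine lt_of_lt_of_eq this (Finset.sum_congr rfl fun i _ => ?_)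
    congr 1
    exact Finset.sum_congr rfl fun j _ => mul_comm _ _

lemma IsMetricOn.isUnit_det (h : IsMetricOn g V) (hx : x ∈ V) : IsUnit (gram g x).det :=
  (Matrix.isUnit_iff_isUnit_det _).1 (h.posDef_gram hx).isUnit

/-- The trace of a bilinear form with respect to the metric `g` at `y`. -/
def metricTrace (g : Coord m → Coord m →L[ℝ] Coord m →L[ℝ] ℝ) (y : Coord m)
    (β : Coord m → Coord m → ℝ) : ℝ :=
  ∑ k, ∑ l, invMetric g y k l * β (basisVec k) (basisVec l)

/-- `e` is an orthonormal frame of the metric `g` at `y`. -/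
structure IsFrame (g : Coord m → Coord m →L[ℝ] Coord m →L[ℝ] ℝ) (y : Coord m)
    (e : Fin m → Coord m) : Prop where
  orthonormal : ∀ a b, g y (e a) (e b) = if a = b then 1 else 0
  expand : ∀ w, w = ∑ a, g y (e a) w • e a
  trace_eq : ∀ β : Coord m → Coord m → ℝ, IsBilin β → metricTrace g y β = ∑ a, β (e a) (e a)

open scoped MatrixOrder in
lemma IsMetricOn.exists_frame (h : IsMetricOn g V) (hx : x ∈ V) : ∃ e, IsFrame g x e := by
  have hP := (h.posDef_gram hx)
  -- Factor the inverse Gram matrix as BᵀB. The rows of B are the coordinates of an orthonormal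
  -- frame, and a trace against g^{kl} becomes a sum over that frame.
  obtain ⟨B, hB⟩ := CStarAlgebra.nonneg_iff_eq_star_mul_self.mp hP.inv.posSemidef.nonneg
  have hB' : (gram g x)⁻¹ = B.transpose * B := by
    rw [hB, Matrix.star_eq_conjTranspose, Matrix.conjTranspose_eq_transpose_of_trivial]
  have hu := h.isUnit_det hx
  have h1 : B * gram g x * B.transpose = 1 := by
    rw [mul_eq_one_comm, ← Matrix.mul_assoc, ← hB', Matrix.nonsing_inv_mul _ hu]
  let e : Fin m → Coord m := fun a => ∑ k, B a k • basisVec k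
  have htr : ∀ β : Coord m → Coord m → ℝ, IsBilin β →
      metricTrace g x β = ∑ a, β (e a) (e a) := by
    intro β hβ
    simp only [e, hβ.sum_left, hβ.sum_right, metricTrace, invMetric, hB', Matrix.mul_apply,
      Matrix.transpose_apply, Finset.sum_mul, Finset.mul_sum]
    conv_lhs =>
      enter [2, k]
      rw [Finset.sum_comm]
    rw [Finset.sum_comm]
    exact Finset.sum_congr rfl fun _ _ => Finset.sum_congr rfl fun _ _ =>
      Finset.sum_congr rfl fun _ _ => by ring
  refine ⟨e, ?_, ?_, htr⟩
  · intro a b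
    have := congrFun (congrFun h1 a) b
    rw [Matrix.one_apply] at this
    rw [← this]
    have hb := isBilin_clm (g x)
    simp only [e, hb.sum_left, hb.sum_right, Matrix.mul_apply, Matrix.transpose_apply, gram,
      Matrix.of_apply, Finset.sum_mul, Finset.mul_sum]
    rw [Finset.sum_comm]
    exact Finset.sum_congr rfl fun _ _ => Finset.sum_congr rfl fun _ _ => by ring
  · intro w
    ext j
    -- The j-th coordinate of the expansion is the trace of u_j g(v, w), so it follows from the
    -- trace formula and g⁻¹g = 1.
    have hj := htr (fun u v => u j * g x v w)
      ⟨by intros; simp; ring, by intros; simp; ring, by intros; simp; ring, by intros; simp; ring⟩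
    have h2 : (∑ a, g x (e a) w • e a) j = ∑ a, e a j * g x (e a) w := by
      simp [mul_comm]
    rw [h2, ← hj]
    simp only [metricTrace]
    conv_rhs =>
      rw [coord_eq_sum w]
    have h3 : ∀ i, ∑ l, invMetric g x j l * gram g x l i = if j = i then 1 else 0 := by
      intro i
      rw [← Matrix.one_apply, ← Matrix.nonsing_inv_mul _ hu, Matrix.mul_apply]
      rfl
    simp only [basisVec, PiLp.single_apply]
    simp only [ite_mul, one_mul, zero_mul, mul_ite, mul_zero]
    rw [Finset.sum_eq_single j (by intro b _ hb; simp [Ne.symm hb]) (by simp)]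
    simp only [if_true, map_sum, map_smul, smul_eq_mul, Finset.mul_sum]
    rw [Finset.sum_comm]
    have h4 : ∀ i, ∑ l, invMetric g x j l * (w i * gram g x l i) = if j = i then w i else 0 := by
      intro i
      have := congrArg (fun t => w i * t) (h3 i)
      simp only [Finset.mul_sum, mul_ite, mul_one, mul_zero] at this
      rw [← this]
      exact Finset.sum_congr rfl fun _ _ => by ring
    exact (Eq.trans (Finset.sum_congr rfl fun i _ => h4 i) (by simp)).symm

end MetricCalculus

/-! ### The Levi-Civita connection and covariant differentiation of metric traces -/

section Christoffel

variable {m : ℕ} {g : Coord m → Coord m →L[ℝ] Coord m →L[ℝ] ℝ} {V : Set (Coord m)} {x : Coord m}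

lemma contDiffOn_det {E : Type*} [NormedAddCommGroup E] [NormedSpace ℝ E] {V : Set E} {k : ℕ}
    {A : E → Matrix (Fin k) (Fin k) ℝ} (h : ∀ i j, ContDiffOn ℝ ∞ (fun y => A y i j) V) :
    ContDiffOn ℝ ∞ (fun y => (A y).det) V := by
  simp only [Matrix.det_apply]
  refine ContDiffOn.sum fun σ _ => ?_
  exact (contDiffOn_prod fun i _ => h _ _).const_smul _

/-- Cramer's rule: the inverse is the adjugate over a nonvanishing determinant, and each entry of
the adjugate is a determinant with one row replaced by constants. -/
lemma IsMetricOn.contDiffOn_invMetric (h : IsMetricOn g V) (i j : Fin m) :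
    ContDiffOn ℝ ∞ (fun y => invMetric g y i j) V := by
  have hgr : ∀ i j, ContDiffOn ℝ ∞ (fun y => gram g y i j) V := fun i j =>
    (h.smooth.clm_apply contDiffOn_const).clm_apply contDiffOn_const
  have hadj : ContDiffOn ℝ ∞ (fun y => (gram g y).adjugate i j) V := by
    simp only [Matrix.adjugate_apply]
    refine contDiffOn_det fun k l => ?_
    by_cases hk : k = j
    · simp only [Matrix.updateRow_apply, hk, if_true]
      exact contDiffOn_const
    · simp only [Matrix.updateRow_apply, hk, if_false]
      exact hgr k l
  have hinv : ContDiffOn ℝ ∞ (fun y => ((gram g y).det)⁻¹) V :=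
    (contDiffOn_det hgr).inv fun y hy => (h.isUnit_det hy).ne_zero
  refine (hinv.mul hadj).congr fun y hy => ?_
  simp [invMetric, Matrix.inv_def]

/-- The lowered Christoffel symbol `w ↦ koszul g x u v w` as a functional. -/
def koszulL (g : Coord m → Coord m →L[ℝ] Coord m →L[ℝ] ℝ) (x u v : Coord m) :
    Coord m →L[ℝ] ℝ :=
  (1 / 2 : ℝ) • (fderiv ℝ g x u v + fderiv ℝ g x v u - ((fderiv ℝ g x).flip u).flip v)

lemma koszulL_apply (u v w : Coord m) : koszulL g x u v w = koszul g x u v w := by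
  simp [koszulL, koszul]

/-- The vector dual to the functional `l` represents `l`. -/
lemma IsMetricOn.inner_sharp (h : IsMetricOn g V) (hx : x ∈ V) (l : Coord m →L[ℝ] ℝ)
    (w : Coord m) :
    g x (∑ k, ∑ j, (invMetric g x k j * l (basisVec j)) • basisVec k) w = l w := by
  obtain ⟨e, he⟩ := h.exists_frame hx
  have h1 := he.trace_eq (fun u v => g x u w * l v)
      ⟨by intros; simp; ring, by intros; simp; ring, by intros; simp; ring, by intros; simp; ring⟩
  have h2 : ∑ a, g x (e a) w * l (e a) = l w := by
    conv_rhs => rw [he.expand w]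
    simp
  rw [h2] at h1
  rw [← h1]
  simp only [metricTrace, map_sum, map_smul, sum_apply, smul_apply, smul_eq_mul]
  exact Finset.sum_congr rfl fun _ _ => Finset.sum_congr rfl fun _ _ => by ring

lemma IsMetricOn.ext_inner (h : IsMetricOn g V) (hx : x ∈ V) {u v : Coord m}
    (huv : ∀ w, g x u w = g x v w) : u = v := by
  by_contra hne
  have := h.pos x hx (u - v) (sub_ne_zero.2 hne)
  rw [(g x).map_sub, sub_apply, huv, sub_self] at this
  exact lt_irrefl _ this

/-- The Christoffel vector is the Koszul functional with its index raised. With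
`IsMetricOn.ext_inner`, identities between Christoffel vectors thereby reduce to the Koszul formula.
-/
lemma IsMetricOn.inner_christoffel (h : IsMetricOn g V) (hx : x ∈ V) (u v w : Coord m) :
    g x (christoffel g x u v) w = koszul g x u v w := by
  rw [← koszulL_apply, ← h.inner_sharp hx (koszulL g x u v)]
  simp only [koszulL_apply, christoffel]

lemma christoffel_add_left (u u' v : Coord m) :
    christoffel g x (u + u') v = christoffel g x u v + christoffel g x u' v := by
  simp only [christoffel, ← Finset.sum_add_distrib, ← add_smul, koszul]
  refine Finset.sum_congr rfl fun _ _ => Finset.sum_congr rfl fun _ _ => ?_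
  congr 1
  simp; ring

lemma christoffel_smul_left (r : ℝ) (u v : Coord m) :
    christoffel g x (r • u) v = r • christoffel g x u v := by
  simp only [christoffel, Finset.smul_sum, smul_smul, koszul]
  refine Finset.sum_congr rfl fun _ _ => Finset.sum_congr rfl fun _ _ => ?_
  congr 1
  simp; ring

lemma christoffel_add_right (u v v' : Coord m) :
    christoffel g x u (v + v') = christoffel g x u v + christoffel g x u v' := by
  simp only [christoffel, ← Finset.sum_add_distrib, ← add_smul, koszul]
  refine Finset.sum_congr rfl fun _ _ => Finset.sum_congr rfl fun _ _ => ?_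
  congr 1
  simp; ring

lemma christoffel_smul_right (r : ℝ) (u v : Coord m) :
    christoffel g x u (r • v) = r • christoffel g x u v := by
  simp only [christoffel, Finset.smul_sum, smul_smul, koszul]
  refine Finset.sum_congr rfl fun _ _ => Finset.sum_congr rfl fun _ _ => ?_
  congr 1
  simp; ring

/-- The Christoffel symbols at `x` as a continuous bilinear map. -/
def christoffelL (g : Coord m → Coord m →L[ℝ] Coord m →L[ℝ] ℝ) (x : Coord m) :
    Coord m →L[ℝ] Coord m →L[ℝ] Coord m :=
  LinearMap.toContinuousLinearMap
    ((LinearMap.toContinuousLinearMap :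
        (Coord m →ₗ[ℝ] Coord m) ≃ₗ[ℝ] (Coord m →L[ℝ] Coord m)).toLinearMap ∘ₗ
      LinearMap.mk₂ ℝ (christoffel g x) christoffel_add_left christoffel_smul_left
        christoffel_add_right christoffel_smul_right)

@[simp]
lemma christoffelL_apply (u v : Coord m) : christoffelL g x u v = christoffel g x u v := rfl

lemma IsMetricOn.contDiffOn_fderiv (h : IsMetricOn g V) : ContDiffOn ℝ ∞ (fderiv ℝ g) V :=
  h.smooth.fderiv_of_isOpen h.isOpen (by simp)

lemma IsMetricOn.contDiffOn_christoffelL (h : IsMetricOn g V) :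
    ContDiffOn ℝ ∞ (christoffelL g) V := by
  refine contDiffOn_clm_apply.2 fun u => contDiffOn_clm_apply.2 fun v => ?_
  simp only [christoffelL_apply, christoffel, koszul]
  refine ContDiffOn.sum fun k _ => ContDiffOn.sum fun l _ => ?_
  have h1 : ∀ a b c : Coord m, ContDiffOn ℝ ∞ (fun y => fderiv ℝ g y a b c) V := fun a b c =>
    ((h.contDiffOn_fderiv.clm_apply contDiffOn_const).clm_apply contDiffOn_const).clm_apply
      contDiffOn_const
  exact ((h.contDiffOn_invMetric k l).mul
    (contDiffOn_const.mul (((h1 _ _ _).add (h1 _ _ _)).sub (h1 _ _ _)))).smul contDiffOn_const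

lemma IsMetricOn.differentiableAt (h : IsMetricOn g V) (hx : x ∈ V) : DifferentiableAt ℝ g x :=
  (h.smooth.contDiffAt (h.isOpen.mem_nhds hx)).differentiableAt (by simp)

lemma IsMetricOn.differentiableAt_christoffelL (h : IsMetricOn g V) (hx : x ∈ V) :
    DifferentiableAt ℝ (christoffelL g) x :=
  (h.contDiffOn_christoffelL.contDiffAt (h.isOpen.mem_nhds hx)).differentiableAt (by simp)

lemma IsMetricOn.fderiv_symm (h : IsMetricOn g V) (hx : x ∈ V) (w u v : Coord m) :
    fderiv ℝ g x w u v = fderiv ℝ g x w v u := by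
  have hd := h.differentiableAt hx
  have key : ∀ a b : Coord m, fderiv ℝ g x w a b = fderiv ℝ (fun y => g y a b) x w := by
    intro a b
    rw [fderiv_clm_apply (by fun_prop) (by fun_prop), fderiv_clm_apply (by fun_prop) (by fun_prop)]
    simp
  rw [key, key]
  congr 1
  refine Filter.EventuallyEq.fderiv_eq ?_
  filter_upwards [h.isOpen.mem_nhds hx] with y hy using h.symm y hy u v

lemma IsMetricOn.christoffel_symm (h : IsMetricOn g V) (hx : x ∈ V) (u v : Coord m) :
    christoffel g x u v = christoffel g x v u := by
  refine h.ext_inner hx fun w => ?_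
  rw [h.inner_christoffel hx, h.inner_christoffel hx]
  simp only [koszul, h.fderiv_symm hx w u v]
  ring

/-- The Levi-Civita connection is metric. -/
lemma IsMetricOn.fderiv_metric (h : IsMetricOn g V) (hx : x ∈ V) (w u v : Coord m) :
    fderiv ℝ g x w u v = g x (christoffel g x w u) v + g x u (christoffel g x w v) := by
  rw [h.symm x hx u, h.inner_christoffel hx, h.inner_christoffel hx]
  simp only [koszul, h.fderiv_symm hx w v u]
  ring

/-- Differentiate g⁻¹g = 1 and multiply by g⁻¹ on the right: d(g⁻¹) = −g⁻¹(dg)g⁻¹. -/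
lemma IsMetricOn.fderiv_invMetric (h : IsMetricOn g V) (hx : x ∈ V) (u : Coord m) (k l : Fin m) :
    fderiv ℝ (fun y => invMetric g y k l) x u =
      - ∑ p, ∑ q, invMetric g x k p * fderiv ℝ g x u (basisVec p) (basisVec q) *
        invMetric g x q l := by
  have hd := h.differentiableAt hx
  have hi : ∀ i j, DifferentiableAt ℝ (fun y => invMetric g y i j) x := fun i j =>
    ((h.contDiffOn_invMetric i j).contDiffAt (h.isOpen.mem_nhds hx)).differentiableAt (by simp)
  have hg : ∀ i j, DifferentiableAt ℝ (fun y => gram g y i j) x := fun i j => by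
    simp only [gram, Matrix.of_apply]
    fun_prop
  have hgd : ∀ i j, fderiv ℝ (fun y => gram g y i j) x u =
      fderiv ℝ g x u (basisVec i) (basisVec j) := by
    intro i j
    simp only [gram, Matrix.of_apply]
    rw [fderiv_clm_apply (by fun_prop) (by fun_prop), fderiv_clm_apply (by fun_prop) (by fun_prop)]
    simp
  have h1 : ∀ q, ∑ p, (fderiv ℝ (fun y => invMetric g y k p) x u * gram g x p q) =
      - ∑ p, invMetric g x k p * fderiv ℝ g x u (basisVec p) (basisVec q) := by
    intro q
    have hc : fderiv ℝ (fun y => ∑ p, invMetric g y k p * gram g y p q) x u = 0 := by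
      have : (fun y => ∑ p, invMetric g y k p * gram g y p q) =ᶠ[nhds x]
          fun _ => (1 : Matrix (Fin m) (Fin m) ℝ) k q := by
        filter_upwards [h.isOpen.mem_nhds hx] with y hy
        rw [← Matrix.nonsing_inv_mul _ (h.isUnit_det hy), Matrix.mul_apply]
        rfl
      rw [this.fderiv_eq]
      simp
    rw [fderiv_fun_sum (fun p _ => (hi k p).fun_mul (hg p q))] at hc
    simp only [sum_apply] at hc
    have h2 : ∀ p, fderiv ℝ (fun y => invMetric g y k p * gram g y p q) x u =
        invMetric g x k p * fderiv ℝ g x u (basisVec p) (basisVec q) +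
          fderiv ℝ (fun y => invMetric g y k p) x u * gram g x p q := by
      intro p
      rw [fderiv_fun_mul (hi k p) (hg p q)]
      simp [hgd, mul_comm]
    simp only [h2, Finset.sum_add_distrib] at hc
    linarith
  have h3 : ∀ p, ∑ q, gram g x p q * invMetric g x q l = if p = l then 1 else 0 := by
    intro p
    rw [← Matrix.one_apply, ← Matrix.mul_nonsing_inv _ (h.isUnit_det hx), Matrix.mul_apply]
    rfl
  calc fderiv ℝ (fun y => invMetric g y k l) x u
      = ∑ p, fderiv ℝ (fun y => invMetric g y k p) x u * if p = l then 1 else 0 := by simp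
    _ = ∑ q, (∑ p, fderiv ℝ (fun y => invMetric g y k p) x u * gram g x p q) *
          invMetric g x q l := by
        simp only [← h3, Finset.mul_sum, Finset.sum_mul]
        rw [Finset.sum_comm]
        exact Finset.sum_congr rfl fun _ _ => Finset.sum_congr rfl fun _ _ => by ring
    _ = _ := by
        simp only [h1]
        rw [Finset.sum_comm, ← Finset.sum_neg_distrib]
        simp only [neg_mul, Finset.sum_mul]

/-- The trace with respect to the metric commutes with covariant differentiation. -/
lemma IsMetricOn.fderiv_metricTrace (h : IsMetricOn g V) (hx : x ∈ V)
    {β : Coord m → Coord m → Coord m → ℝ} (hβ : IsBilin (β x))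
    (hd : ∀ k l, DifferentiableAt ℝ (fun y => β y (basisVec k) (basisVec l)) x) (u : Coord m) :
    fderiv ℝ (fun y => metricTrace g y (β y)) x u = metricTrace g x (covTwoTensor g β x u) := by
  have hi : ∀ i j, DifferentiableAt ℝ (fun y => invMetric g y i j) x := fun i j =>
    ((h.contDiffOn_invMetric i j).contDiffAt (h.isOpen.mem_nhds hx)).differentiableAt (by simp)
  obtain ⟨e, he⟩ := h.exists_frame hx
  have hb1 : IsBilin (fun a b => β x (christoffel g x u a) b) :=
    ⟨by simp [christoffel_add_right, hβ.add_left], by simp [christoffel_smul_right, hβ.smul_left],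
      by simp [hβ.add_right], by simp [hβ.smul_right]⟩
  have hb2 : IsBilin (fun a b => β x a (christoffel g x u b)) :=
    ⟨by simp [hβ.add_left], by simp [hβ.smul_left],
      by simp [christoffel_add_right, hβ.add_right],
      by simp [christoffel_smul_right, hβ.smul_right]⟩
  -- The variation of g⁻¹ must supply the two connection terms of ∇β. It does, because ∂g is a sum
  -- of two Christoffel terms and each can be expanded in an orthonormal frame.
  have key : ∑ k, ∑ l, fderiv ℝ (fun y => invMetric g y k l) x u *
      β x (basisVec k) (basisVec l) =
      - (metricTrace g x (fun a b => β x (christoffel g x u a) b) +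
        metricTrace g x (fun a b => β x a (christoffel g x u b))) := by
    have e1 : ∑ k, ∑ l, fderiv ℝ (fun y => invMetric g y k l) x u * β x (basisVec k) (basisVec l) =
        - metricTrace g x (fun k p => metricTrace g x
            (fun q l => fderiv ℝ g x u p q * β x k l)) := by
      simp only [h.fderiv_invMetric hx, metricTrace, Finset.mul_sum, Finset.sum_mul, neg_mul,
        Finset.sum_neg_distrib]
      congr 1
      refine Finset.sum_congr rfl fun k _ => ?_
      rw [Finset.sum_comm]
      refine Finset.sum_congr rfl fun p _ => ?_
      rw [Finset.sum_comm]
      exact Finset.sum_congr rfl fun _ _ => Finset.sum_congr rfl fun _ _ => by ring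
    have e2 : ∀ k p : Coord m, metricTrace g x (fun q l => fderiv ℝ g x u p q * β x k l) =
        ∑ b, fderiv ℝ g x u p (e b) * β x k (e b) := fun k p =>
      he.trace_eq _ ⟨by intros; simp; ring, by intros; simp; ring,
        by intros; simp [hβ.add_right]; ring, by intros; simp [hβ.smul_right]; ring⟩
    rw [e1, he.trace_eq _ hb1, he.trace_eq _ hb2]
    simp only [e2]
    rw [he.trace_eq]
    · congr 1
      simp only [h.fderiv_metric hx, add_mul, Finset.sum_add_distrib]
      rw [add_comm]
      congr 1
      · rw [Finset.sum_comm]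
        refine Finset.sum_congr rfl fun a _ => ?_
        conv_rhs => rw [he.expand (christoffel g x u (e a)), hβ.sum_left]
      · refine Finset.sum_congr rfl fun a _ => ?_
        conv_rhs => rw [he.expand (christoffel g x u (e a)), hβ.sum_right]
        exact Finset.sum_congr rfl fun b _ => by rw [h.symm x hx]
    · constructor <;> intros <;>
        simp [hβ.add_left, hβ.smul_left, Finset.sum_add_distrib, mul_add, add_mul,
          Finset.mul_sum] <;>
        exact Finset.sum_congr rfl fun _ _ => by ring
  have hcov : metricTrace g x (covTwoTensor g β x u) =
      metricTrace g x (fun a b => fderiv ℝ (fun y => β y a b) x u) -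
      metricTrace g x (fun a b => β x (christoffel g x u a) b) -
        metricTrace g x (fun a b => β x a (christoffel g x u b)) := by
    simp only [metricTrace, covTwoTensor, mul_sub, Finset.sum_sub_distrib]
  have hder : fderiv ℝ (fun y => metricTrace g y (β y)) x u =
      ∑ k, ∑ l, fderiv ℝ (fun y => invMetric g y k l) x u * β x (basisVec k) (basisVec l) +
        metricTrace g x (fun a b => fderiv ℝ (fun y => β y a b) x u) := by
    simp only [metricTrace]
    rw [fderiv_fun_sum fun k _ => DifferentiableAt.fun_sum fun l _ => (hi k l).fun_mul (hd k l)]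
    simp only [sum_apply, ← Finset.sum_add_distrib]
    refine Finset.sum_congr rfl fun k _ => ?_
    rw [fderiv_fun_sum fun l _ => (hi k l).fun_mul (hd k l)]
    simp only [sum_apply]
    refine Finset.sum_congr rfl fun l _ => ?_
    rw [fderiv_fun_mul (hi k l) (hd k l)]
    simp
    ring
  rw [hder, key, hcov]
  ring

end Christoffel

/-! ### Calculus of cubic forms -/

section CubicForms

/-- Trilinear forms on coordinate space. -/
abbrev Cubic (m : ℕ) : Type := Coord m →L[ℝ] Coord m →L[ℝ] Coord m →L[ℝ] ℝ

variable {m : ℕ} {g : Coord m → Coord m →L[ℝ] Coord m →L[ℝ] ℝ} {V : Set (Coord m)} {x : Coord m}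

/-- The derivation action of endomorphisms on trilinear forms, up to sign. -/
def cubicAct : (Coord m →L[ℝ] Coord m) →L[ℝ] Cubic m →L[ℝ] Cubic m :=
  (ContinuousLinearMap.compL ℝ (Coord m) (Coord m) (Coord m →L[ℝ] Coord m →L[ℝ] ℝ)).flip
  + (ContinuousLinearMap.compL ℝ (Coord m) (Coord m →L[ℝ] Coord m →L[ℝ] ℝ)
      (Coord m →L[ℝ] Coord m →L[ℝ] ℝ)).comp
      (ContinuousLinearMap.compL ℝ (Coord m) (Coord m) (Coord m →L[ℝ] ℝ)).flip
  + (ContinuousLinearMap.compL ℝ (Coord m) (Coord m →L[ℝ] Coord m →L[ℝ] ℝ)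
      (Coord m →L[ℝ] Coord m →L[ℝ] ℝ)).comp
      ((ContinuousLinearMap.compL ℝ (Coord m) (Coord m →L[ℝ] ℝ) (Coord m →L[ℝ] ℝ)).comp
        (ContinuousLinearMap.compL ℝ (Coord m) (Coord m) ℝ).flip)

@[simp]
lemma cubicAct_apply (A : Coord m →L[ℝ] Coord m) (P : Cubic m) (a b c : Coord m) :
    cubicAct A P a b c = P (A a) b c + P a (A b) c + P a b (A c) := rfl

/-- The covariant derivative `∇_u P` of a field of trilinear forms. -/
def cubicCov (g : Coord m → Coord m →L[ℝ] Coord m →L[ℝ] ℝ) (P : Coord m → Cubic m)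
    (y u : Coord m) : Cubic m :=
  fderiv ℝ P y u - cubicAct (christoffelL g y u) (P y)

/-- The second covariant derivative `∇²_{u,v} P` of a field of trilinear forms. -/
def cubicHess (g : Coord m → Coord m →L[ℝ] Coord m →L[ℝ] ℝ) (P : Coord m → Cubic m)
    (y u v : Coord m) : Cubic m :=
  cubicCov g (fun z => cubicCov g P z v) y u - cubicCov g P y (christoffel g y u v)

/-- The covariant derivative `∇_u l` of a field of covectors. -/
def covectorCov (g : Coord m → Coord m →L[ℝ] Coord m →L[ℝ] ℝ) (l : Coord m → Coord m →L[ℝ] ℝ)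
    (y u : Coord m) : Coord m →L[ℝ] ℝ :=
  fderiv ℝ l y u - (l y).comp (christoffelL g y u)

lemma fderiv_cubic_apply {P : Coord m → Cubic m} (hP : DifferentiableAt ℝ P x)
    (u a b c : Coord m) : fderiv ℝ (fun y => P y a b c) x u = fderiv ℝ P x u a b c := by
  have h1 : DifferentiableAt ℝ (fun y => P y a) x := hP.clm_apply (by fun_prop)
  have h2 : DifferentiableAt ℝ (fun y => P y a b) x := h1.clm_apply (by fun_prop)
  rw [fderiv_clm_apply h2 (by fun_prop), fderiv_clm_apply h1 (by fun_prop),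
    fderiv_clm_apply hP (by fun_prop)]
  simp

lemma differentiableAt_cubic_apply {P : Coord m → Cubic m} (hP : DifferentiableAt ℝ P x)
    (a b c : Coord m) : DifferentiableAt ℝ (fun y => P y a b c) x :=
  ((hP.clm_apply (by fun_prop)).clm_apply (by fun_prop)).clm_apply (by fun_prop)

lemma cubicCov_apply {P : Coord m → Cubic m} (hP : DifferentiableAt ℝ P x) (u a b c : Coord m) :
    cubicCov g P x u a b c = fderiv ℝ (fun y => P y a b c) x u - P x (christoffel g x u a) b c
      - P x a (christoffel g x u b) c - P x a b (christoffel g x u c) := by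
  rw [fderiv_cubic_apply hP]
  simp only [cubicCov, sub_apply, cubicAct_apply, christoffelL_apply]
  ring

lemma IsMetricOn.contDiffOn_cubicCov (h : IsMetricOn g V) {P : Coord m → Cubic m}
    (hP : ContDiffOn ℝ ∞ P V) (v : Coord m) : ContDiffOn ℝ ∞ (fun y => cubicCov g P y v) V := by
  unfold cubicCov
  refine ((hP.fderiv_of_isOpen h.isOpen (by simp)).clm_apply contDiffOn_const).sub ?_
  exact (contDiffOn_const.clm_apply
    (h.contDiffOn_christoffelL.clm_apply contDiffOn_const)).clm_apply hP

lemma IsMetricOn.differentiableAt_of_contDiffOn (h : IsMetricOn g V) (hx : x ∈ V)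
    {W : Type*} [NormedAddCommGroup W] [NormedSpace ℝ W] {P : Coord m → W}
    (hP : ContDiffOn ℝ ∞ P V) : DifferentiableAt ℝ P x :=
  (hP.contDiffAt (h.isOpen.mem_nhds hx)).differentiableAt (by simp)

lemma cubicCov_add (P : Coord m → Cubic m) (y u u' : Coord m) :
    cubicCov g P y (u + u') = cubicCov g P y u + cubicCov g P y u' := by
  simp only [cubicCov, map_add, add_apply]
  abel

lemma cubicCov_smul (P : Coord m → Cubic m) (y u : Coord m) (r : ℝ) :
    cubicCov g P y (r • u) = r • cubicCov g P y u := by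
  simp only [cubicCov, map_smul, smul_apply, smul_sub]

/-- A is a connection form acting on the fibre through B. Under antisymmetrisation in u and v the
term B(∂_u A v, P) produces the derivative part of the curvature. -/
lemma fderiv_connection {E X W : Type*} [NormedAddCommGroup E] [NormedSpace ℝ E]
    [NormedAddCommGroup X] [NormedSpace ℝ X] [NormedAddCommGroup W] [NormedSpace ℝ W]
    (B : X →L[ℝ] W →L[ℝ] W) {A : E → E →L[ℝ] X} {P : E → W} {x : E}
    (hA : DifferentiableAt ℝ A x) (hP : DifferentiableAt ℝ P x)
    (hP' : DifferentiableAt ℝ (fderiv ℝ P) x) (u v : E) :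
    fderiv ℝ (fun y => fderiv ℝ P y v - B (A y v) (P y)) x u =
      fderiv ℝ (fderiv ℝ P) x u v - (B (A x v) (fderiv ℝ P x u) + B (fderiv ℝ A x u v) (P x)) := by
  have h1 : DifferentiableAt ℝ (fun y => A y v) x := hA.clm_apply (by fun_prop)
  have h2 : DifferentiableAt ℝ (fun y => B (A y v) (P y)) x := by fun_prop
  have h3 : fderiv ℝ (fun y => A y v) x u = fderiv ℝ A x u v := by
    rw [fderiv_clm_apply hA (by fun_prop)]
    simp
  have h4 : fderiv ℝ (fun y => fderiv ℝ P y v) x u = fderiv ℝ (fderiv ℝ P) x u v := by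
    rw [fderiv_clm_apply hP' (by fun_prop)]
    simp
  rw [fderiv_fun_sub (hP'.clm_apply (by fun_prop)) h2, sub_apply, B.fderiv_of_bilinear h1 hP, h4]
  simp [h3]

lemma IsMetricOn.fderiv_cubicCov (h : IsMetricOn g V) (hx : x ∈ V) {P : Coord m → Cubic m}
    (hP : ContDiffOn ℝ ∞ P V) (u v : Coord m) :
    fderiv ℝ (fun y => cubicCov g P y v) x u = fderiv ℝ (fderiv ℝ P) x u v
      - (cubicAct (christoffelL g x v) (fderiv ℝ P x u)
      + cubicAct (fderiv ℝ (christoffelL g) x u v) (P x)) :=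
  fderiv_connection cubicAct (h.differentiableAt_christoffelL hx)
    (h.differentiableAt_of_contDiffOn hx hP)
    (h.differentiableAt_of_contDiffOn hx (hP.fderiv_of_isOpen h.isOpen (m := ∞) (by simp))) u v

lemma fderiv_christoffel_apply (hG : DifferentiableAt ℝ (christoffelL g) x) (u v w : Coord m) :
    fderiv ℝ (fun y => christoffel g y v w) x u = fderiv ℝ (christoffelL g) x u v w := by
  have h1 : DifferentiableAt ℝ (fun y => christoffelL g y v) x := hG.clm_apply (by fun_prop)
  simp only [← christoffelL_apply]
  rw [fderiv_clm_apply h1 (by fun_prop), fderiv_clm_apply hG (by fun_prop)]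
  simp

lemma fderiv_fderiv_comm {W : Type*} [NormedAddCommGroup W] [NormedSpace ℝ W] {P : Coord m → W}
    (hV : IsOpen V) (hx : x ∈ V) (hP : ContDiffOn ℝ ∞ P V) (u v : Coord m) :
    fderiv ℝ (fderiv ℝ P) x u v = fderiv ℝ (fderiv ℝ P) x v u :=
  (hP.contDiffAt (hV.mem_nhds hx)).isSymmSndFDerivAt (by simp; exact WithTop.coe_le_coe.2 le_top) u v

/-- The Ricci identity for trilinear forms. -/
lemma IsMetricOn.cubicHess_comm (h : IsMetricOn g V) (hx : x ∈ V) {P : Coord m → Cubic m}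
    (hP : ContDiffOn ℝ ∞ P V) (u v a b c : Coord m) :
    cubicHess g P x u v a b c - cubicHess g P x v u a b c =
      - (P x (curvature g x u v a) b c + P x a (curvature g x u v b) c
        + P x a b (curvature g x u v c)) := by
  have hG := h.differentiableAt_christoffelL hx
  -- Torsion-freeness makes the two corrections ∇_{Γ(u,v)} P equal, so they cancel.
  simp only [cubicHess, h.christoffel_symm hx v u, sub_apply]
  rw [cubicCov, cubicCov.eq_def g (fun z => cubicCov g P z u), h.fderiv_cubicCov hx hP,
    h.fderiv_cubicCov hx hP, fderiv_fderiv_comm h.isOpen hx hP u v]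
  simp only [cubicCov, curvature, fderiv_christoffel_apply hG, sub_apply, cubicAct_apply,
    christoffelL_apply, map_add, map_sub, add_apply]
  ring

lemma metricTrace_add (y : Coord m) (β γ : Coord m → Coord m → ℝ) :
    metricTrace g y (fun a b => β a b + γ a b) = metricTrace g y β + metricTrace g y γ := by
  simp [metricTrace, mul_add, Finset.sum_add_distrib]

lemma metricTrace_sub (y : Coord m) (β γ : Coord m → Coord m → ℝ) :
    metricTrace g y (fun a b => β a b - γ a b) = metricTrace g y β - metricTrace g y γ := by
  simp [metricTrace, mul_sub, Finset.sum_sub_distrib]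

lemma metricTrace_mul_left (y : Coord m) (r : ℝ) (β : Coord m → Coord m → ℝ) :
    metricTrace g y (fun a b => r * β a b) = r * metricTrace g y β := by
  simp only [metricTrace, Finset.mul_sum]
  exact Finset.sum_congr rfl fun _ _ => Finset.sum_congr rfl fun _ _ => by ring

lemma IsMetricOn.differentiableAt_metricTrace (h : IsMetricOn g V) (hx : x ∈ V)
    {β : Coord m → Coord m → Coord m → ℝ}
    (hd : ∀ k l, DifferentiableAt ℝ (fun y => β y (basisVec k) (basisVec l)) x) :
    DifferentiableAt ℝ (fun y => metricTrace g y (β y)) x := by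
  simp only [metricTrace]
  exact DifferentiableAt.fun_sum fun k _ => DifferentiableAt.fun_sum fun l _ =>
    (h.differentiableAt_of_contDiffOn hx (h.contDiffOn_invMetric k l)).fun_mul (hd k l)

/-- The inner product of trilinear forms induced by the metric at `y`. -/
def cubicInner (g : Coord m → Coord m →L[ℝ] Coord m →L[ℝ] ℝ) (y : Coord m) (P Q : Cubic m) : ℝ :=
  metricTrace g y fun i i' => metricTrace g y fun j j' => metricTrace g y fun k k' =>
    P i j k * Q i' j' k'

/-- Needed to evaluate nested traces in a frame one at a time: each outer trace still sees a
bilinear form. -/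
lemma isBilin_metricTrace {y : Coord m} {β : Coord m → Coord m → Coord m → Coord m → ℝ}
    (h : ∀ j j', IsBilin (fun i i' => β i i' j j')) :
    IsBilin (fun i i' => metricTrace g y fun j j' => β i i' j j') := by
  constructor <;> intros <;>
    simp only [metricTrace, (h _ _).add_left, (h _ _).add_right, (h _ _).smul_left,
      (h _ _).smul_right, mul_add, Finset.sum_add_distrib, Finset.mul_sum, mul_left_comm]

lemma IsFrame.cubicInner_eq {e : Fin m → Coord m} (he : IsFrame g x e) (P Q : Cubic m) :
    cubicInner g x P Q = ∑ a, ∑ b, ∑ c, P (e a) (e b) (e c) * Q (e a) (e b) (e c) := by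
  have h3 : ∀ i i' j j', metricTrace g x (fun k k' => P i j k * Q i' j' k') =
      ∑ c, P i j (e c) * Q i' j' (e c) := fun i i' j j' => he.trace_eq _
    ⟨by intros; simp; ring, by intros; simp; ring, by intros; simp; ring, by intros; simp; ring⟩
  have h2 : ∀ i i', metricTrace g x (fun j j' => metricTrace g x (fun k k' => P i j k * Q i' j' k'))
      = ∑ b, metricTrace g x (fun k k' => P i (e b) k * Q i' (e b) k') := fun i i' =>
    he.trace_eq _ (isBilin_metricTrace fun j j' =>
      ⟨by intros; simp; ring, by intros; simp; ring, by intros; simp; ring, by intros; simp; ring⟩)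
  unfold cubicInner
  rw [he.trace_eq _ (isBilin_metricTrace fun j j' => isBilin_metricTrace fun k k' =>
      ⟨by intros; simp; ring, by intros; simp; ring, by intros; simp; ring, by intros; simp; ring⟩)]
  exact Finset.sum_congr rfl fun a _ => (h2 _ _).trans (Finset.sum_congr rfl fun b _ => h3 _ _ _ _)

/-- Each of the three nested traces absorbs the Christoffel terms of its own pair of slots, by
`IsMetricOn.fderiv_metricTrace`. The ordinary product rule remains. -/
lemma IsMetricOn.fderiv_cubicInner (h : IsMetricOn g V) (hx : x ∈ V) {P Q : Coord m → Cubic m}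
    (hP : DifferentiableAt ℝ P x) (hQ : DifferentiableAt ℝ Q x) (u : Coord m) :
    fderiv ℝ (fun y => cubicInner g y (P y) (Q y)) x u =
      cubicInner g x (cubicCov g P x u) (Q x) + cubicInner g x (P x) (cubicCov g Q x u) := by
  have hpq : ∀ i j k i' j' k', DifferentiableAt ℝ (fun y => P y i j k * Q y i' j' k') x :=
    fun i j k i' j' k' => (differentiableAt_cubic_apply hP _ _ _).fun_mul
      (differentiableAt_cubic_apply hQ _ _ _)
  have d1 : ∀ i j i' j', DifferentiableAt ℝ
      (fun y => metricTrace g y fun k k' => P y i j k * Q y i' j' k') x := fun i j i' j' =>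
    h.differentiableAt_metricTrace hx (β := fun y k k' => P y i j k * Q y i' j' k')
      fun k l => hpq _ _ _ _ _ _
  have d2 : ∀ i i', DifferentiableAt ℝ (fun y => metricTrace g y fun j j' =>
      metricTrace g y fun k k' => P y i j k * Q y i' j' k') x := fun i i' =>
    h.differentiableAt_metricTrace hx
      (β := fun y j j' => metricTrace g y fun k k' => P y i j k * Q y i' j' k')
      fun k l => d1 _ _ _ _
  have b3 : ∀ i j i' j', IsBilin (fun k k' => P x i j k * Q x i' j' k') := fun i j i' j' =>
    ⟨by intros; simp; ring, by intros; simp; ring, by intros; simp; ring, by intros; simp; ring⟩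
  have b2 : ∀ i i', IsBilin (fun j j' => metricTrace g x fun k k' => P x i j k * Q x i' j' k') :=
    fun i i' => isBilin_metricTrace fun k k' =>
      ⟨by intros; simp; ring, by intros; simp; ring, by intros; simp; ring, by intros; simp; ring⟩
  have b1 : IsBilin (fun i i' => metricTrace g x fun j j' => metricTrace g x fun k k' =>
      P x i j k * Q x i' j' k') :=
    isBilin_metricTrace fun j j' => isBilin_metricTrace fun k k' =>
      ⟨by intros; simp; ring, by intros; simp; ring, by intros; simp; ring, by intros; simp; ring⟩
  unfold cubicInner
  rw [h.fderiv_metricTrace hx (β := fun y i i' => metricTrace g y fun j j' =>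
    metricTrace g y fun k k' => P y i j k * Q y i' j' k') b1 (fun k l => d2 _ _),
    ← metricTrace_add]
  congr 1
  funext i i'
  simp only [covTwoTensor]
  rw [h.fderiv_metricTrace hx (β := fun y j j' =>
    metricTrace g y fun k k' => P y i j k * Q y i' j' k') (b2 i i') (fun k l => d1 _ _ _ _)]
  simp only [← metricTrace_sub, ← metricTrace_add]
  congr 1
  funext j j'
  simp only [covTwoTensor]
  rw [h.fderiv_metricTrace hx (β := fun y k k' => P y i j k * Q y i' j' k') (b3 i j i' j')
    (fun k l => hpq _ _ _ _ _ _)]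
  simp only [← metricTrace_sub]
  congr 1
  funext k k'
  simp only [covTwoTensor]
  rw [fderiv_fun_mul (differentiableAt_cubic_apply hP _ _ _)
    (differentiableAt_cubic_apply hQ _ _ _), cubicCov_apply hP, cubicCov_apply hQ]
  simp only [add_apply, smul_apply, smul_eq_mul]
  ring

/-- The trace of a trilinear form over its first two arguments. -/
def cubicTrace (g : Coord m → Coord m →L[ℝ] Coord m →L[ℝ] ℝ) (y : Coord m) (P : Cubic m) :
    Coord m →L[ℝ] ℝ :=
  ∑ k, ∑ l, invMetric g y k l • P (basisVec k) (basisVec l)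

lemma cubicTrace_apply (y : Coord m) (P : Cubic m) (w : Coord m) :
    cubicTrace g y P w = metricTrace g y (fun a b => P a b w) := by
  simp [cubicTrace, metricTrace]

lemma cubicTrace_sub (y : Coord m) (P Q : Cubic m) :
    cubicTrace g y (P - Q) = cubicTrace g y P - cubicTrace g y Q := by
  ext w
  simp [cubicTrace_apply, metricTrace_sub]

lemma IsFrame.cubicTrace_eq {e : Fin m → Coord m} (he : IsFrame g x e) (P : Cubic m)
    (w : Coord m) : cubicTrace g x P w = ∑ a, P (e a) (e a) w := by
  rw [cubicTrace_apply, he.trace_eq _ ⟨by simp, by simp, by simp, by simp⟩]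

lemma IsMetricOn.contDiffOn_cubicTrace (h : IsMetricOn g V) {P : Coord m → Cubic m}
    (hP : ContDiffOn ℝ ∞ P V) : ContDiffOn ℝ ∞ (fun y => cubicTrace g y (P y)) V := by
  unfold cubicTrace
  exact ContDiffOn.sum fun k _ => ContDiffOn.sum fun l _ => (h.contDiffOn_invMetric k l).smul
    ((hP.clm_apply contDiffOn_const).clm_apply contDiffOn_const)

/-- Contraction with the parallel metric absorbs the Christoffel terms of the two traced slots; that
of the free slot is the one in the derivative of a covector. -/
lemma IsMetricOn.covectorCov_cubicTrace (h : IsMetricOn g V) (hx : x ∈ V) {P : Coord m → Cubic m}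
    (hP : ContDiffOn ℝ ∞ P V) (u : Coord m) :
    covectorCov g (fun y => cubicTrace g y (P y)) x u = cubicTrace g x (cubicCov g P x u) := by
  have hPx := h.differentiableAt_of_contDiffOn hx hP
  have hT := h.differentiableAt_of_contDiffOn hx (h.contDiffOn_cubicTrace hP)
  ext w
  have h1 : fderiv ℝ (fun y => cubicTrace g y (P y)) x u w =
      fderiv ℝ (fun y => cubicTrace g y (P y) w) x u := by
    rw [fderiv_clm_apply hT (by fun_prop)]
    simp
  simp only [covectorCov, sub_apply, h1, ContinuousLinearMap.comp_apply, cubicTrace_apply]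
  rw [h.fderiv_metricTrace hx (β := fun y a b => P y a b w) ⟨by simp, by simp, by simp, by simp⟩
    (fun _ _ => differentiableAt_cubic_apply hPx _ _ _), ← metricTrace_sub]
  congr 1
  funext a b
  rw [cubicCov_apply hPx]
  simp [covTwoTensor]

/-- The symmetric product `b(u, v) l(w) + l(u) b(v, w) + l(v) b(u, w)`. -/
def symProd (b : Coord m →L[ℝ] Coord m →L[ℝ] ℝ) (l : Coord m →L[ℝ] ℝ) : Cubic m :=
  ((ContinuousLinearMap.smulRightL ℝ (Coord m) (Coord m →L[ℝ] ℝ)).flip l).comp b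
    + l.smulRight b + (l.smulRight b).flip

@[simp]
lemma symProd_apply (b : Coord m →L[ℝ] Coord m →L[ℝ] ℝ) (l : Coord m →L[ℝ] ℝ)
    (u v w : Coord m) :
    symProd b l u v w = b u v * l w + l u * b v w + l v * b u w := by
  simp [symProd]

lemma IsMetricOn.contDiffOn_symProd (h : IsMetricOn g V) {l : Coord m → Coord m →L[ℝ] ℝ}
    (hl : ContDiffOn ℝ ∞ l V) : ContDiffOn ℝ ∞ (fun y => symProd (g y) (l y)) V := by
  refine contDiffOn_clm_apply.2 fun u => contDiffOn_clm_apply.2 fun v =>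
    contDiffOn_clm_apply.2 fun w => ?_
  simp only [symProd_apply]
  have h1 : ∀ a b, ContDiffOn ℝ ∞ (fun y => g y a b) V := fun a b =>
    (h.smooth.clm_apply contDiffOn_const).clm_apply contDiffOn_const
  have h2 : ∀ a, ContDiffOn ℝ ∞ (fun y => l y a) V := fun a => hl.clm_apply contDiffOn_const
  exact (((h1 _ _).mul (h2 _)).add ((h2 _).mul (h1 _ _))).add ((h2 _).mul (h1 _ _))

/-- The metric is parallel, so only the covector is differentiated. -/
lemma IsMetricOn.cubicCov_symProd (h : IsMetricOn g V) (hx : x ∈ V)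
    {l : Coord m → Coord m →L[ℝ] ℝ} (hl : ContDiffOn ℝ ∞ l V) (u : Coord m) :
    cubicCov g (fun y => symProd (g y) (l y)) x u = symProd (g x) (covectorCov g l x u) := by
  have hg := h.differentiableAt hx
  have hlx := h.differentiableAt_of_contDiffOn hx hl
  ext a b c
  rw [cubicCov_apply (h.differentiableAt_of_contDiffOn hx (h.contDiffOn_symProd hl))]
  have h1 : ∀ p q, DifferentiableAt ℝ (fun y => g y p q) x := fun p q => by fun_prop
  have h2 : ∀ p, DifferentiableAt ℝ (fun y => l y p) x := fun p => by fun_prop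
  have h3 : ∀ p q, fderiv ℝ (fun y => g y p q) x u =
      g x (christoffel g x u p) q + g x p (christoffel g x u q) := by
    intro p q
    rw [← h.fderiv_metric hx, fderiv_clm_apply (by fun_prop) (by fun_prop),
      fderiv_clm_apply (by fun_prop) (by fun_prop)]
    simp
  have h4 : ∀ p, fderiv ℝ (fun y => l y p) x u =
      covectorCov g l x u p + l x (christoffel g x u p) := by
    intro p
    rw [fderiv_clm_apply (by fun_prop) (by fun_prop)]
    simp [covectorCov]
  simp only [symProd_apply]
  rw [fderiv_fun_add (((h1 _ _).fun_mul (h2 _)).fun_add ((h2 _).fun_mul (h1 _ _)))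
      ((h2 _).fun_mul (h1 _ _)),
    fderiv_fun_add ((h1 _ _).fun_mul (h2 _)) ((h2 _).fun_mul (h1 _ _)),
    fderiv_fun_mul (h1 _ _) (h2 _), fderiv_fun_mul (h2 _) (h1 _ _),
    fderiv_fun_mul (h2 _) (h1 _ _)]
  simp only [add_apply, smul_apply, smul_eq_mul, h3, h4]
  ring

/-- The trace-free part of a totally symmetric trilinear form. -/
def tracefreePart (g : Coord m → Coord m →L[ℝ] Coord m →L[ℝ] ℝ) (y : Coord m) (P : Cubic m) :
    Cubic m :=
  P - (1 / ((m : ℝ) + 2)) • symProd (g y) (cubicTrace g y P)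

lemma symProd_sub (b : Coord m →L[ℝ] Coord m →L[ℝ] ℝ) (l l' : Coord m →L[ℝ] ℝ) :
    symProd b (l - l') = symProd b l - symProd b l' := by
  ext u v w
  simp
  ring

lemma tracefreePart_sub (y : Coord m) (P Q : Cubic m) :
    tracefreePart g y (P - Q) = tracefreePart g y P - tracefreePart g y Q := by
  simp only [tracefreePart, cubicTrace_sub, symProd_sub, smul_sub]
  abel

lemma IsMetricOn.contDiffOn_tracefreePart (h : IsMetricOn g V) {P : Coord m → Cubic m}
    (hP : ContDiffOn ℝ ∞ P V) : ContDiffOn ℝ ∞ (fun y => tracefreePart g y (P y)) V :=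
  hP.sub ((h.contDiffOn_symProd (h.contDiffOn_cubicTrace hP)).const_smul _)

/-- The projection is built from a metric trace and a symmetric product with the metric, and both
commute with ∇. -/
lemma IsMetricOn.cubicCov_tracefreePart (h : IsMetricOn g V) (hx : x ∈ V) {P : Coord m → Cubic m}
    (hP : ContDiffOn ℝ ∞ P V) (u : Coord m) :
    cubicCov g (fun y => tracefreePart g y (P y)) x u = tracefreePart g x (cubicCov g P x u) := by
  have hS := h.contDiffOn_symProd (h.contDiffOn_cubicTrace hP)
  have hSx := h.differentiableAt_of_contDiffOn hx hS
  simp only [tracefreePart]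
  rw [← h.covectorCov_cubicTrace hx hP, ← h.cubicCov_symProd hx (h.contDiffOn_cubicTrace hP)]
  simp only [cubicCov]
  rw [fderiv_fun_sub (h.differentiableAt_of_contDiffOn hx hP) (hSx.fun_const_smul _),
    fderiv_fun_const_smul hSx]
  simp only [sub_apply, smul_apply, map_sub, map_smul, smul_sub]
  abel

/-- The first-order statement holds on all of the open set, so it can be differentiated once more.
-/
lemma IsMetricOn.cubicHess_tracefreePart (h : IsMetricOn g V) (hx : x ∈ V)
    {P : Coord m → Cubic m} (hP : ContDiffOn ℝ ∞ P V) (u v : Coord m) :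
    cubicHess g (fun y => tracefreePart g y (P y)) x u v
      = tracefreePart g x (cubicHess g P x u v) := by
  simp only [cubicHess, tracefreePart_sub]
  rw [← h.cubicCov_tracefreePart hx hP, ← h.cubicCov_tracefreePart hx (h.contDiffOn_cubicCov hP v)]
  congr 1
  simp only [cubicCov]
  congr 1
  · congr 1
    refine Filter.EventuallyEq.fderiv_eq ?_
    filter_upwards [h.isOpen.mem_nhds hx] with y hy
    exact h.cubicCov_tracefreePart hy hP v
  · congr 1
    exact h.cubicCov_tracefreePart hx hP v

end CubicForms

/-! ### Algebraic Kähler curvature tensors -/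

section KaehlerCurvature

variable {W : Type*} [AddCommGroup W]

/-- An algebraic Kähler curvature tensor with respect to the complex structure `J`. -/
structure IsKaehlerCurvature (J : W → W) (R : W → W → W → W → ℝ) : Prop where
  J_add : ∀ x y, J (x + y) = J x + J y
  J_sq : ∀ x, J (J x) = -x
  add_fst : ∀ x x' y z w, R (x + x') y z w = R x y z w + R x' y z w
  anti_fst : ∀ x y z w, R x y z w = - R y x z w
  anti_snd : ∀ x y z w, R x y z w = - R x y w z
  bianchi : ∀ x y z w, R x y z w + R y z x w + R z x y w = 0
  J_inv : ∀ x y z w, R x y (J z) (J w) = R x y z w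

variable {J : W → W} {R : W → W → W → W → ℝ}

namespace IsKaehlerCurvature

/-- The classical octahedron argument: combine the four Bianchi identities obtained by rotating the
arguments. -/
lemma pair_symm (h : IsKaehlerCurvature J R) (x y z w : W) : R x y z w = R z w x y := by
  have b1 := h.bianchi x y z w
  have b2 := h.bianchi y z w x
  have b3 := h.bianchi z w x y
  have b4 := h.bianchi w x y z
  linarith [h.anti_snd y z x w, h.anti_snd z x y w, h.anti_fst z x y w, h.anti_fst z x w y,
    h.anti_snd z w y x, h.anti_fst w y z x, h.anti_snd w y x z, h.anti_snd w x y z,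
    h.anti_fst x y w z, h.anti_snd x y w z, h.anti_fst y w x z, h.anti_snd y w x z,
    h.anti_snd y w z x, h.anti_fst w x z y, h.anti_snd x z w y, h.anti_fst x z w y,
    h.anti_fst y z w x, h.anti_snd y z w x]

lemma add_snd (h : IsKaehlerCurvature J R) (x y y' z w : W) :
    R x (y + y') z w = R x y z w + R x y' z w := by
  rw [h.anti_fst, h.add_fst, h.anti_fst x y, h.anti_fst x y']
  ring

lemma add_trd (h : IsKaehlerCurvature J R) (x y z z' w : W) :
    R x y (z + z') w = R x y z w + R x y z' w := by
  rw [h.pair_symm, h.add_fst, h.pair_symm x y z, h.pair_symm x y z']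

lemma add_fth (h : IsKaehlerCurvature J R) (x y z w w' : W) :
    R x y z (w + w') = R x y z w + R x y z w' := by
  rw [h.pair_symm, h.add_snd, h.pair_symm x y z w, h.pair_symm x y z w']

/-- Only additivity is assumed, so the sign rule comes from R(0, …) = 0. No scalar multiplication is
needed below. -/
lemma neg_fst (h : IsKaehlerCurvature J R) (x y z w : W) : R (-x) y z w = - R x y z w := by
  have h0 := h.add_fst 0 0 y z w
  have h1 := h.add_fst x (-x) y z w
  rw [add_neg_cancel] at h1
  rw [add_zero] at h0
  linarith

lemma neg_snd (h : IsKaehlerCurvature J R) (x y z w : W) : R x (-y) z w = - R x y z w := by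
  rw [h.anti_fst, h.neg_fst, h.anti_fst x y]

lemma neg_trd (h : IsKaehlerCurvature J R) (x y z w : W) : R x y (-z) w = - R x y z w := by
  rw [h.pair_symm, h.neg_fst, h.pair_symm x y z w]

lemma neg_fth (h : IsKaehlerCurvature J R) (x y z w : W) : R x y z (-w) = - R x y z w := by
  rw [h.pair_symm, h.neg_snd, h.pair_symm x y z w]

lemma J_neg (h : IsKaehlerCurvature J R) (x : W) : J (-x) = - J x := by
  have h0 := h.J_add 0 0
  have h1 := h.J_add x (-x)
  rw [add_zero, left_eq_add] at h0
  rw [add_neg_cancel, h0] at h1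
  exact (neg_eq_of_add_eq_zero_right h1.symm).symm

lemma J_inv_fst (h : IsKaehlerCurvature J R) (x y z w : W) : R (J x) (J y) z w = R x y z w := by
  rw [h.pair_symm, h.J_inv, h.pair_symm x y]

/-- J-invariance of the first pair, J² = −1 and skew symmetry combine: J moves to the other slot
when the two vectors are exchanged. -/
lemma J_swap (h : IsKaehlerCurvature J R) (x y z w : W) : R y (J x) z w = R x (J y) z w := by
  rw [← h.J_inv_fst, h.J_sq, h.neg_snd, ← h.anti_fst]

lemma J_swap_snd (h : IsKaehlerCurvature J R) (x y z w : W) : R z w y (J x) = R z w x (J y) := by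
  rw [h.pair_symm, h.J_swap, h.pair_symm]

/-- A Kähler curvature tensor of vanishing holomorphic sectional curvature vanishes. -/
theorem eq_zero (h : IsKaehlerCurvature J R) (hol : ∀ x, R x (J x) x (J x) = 0) (x y z w : W) :
    R x y z w = 0 := by
  -- Add the hypothesis at x + y and at x − y. Only the terms quadratic in y survive, and the
  -- symmetries reduce the six of them to two values.
  have polar : ∀ x y, R x (J x) y (J y) + 2 * R x (J y) x (J y) = 0 := by
    intro x y
    have h1 := hol (x + y)
    have h2 := hol (x + -y)
    simp only [h.J_add, h.J_neg, h.add_fst, h.add_snd, h.add_trd, h.add_fth, h.neg_fst, h.neg_snd,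
      h.neg_trd, h.neg_fth, hol] at h1 h2
    have e1 : R y (J x) y (J x) = R x (J y) x (J y) := by rw [h.J_swap, h.J_swap_snd]
    have e2 : R x (J y) y (J x) = R x (J y) x (J y) := by rw [h.J_swap_snd]
    have e3 : R y (J x) x (J y) = R x (J y) x (J y) := by rw [h.J_swap]
    have e4 : R y (J y) x (J x) = R x (J x) y (J y) := h.pair_symm _ _ _ _
    linarith
  -- Bianchi on (x, Jx, y) paired with Jy rewrites the first term of `polar` as R(x, Jy, x, Jy) +
  -- R(x, y, x, y).
  have key : ∀ x y, 3 * R x (J y) x (J y) + R x y x y = 0 := by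
    intro x y
    have b := h.bianchi x (J x) y (J y)
    have e1 : R (J x) y x (J y) = - R x (J y) x (J y) := by rw [h.anti_fst, h.J_swap]
    have e2 : R y x (J x) (J y) = - R x y x y := by rw [h.J_inv, h.anti_fst]
    linarith [polar x y]
  -- Replacing y by Jy exchanges the two unknowns of `key`. The resulting 2×2 system is
  -- nondegenerate, so all sectional curvatures vanish.
  have sec : ∀ x y, R x y x y = 0 := by
    intro x y
    have h1 := key x y
    have h2 := key x (J y)
    rw [h.J_sq, h.neg_snd, h.neg_fth] at h2
    linarith
  have h3 : ∀ x y z, R x y z y = 0 := by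
    intro x y z
    have h1 := sec (x + z) y
    simp only [h.add_fst, h.add_trd, sec] at h1
    linarith [h.pair_symm x y z y]
  -- Polarising twice makes R skew in its second and fourth slots as well. With the other symmetries
  -- and Bianchi, this forces R = 0.
  have h4 : ∀ x y z w, R x y z w = - R x w z y := by
    intro x y z w
    have h1 := h3 x (y + w) z
    simp only [h.add_snd, h.add_fth, h3] at h1
    linarith
  linarith [h.bianchi x y z w, h4 x y z w, h4 y z x w, h4 z x y w, h.anti_fst x w z y,
    h.anti_snd x w z y, h.bianchi x w z y, h.pair_symm x y z w, h.pair_symm y z x w,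
    h.pair_symm z x y w, h.anti_fst y z x w, h.anti_fst z x y w, h.anti_snd y z x w,
    h.anti_snd z x y w, h4 x z y w, h4 x y w z, h.anti_fst x z y w, h.anti_snd x y w z,
    h.pair_symm x w z y, h.anti_fst w x z y]

end IsKaehlerCurvature

/-- The curvature tensor of constant holomorphic sectional curvature `4` determined by an inner
product `b` and a complex structure `J`. -/
def modelCurvature (b : W → W → ℝ) (J : W → W) (x y z w : W) : ℝ :=
  b y z * b x w - b x z * b y w + b (J y) z * b (J x) w - b (J x) z * b (J y) w
    + 2 * (b x (J y) * b (J z) w)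

/-- A Kähler curvature tensor of constant holomorphic sectional curvature `4c` is `c` times the
model tensor. -/
theorem IsKaehlerCurvature.eq_model (h : IsKaehlerCurvature J R) {c : ℝ} {b : W → W → ℝ}
    (b_symm : ∀ x y, b x y = b y x) (b_add : ∀ x x' y, b (x + x') y = b x y + b x' y)
    (b_J : ∀ x y, b (J x) (J y) = b x y)
    (hol : ∀ x, R x (J x) (J x) x = 4 * c * b x x ^ 2) (x y z w : W) :
    R x y z w = c * modelCurvature b J x y z w := by
  have b_neg : ∀ u v, b (-u) v = - b u v := by
    intro u v
    have h0 := b_add 0 0 v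
    have h1 := b_add u (-u) v
    rw [add_neg_cancel] at h1
    rw [add_zero] at h0
    linarith
  have b_neg' : ∀ u v, b u (-v) = - b u v := fun u v => by rw [b_symm, b_neg, b_symm]
  have skew : ∀ u v, b (J u) v = - b u (J v) := fun u v => by
    rw [← b_J (J u) v, h.J_sq, b_neg]
  have anti : ∀ u v, b u (J v) = - b v (J u) := fun u v => by rw [b_symm, skew]
  have diag : ∀ u, b u (J u) = 0 := fun u => by linarith [anti u u]
  -- The difference from the model is again a Kähler curvature tensor, now with vanishing
  -- holomorphic sectional curvature.
  have hS : IsKaehlerCurvature J (fun x y z w => R x y z w - c * modelCurvature b J x y z w) := by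
    refine ⟨h.J_add, h.J_sq, ?_, ?_, ?_, ?_, ?_⟩
    · intro x x' y z w
      simp only [h.add_fst, modelCurvature, h.J_add, b_add]
      ring
    · intro x y z w
      simp only [h.anti_fst x y, modelCurvature, skew]
      rw [anti x y]
      ring
    · intro x y z w
      simp only [h.anti_snd x y z w, modelCurvature, skew]
      rw [anti z w]
      ring
    · intro x y z w
      simp only [modelCurvature, skew]
      rw [b_symm z y, b_symm z x, b_symm x y, anti z x, anti z y, anti y x]
      linear_combination h.bianchi x y z w
    · intro x y z w
      simp only [h.J_inv, modelCurvature, skew, h.J_sq, b_neg, b_neg']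
      ring
  have h1 := hS.eq_zero (fun u => by
    simp only [modelCurvature, h.anti_snd u (J u) u, hol, skew, diag, h.J_sq, b_neg, b_neg']
    ring) x y z w
  linarith

end KaehlerCurvature

/-! ### Commutators of symmetric matrices -/

section Commutator

variable {n : ℕ}

/-- The square of the Frobenius norm. -/
def frobSq (A : Matrix (Fin n) (Fin n) ℝ) : ℝ := ∑ i, ∑ j, A i j ^ 2

lemma frobSq_eq_trace (A : Matrix (Fin n) (Fin n) ℝ) : frobSq A = (A.transpose * A).trace := by
  simp only [frobSq, Matrix.trace, Matrix.mul_apply, Matrix.diag, Matrix.transpose_apply]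
  rw [Finset.sum_comm]
  exact Finset.sum_congr rfl fun _ _ => Finset.sum_congr rfl fun _ _ => by ring

lemma frobSq_conj (A U : Matrix (Fin n) (Fin n) ℝ) (hU : U.transpose * U = 1) :
    frobSq (U * A * U.transpose) = frobSq A := by
  rw [frobSq_eq_trace, frobSq_eq_trace]
  simp only [Matrix.transpose_mul, Matrix.transpose_transpose]
  have : U * (A.transpose * U.transpose) * (U * A * U.transpose) =
      U * (A.transpose * A * U.transpose) := by
    calc _ = U * (A.transpose * (U.transpose * U) * A * U.transpose) := by
          simp only [Matrix.mul_assoc]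
      _ = _ := by rw [hU, Matrix.mul_one]
  rw [this, Matrix.trace_mul_comm, Matrix.mul_assoc, hU, Matrix.mul_one]

lemma frobSq_nonneg (A : Matrix (Fin n) (Fin n) ℝ) : 0 ≤ frobSq A :=
  Finset.sum_nonneg fun _ _ => Finset.sum_nonneg fun _ _ => sq_nonneg _

/-- The entries of the commutator are (d_i − d_j)B_ij, and for i ≠ j one has (d_i − d_j)² ≤ 2(d_i² +
d_j²) ≤ 2|d|². -/
lemma frobSq_commutator_diagonal (d : Fin n → ℝ) (B : Matrix (Fin n) (Fin n) ℝ) :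
    frobSq (Matrix.diagonal d * B - B * Matrix.diagonal d) ≤
      2 * frobSq (Matrix.diagonal d) * frobSq B := by
  have hd : frobSq (Matrix.diagonal d) = ∑ i, d i ^ 2 := by
    simp [frobSq, Matrix.diagonal_apply, ite_pow]
  rw [hd]
  simp only [frobSq, Matrix.sub_apply, Matrix.diagonal_mul, Matrix.mul_diagonal, Finset.mul_sum]
  refine Finset.sum_le_sum fun i _ => Finset.sum_le_sum fun j _ => ?_
  by_cases hij : i = j
  · subst hij
    have : 0 ≤ ∑ i, d i ^ 2 := Finset.sum_nonneg fun _ _ => sq_nonneg _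
    rw [show d i * B i i - B i i * d i = 0 by ring, ← Finset.mul_sum, zero_pow two_ne_zero]
    positivity
  · have h1 : d i ^ 2 + d j ^ 2 ≤ ∑ i, d i ^ 2 := by
      rw [← Finset.sum_pair hij (f := fun i => d i ^ 2)]
      exact Finset.sum_le_sum_of_subset_of_nonneg (Finset.subset_univ _) fun _ _ _ => sq_nonneg _
    rw [← Finset.mul_sum]
    nlinarith [mul_nonneg (sub_nonneg.2 h1) (sq_nonneg (B i j)),
      mul_nonneg (sq_nonneg (d i + d j)) (sq_nonneg (B i j))]

/-- Diagonalise A by an orthogonal matrix. Conjugation respects commutators and the Frobenius norm,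
which reduces to the diagonal case. -/
lemma frobSq_commutator_le {A : Matrix (Fin n) (Fin n) ℝ} (hA : A.transpose = A)
    (B : Matrix (Fin n) (Fin n) ℝ) : frobSq (A * B - B * A) ≤ 2 * frobSq A * frobSq B := by
  have hH : A.IsHermitian := by
    rw [Matrix.IsHermitian, Matrix.conjTranspose_eq_transpose_of_trivial, hA]
  set U : Matrix (Fin n) (Fin n) ℝ := ↑(hH.eigenvectorUnitary) with hUdef
  have hst : star U = U.transpose := by
    rw [Matrix.star_eq_conjTranspose, Matrix.conjTranspose_eq_transpose_of_trivial]
  have h1 : U.transpose * U = 1 := by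
    rw [← hst]
    exact Unitary.coe_star_mul_self _
  have h2 : U * U.transpose = 1 := mul_eq_one_comm.1 h1
  set D := Matrix.diagonal hH.eigenvalues
  have hAD : A = U * D * U.transpose := by
    conv_lhs => rw [hH.spectral_theorem, Unitary.conjStarAlgAut_apply]
    rw [← hst]
    rfl
  set B' := U.transpose * B * U
  have hB : B = U * B' * U.transpose := by
    calc B = (U * U.transpose) * B * (U * U.transpose) := by rw [h2]; simp
      _ = _ := by simp only [B', Matrix.mul_assoc]
  have hmul : ∀ X Y : Matrix (Fin n) (Fin n) ℝ,
      (U * X * U.transpose) * (U * Y * U.transpose) = U * (X * Y) * U.transpose := by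
    intro X Y
    calc _ = U * X * (U.transpose * U) * Y * U.transpose := by simp only [Matrix.mul_assoc]
      _ = _ := by rw [h1]; simp only [Matrix.mul_assoc, Matrix.one_mul]
  rw [hB, hAD, hmul, hmul, ← Matrix.sub_mul, ← Matrix.mul_sub, frobSq_conj _ _ h1,
    frobSq_conj _ _ h1, frobSq_conj _ _ h1]
  exact frobSq_commutator_diagonal _ _

/-- The commutator of `A` and `B` is controlled by the Gram determinant of the pair. -/
lemma frobSq_commutator_le_gram {A : Matrix (Fin n) (Fin n) ℝ} (hA : A.transpose = A)
    (B : Matrix (Fin n) (Fin n) ℝ) :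
    frobSq (A * B - B * A) ≤
      2 * (frobSq A * frobSq B - (∑ i, ∑ j, A i j * B i j) ^ 2) := by
  set s := ∑ i, ∑ j, A i j * B i j with hs
  by_cases h0 : frobSq A = 0
  · have hz : A = 0 := by
      ext i j
      have h1 := (Finset.sum_eq_zero_iff_of_nonneg (fun i _ =>
        Finset.sum_nonneg fun j _ => sq_nonneg (A i j))).1 h0 i (Finset.mem_univ _)
      have h2 := (Finset.sum_eq_zero_iff_of_nonneg (fun j _ => sq_nonneg (A i j))).1 h1 j
        (Finset.mem_univ _)
      simpa using h2
    have hs0 : s = 0 := by simp [hs, hz]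
    rw [hs0, hz]
    simp [frobSq]
  -- Removing from B its projection onto A leaves the commutator unchanged and turns the product of
  -- norms into the Gram determinant.
  · have h1 := frobSq_commutator_le hA (B - (s / frobSq A) • A)
    have h2 : A * (B - (s / frobSq A) • A) - (B - (s / frobSq A) • A) * A = A * B - B * A := by
      simp [Matrix.mul_sub, Matrix.sub_mul]
    have h3 : frobSq (B - (s / frobSq A) • A) =
        frobSq B - 2 * (s / frobSq A) * s + (s / frobSq A) ^ 2 * frobSq A := by
      simp only [frobSq, hs, Finset.mul_sum, ← Finset.sum_sub_distrib, ← Finset.sum_add_distrib]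
      refine Finset.sum_congr rfl fun i _ => Finset.sum_congr rfl fun j _ => ?_
      simp only [Matrix.sub_apply, Matrix.smul_apply, smul_eq_mul]
      ring
    rw [h2, h3] at h1
    refine h1.trans (le_of_eq ?_)
    field_simp
    ring

end Commutator

/-! ### The algebraic inequality -/

section AlgebraicInequality

variable {n : ℕ}

/-- The Kronecker symbol. -/
def kron (i j : Fin n) : ℝ := if i = j then 1 else 0

lemma kron_comm (i j : Fin n) : kron i j = kron j i := by simp [kron, eq_comm]

lemma kron_self (i : Fin n) : kron i i = 1 := by simp [kron]

lemma sum_kron_mul (i : Fin n) (f : Fin n → ℝ) : ∑ j, kron i j * f j = f i := by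
  simp [kron]

lemma sum_kron_mul' (i : Fin n) (f : Fin n → ℝ) : ∑ j, kron j i * f j = f i := by
  simp [kron]

/-- A totally symmetric and trace-free family of components. -/
structure IsTracefree (t : Fin n → Fin n → Fin n → ℝ) : Prop where
  swap12 : ∀ i j k, t i j k = t j i k
  swap23 : ∀ i j k, t i j k = t i k j
  trace : ∀ k, ∑ i, t i i k = 0

/-- The contraction `∑ t_{ijm} (r_{kmil} C_{ljk} + r_{kmjl} C_{ilk} + r_{kmkl} C_{ijl})` of the
derivation action of `r` on `C` with `t`. -/
def curvContraction (r : Fin n → Fin n → Fin n → Fin n → ℝ) (t C : Fin n → Fin n → Fin n → ℝ) :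
    ℝ :=
  ∑ i, ∑ j, ∑ m, t i j m *
    ∑ k, ∑ l, (r k m i l * C l j k + r k m j l * C i l k + r k m k l * C i j l)

/-- The Gram matrix of the slices of `t`. -/
def sliceGram (t : Fin n → Fin n → Fin n → ℝ) (m l : Fin n) : ℝ := ∑ i, ∑ j, t m i j * t l i j

/-- The Kulkarni–Nomizu product of `P` with the Kronecker symbol. -/
def kulkarniNomizu (P : Fin n → Fin n → ℝ) (k m i l : Fin n) : ℝ :=
  kron k l * P m i + kron m i * P k l - kron m l * P k i - kron k i * P m l

/-- The quadratic curvature expression `∑ₐ (C_{mia} C_{kla} - C_{kia} C_{mla})`. -/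
def gaussTerm (C : Fin n → Fin n → Fin n → ℝ) (k m i l : Fin n) : ℝ :=
  ∑ a, (C m i a * C k l a - C k i a * C m l a)

/-- The components `δ_{ij} b_k + δ_{ik} b_j + δ_{jk} b_i`. -/
def kronSym (b : Fin n → ℝ) (i j k : Fin n) : ℝ := kron i j * b k + kron i k * b j + kron j k * b i

variable {t : Fin n → Fin n → Fin n → ℝ}

lemma IsTracefree.swap13 (h : IsTracefree t) (i j k : Fin n) : t i j k = t k j i := by
  rw [h.swap12, h.swap23, h.swap12]

lemma IsTracefree.trace13 (h : IsTracefree t) (j : Fin n) : ∑ i, t i j i = 0 := by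
  rw [← h.trace j]
  exact Finset.sum_congr rfl fun i _ => h.swap23 _ _ _

lemma curvContraction_add (r r' : Fin n → Fin n → Fin n → Fin n → ℝ)
    (t C : Fin n → Fin n → Fin n → ℝ) :
    curvContraction (fun k m i l => r k m i l + r' k m i l) t C =
      curvContraction r t C + curvContraction r' t C := by
  simp only [curvContraction, ← Finset.sum_add_distrib, ← mul_add]
  refine Finset.sum_congr rfl fun i _ => Finset.sum_congr rfl fun j _ =>
    Finset.sum_congr rfl fun m _ => ?_
  congr 1
  exact Finset.sum_congr rfl fun k _ => Finset.sum_congr rfl fun l _ => by ring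

lemma curvContraction_add_right (r : Fin n → Fin n → Fin n → Fin n → ℝ)
    (t C C' : Fin n → Fin n → Fin n → ℝ) :
    curvContraction r t (fun i j k => C i j k + C' i j k) =
      curvContraction r t C + curvContraction r t C' := by
  simp only [curvContraction, ← Finset.sum_add_distrib, ← mul_add]
  refine Finset.sum_congr rfl fun i _ => Finset.sum_congr rfl fun j _ =>
    Finset.sum_congr rfl fun m _ => ?_
  congr 1
  exact Finset.sum_congr rfl fun k _ => Finset.sum_congr rfl fun l _ => by ring

/-- For symmetric `t` the contraction reduces to a sectional and a Ricci term. -/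
lemma IsTracefree.curvContraction_self (h : IsTracefree t)
    (r : Fin n → Fin n → Fin n → Fin n → ℝ) :
    curvContraction r t t =
      2 * (∑ i, ∑ j, ∑ m, t i j m * ∑ k, ∑ l, r k m i l * t l j k) +
        ∑ m, ∑ l, (∑ k, r k m k l) * sliceGram t m l := by
  have h1 : curvContraction r t t =
      ∑ i, ∑ j, ∑ m, t i j m * (∑ k, ∑ l, r k m i l * t l j k) +
      ∑ i, ∑ j, ∑ m, t i j m * (∑ k, ∑ l, r k m j l * t i l k) +
      ∑ i, ∑ j, ∑ m, t i j m * (∑ k, ∑ l, r k m k l * t i j l) := by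
    simp only [curvContraction, ← Finset.sum_add_distrib, ← mul_add]
  have h2 : ∑ i, ∑ j, ∑ m, t i j m * (∑ k, ∑ l, r k m j l * t i l k) =
      ∑ i, ∑ j, ∑ m, t i j m * ∑ k, ∑ l, r k m i l * t l j k := by
    rw [Finset.sum_comm]
    refine Finset.sum_congr rfl fun i _ => Finset.sum_congr rfl fun j _ =>
      Finset.sum_congr rfl fun m _ => ?_
    rw [h.swap12 j i m]
    congr 1
    exact Finset.sum_congr rfl fun k _ => Finset.sum_congr rfl fun l _ => by rw [h.swap12 j l k]
  have h3 : ∑ i, ∑ j, ∑ m, t i j m * (∑ k, ∑ l, r k m k l * t i j l) =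
      ∑ m, ∑ l, (∑ k, r k m k l) * sliceGram t m l := by
    have e1 : ∀ i j m, t i j m * (∑ k, ∑ l, r k m k l * t i j l) =
        ∑ l, (∑ k, r k m k l) * (t m i j * t l i j) := by
      intro i j m
      rw [Finset.sum_comm, Finset.mul_sum]
      refine Finset.sum_congr rfl fun l _ => ?_
      rw [← Finset.sum_mul, h.swap13 m i j, h.swap12 j i m, h.swap13 l i j, h.swap12 j i l]
      ring
    simp only [e1, sliceGram, Finset.mul_sum]
    calc _ = ∑ i, ∑ m, ∑ j, ∑ l, (∑ k, r k m k l) * (t m i j * t l i j) :=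
          Finset.sum_congr rfl fun i _ => Finset.sum_comm
      _ = ∑ m, ∑ i, ∑ j, ∑ l, (∑ k, r k m k l) * (t m i j * t l i j) := Finset.sum_comm
      _ = ∑ m, ∑ i, ∑ l, ∑ j, (∑ k, r k m k l) * (t m i j * t l i j) :=
          Finset.sum_congr rfl fun m _ => Finset.sum_congr rfl fun i _ => Finset.sum_comm
      _ = _ := Finset.sum_congr rfl fun m _ => Finset.sum_comm
  rw [h1, h2, h3]
  ring

/-- With S the slice Gram matrix, the sectional sum is −2⟨S, P⟩, because the other two Kronecker
terms produce traces of t. The Ricci contraction of the product is (2 − n)P − (tr P)δ. Twice the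
first plus the second gives the factor −(n + 2). -/
lemma IsTracefree.curvContraction_kulkarniNomizu (h : IsTracefree t) {P : Fin n → Fin n → ℝ}
    (hP : ∀ i j, P i j = P j i) :
    curvContraction (kulkarniNomizu P) t t =
      - (((n : ℝ) + 2) * ∑ m, ∑ l, sliceGram t m l * P m l
        + (∑ i, P i i) * ∑ m, sliceGram t m m) := by
  have h1 : ∀ i j m, ∑ k, ∑ l, kulkarniNomizu P k m i l * t l j k =
      kron m i * (∑ k, ∑ l, P k l * t l j k) - ∑ k, P k i * t m j k - ∑ l, P m l * t l j i := by
    intro i j m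
    have e1 : ∑ k, ∑ l, kron k l * (P m i * t l j k) = 0 := by
      simp only [sum_kron_mul, ← Finset.mul_sum, h.trace13, mul_zero]
    have e2 : ∑ k, ∑ l, kron m l * (P k i * t l j k) = ∑ k, P k i * t m j k := by
      simp only [sum_kron_mul]
    have e3 : ∑ k, ∑ l, kron k i * (P m l * t l j k) = ∑ l, P m l * t l j i := by
      simp only [← Finset.mul_sum, sum_kron_mul']
    calc _ = ∑ k, ∑ l, kron k l * (P m i * t l j k) + kron m i * (∑ k, ∑ l, P k l * t l j k)
          - ∑ k, ∑ l, kron m l * (P k i * t l j k) - ∑ k, ∑ l, kron k i * (P m l * t l j k) := by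
          simp only [kulkarniNomizu, Finset.mul_sum, ← Finset.sum_add_distrib,
            ← Finset.sum_sub_distrib]
          exact Finset.sum_congr rfl fun k _ => Finset.sum_congr rfl fun l _ => by ring
      _ = _ := by rw [e1, e2, e3]; ring
  have h2 : ∑ i, ∑ j, ∑ m, t i j m * (kron m i * (∑ k, ∑ l, P k l * t l j k)) = 0 := by
    have : ∀ i j, ∑ m, t i j m * (kron m i * (∑ k, ∑ l, P k l * t l j k)) =
        t i j i * (∑ k, ∑ l, P k l * t l j k) := by
      intro i j
      rw [← sum_kron_mul' i (fun m => t i j m * (∑ k, ∑ l, P k l * t l j k))]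
      exact Finset.sum_congr rfl fun m _ => by ring
    simp only [this]
    rw [Finset.sum_comm]
    simp only [← Finset.sum_mul, h.trace13, zero_mul, Finset.sum_const_zero]
  have h3 : ∑ i, ∑ j, ∑ m, t i j m * (∑ k, P k i * t m j k) =
      ∑ m, ∑ l, sliceGram t m l * P m l := by
    simp only [sliceGram, Finset.sum_mul, Finset.mul_sum]
    refine Finset.sum_congr rfl fun i _ => ?_
    calc _ = ∑ j, ∑ k, ∑ m, t i j m * (P k i * t m j k) :=
          Finset.sum_congr rfl fun j _ => Finset.sum_comm
      _ = ∑ k, ∑ j, ∑ m, t i j m * (P k i * t m j k) := Finset.sum_comm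
      _ = _ := by
          refine Finset.sum_congr rfl fun k _ => Finset.sum_congr rfl fun j _ =>
            Finset.sum_congr rfl fun m _ => ?_
          rw [h.swap13 m j k, hP k i]
          ring
  have h4 : ∑ i, ∑ j, ∑ m, t i j m * (∑ l, P m l * t l j i) =
      ∑ m, ∑ l, sliceGram t m l * P m l := by
    rw [← h3]
    calc _ = ∑ j, ∑ i, ∑ m, t i j m * (∑ l, P m l * t l j i) := Finset.sum_comm
      _ = ∑ j, ∑ m, ∑ i, t i j m * (∑ l, P m l * t l j i) :=
          Finset.sum_congr rfl fun j _ => Finset.sum_comm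
      _ = ∑ m, ∑ j, ∑ i, t i j m * (∑ l, P m l * t l j i) := Finset.sum_comm
      _ = _ := by
          refine Finset.sum_congr rfl fun m _ => Finset.sum_congr rfl fun j _ =>
            Finset.sum_congr rfl fun i _ => ?_
          rw [h.swap13 i j m]
          congr 1
          exact Finset.sum_congr rfl fun l _ => by rw [hP, h.swap13 l j i]
  have h5 : ∀ m l, ∑ k, kulkarniNomizu P k m k l =
      (2 - (n : ℝ)) * P m l - kron m l * ∑ k, P k k := by
    intro m l
    simp only [kulkarniNomizu, Finset.sum_add_distrib, Finset.sum_sub_distrib, sum_kron_mul',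
      sum_kron_mul, kron_self, ← Finset.mul_sum, Finset.sum_const, Finset.card_univ,
      Fintype.card_fin, nsmul_eq_mul, one_mul]
    ring
  have h6 : ∑ m, ∑ l, kron m l * (∑ k, P k k) * sliceGram t m l =
      (∑ i, P i i) * ∑ m, sliceGram t m m := by
    simp only [mul_assoc, sum_kron_mul, ← Finset.mul_sum]
  rw [h.curvContraction_self]
  simp only [h1, h5, mul_sub, sub_mul, Finset.sum_sub_distrib, h2, h3, h4, h6]
  have h7 : ∑ m, ∑ l, (2 * P m l * sliceGram t m l) = 2 * ∑ m, ∑ l, sliceGram t m l * P m l := by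
    simp only [Finset.mul_sum]
    exact Finset.sum_congr rfl fun k _ => Finset.sum_congr rfl fun l _ => by ring
  have h8 : ∑ m, ∑ l, ((n : ℝ) * P m l * sliceGram t m l) =
      n * ∑ m, ∑ l, sliceGram t m l * P m l := by
    simp only [Finset.mul_sum]
    exact Finset.sum_congr rfl fun k _ => Finset.sum_congr rfl fun l _ => by ring
  rw [h7, h8]
  ring

/-- The slice `(t_{mij})_{ij}`. -/
def slice (t : Fin n → Fin n → Fin n → ℝ) (m : Fin n) : Matrix (Fin n) (Fin n) ℝ :=
  Matrix.of fun i j => t m i j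

/-- For fixed k and m the Gauss term is the commutator [A_m, A_k] of slices, and its Ricci
contraction is the slice Gram matrix because t is trace-free. -/
lemma IsTracefree.curvContraction_gaussTerm (h : IsTracefree t) :
    curvContraction (gaussTerm t) t t =
      ∑ m, ∑ k, frobSq (slice t m * slice t k - slice t k * slice t m)
        + ∑ m, ∑ l, sliceGram t m l ^ 2 := by
  have hK : ∀ k m i l, gaussTerm t k m i l =
      (slice t m * slice t k - slice t k * slice t m) i l := by
    intro k m i l
    simp only [gaussTerm, slice, Matrix.sub_apply, Matrix.mul_apply, Matrix.of_apply,
      Finset.sum_sub_distrib]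
    congr 1 <;> refine Finset.sum_congr rfl fun a _ => ?_
    · rw [h.swap23 k l a]
    · rw [h.swap23 m l a]
  have h1 : ∑ i, ∑ j, ∑ m, t i j m * (∑ k, ∑ l, gaussTerm t k m i l * t l j k) =
      ∑ m, ∑ k, ∑ i, ∑ l, (slice t m * slice t k) i l * gaussTerm t k m i l := by
    have e1 : ∀ m k i l, (slice t m * slice t k) i l * gaussTerm t k m i l =
        ∑ j, t i j m * (gaussTerm t k m i l * t l j k) := by
      intro m k i l
      simp only [Matrix.mul_apply, slice, Matrix.of_apply, Finset.sum_mul]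
      refine Finset.sum_congr rfl fun j _ => ?_
      rw [h.swap13 i j m, h.swap13 l j k, h.swap23 m j i]
      rw [h.swap23 k j l, h.swap23 k l j, h.swap23 m i j]
      rw [h.swap23 m j i]
      ring
    simp only [e1, Finset.mul_sum]
    calc _ = ∑ i, ∑ m, ∑ j, ∑ k, ∑ l, t i j m * (gaussTerm t k m i l * t l j k) :=
          Finset.sum_congr rfl fun i _ => Finset.sum_comm
      _ = ∑ m, ∑ i, ∑ j, ∑ k, ∑ l, t i j m * (gaussTerm t k m i l * t l j k) := Finset.sum_comm
      _ = ∑ m, ∑ i, ∑ k, ∑ j, ∑ l, t i j m * (gaussTerm t k m i l * t l j k) :=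
          Finset.sum_congr rfl fun m _ => Finset.sum_congr rfl fun i _ => Finset.sum_comm
      _ = ∑ m, ∑ k, ∑ i, ∑ j, ∑ l, t i j m * (gaussTerm t k m i l * t l j k) :=
          Finset.sum_congr rfl fun m _ => Finset.sum_comm
      _ = _ := Finset.sum_congr rfl fun m _ => Finset.sum_congr rfl fun k _ =>
          Finset.sum_congr rfl fun i _ => Finset.sum_comm
  -- Exchanging m and k reverses the commutator. Averaging both forms therefore replaces the product
  -- A_m A_k by half the commutator.
  have h2 : ∑ m, ∑ k, ∑ i, ∑ l, (slice t m * slice t k) i l * gaussTerm t k m i l =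
      ∑ m, ∑ k, ∑ i, ∑ l, -((slice t k * slice t m) i l * gaussTerm t k m i l) := by
    rw [Finset.sum_comm]
    refine Finset.sum_congr rfl fun m _ => Finset.sum_congr rfl fun k _ =>
      Finset.sum_congr rfl fun i _ => Finset.sum_congr rfl fun l _ => ?_
    rw [hK, hK, Matrix.sub_apply, Matrix.sub_apply]
    ring
  have h3 : 2 * ∑ m, ∑ k, ∑ i, ∑ l, (slice t m * slice t k) i l * gaussTerm t k m i l =
      ∑ m, ∑ k, frobSq (slice t m * slice t k - slice t k * slice t m) := by
    rw [two_mul]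
    nth_rewrite 2 [h2]
    simp only [← Finset.sum_add_distrib, frobSq, hK]
    refine Finset.sum_congr rfl fun m _ => Finset.sum_congr rfl fun k _ =>
      Finset.sum_congr rfl fun i _ => Finset.sum_congr rfl fun l _ => ?_
    rw [Matrix.sub_apply]
    ring
  have h4 : ∀ m l, ∑ k, gaussTerm t k m k l = sliceGram t m l := by
    intro m l
    simp only [gaussTerm, Finset.sum_sub_distrib]
    have : ∑ k, ∑ a, t k k a * t m l a = 0 := by
      rw [Finset.sum_comm]
      simp only [← Finset.sum_mul, h.trace, zero_mul, Finset.sum_const_zero]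
    rw [this, sub_zero, sliceGram]
    exact Finset.sum_congr rfl fun k _ => Finset.sum_congr rfl fun a _ => by rw [h.swap12 k l a]
  rw [h.curvContraction_self, h1, h3]
  simp only [h4, sq]

/-- In the expansion, every term containing a Kronecker symbol assembles into the Kulkarni–Nomizu
product. The terms b·t without one cancel between the two halves by the total symmetry of t. The
factor 1/2 appears because the product of δ with itself counts each term twice. -/
lemma gaussTerm_add_kronSym (h : IsTracefree t) (b : Fin n → ℝ) (k m i l : Fin n) :
    gaussTerm (fun i j k => t i j k + kronSym b i j k) k m i l =
      gaussTerm t k m i l + kulkarniNomizu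
        (fun i j => ∑ a, t i j a * b a + b i * b j + (1 / 2) * (∑ a, b a ^ 2) * kron i j)
        k m i l := by
  have key : ∀ p q r s, ∑ a, (t p q a + kronSym b p q a) * (t r s a + kronSym b r s a) =
      ∑ a, t p q a * t r s a + kron r s * (∑ a, t p q a * b a) + kron p q * (∑ a, t r s a * b a)
      + (b s * t p q r + b r * t p q s + b q * t r s p + b p * t r s q)
      + kron p q * kron r s * (∑ a, b a ^ 2) + 2 * kron p q * b r * b s
      + 2 * kron r s * b p * b q + b q * (kron p r * b s + kron p s * b r)
      + b p * (kron q r * b s + kron q s * b r) := by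
    intro p q r s
    calc _ = ∑ a, t p q a * t r s a + kron r s * (∑ a, t p q a * b a)
        + kron p q * (∑ a, t r s a * b a)
        + (b s * ∑ a, kron r a * t p q a + b r * ∑ a, kron s a * t p q a
          + b q * ∑ a, kron p a * t r s a + b p * ∑ a, kron q a * t r s a)
        + kron p q * kron r s * (∑ a, b a ^ 2) + kron p q * (∑ a, kron r a * b a) * b s
        + kron p q * (∑ a, kron s a * b a) * b r
        + kron r s * (∑ a, kron p a * b a) * b q + kron r s * (∑ a, kron q a * b a) * b p
        + b q * ((∑ a, kron p a * kron r a) * b s + (∑ a, kron p a * kron s a) * b r)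
        + b p * ((∑ a, kron q a * kron r a) * b s + (∑ a, kron q a * kron s a) * b r) := by
          simp only [Finset.mul_sum, Finset.sum_mul, ← Finset.sum_add_distrib, kronSym]
          exact Finset.sum_congr rfl fun a _ => by ring
      _ = _ := by
          simp only [sum_kron_mul, kron_comm r p, kron_comm s p, kron_comm r q, kron_comm s q]
          ring
  simp only [gaussTerm, Finset.sum_sub_distrib, key, kulkarniNomizu]
  rw [kron_comm k m, kron_comm i l, kron_comm i k, kron_comm i m,
    h.swap23 m i k, h.swap23 m i l, h.swap23 k l m, h.swap23 k l i, h.swap23 k i m,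
    h.swap12 k m i, h.swap23 m l k, h.swap12 m k l]
  ring

/-- The pure trace part does not contribute to the contraction. -/
lemma IsTracefree.curvContraction_kronSym (h : IsTracefree t)
    {r : Fin n → Fin n → Fin n → Fin n → ℝ} (h12 : ∀ k m i l, r k m i l = - r m k i l)
    (h34 : ∀ k m i l, r k m i l = - r k m l i) (b : Fin n → ℝ) :
    curvContraction r t (kronSym b) = 0 := by
  have e1 : ∀ i j m, ∑ k, ∑ l, (r k m i l * kronSym b l j k + r k m j l * kronSym b i l k
      + r k m k l * kronSym b i j l) =
      ∑ l, r j m i l * b l + ∑ l, r i m j l * b l + kron i j * ∑ k, ∑ l, r k m k l * b l := by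
    intro i j m
    calc _ = (∑ k, b k * ∑ l, kron j l * r k m i l + b j * ∑ k, ∑ l, kron k l * r k m i l
          + ∑ k, kron j k * ∑ l, r k m i l * b l) +
          (∑ k, b k * ∑ l, kron i l * r k m j l + ∑ k, kron i k * ∑ l, r k m j l * b l
          + b i * ∑ k, ∑ l, kron k l * r k m j l) +
          (kron i j * ∑ k, ∑ l, r k m k l * b l + b j * ∑ k, ∑ l, kron i l * r k m k l
          + b i * ∑ k, ∑ l, kron j l * r k m k l) := by
          simp only [Finset.mul_sum, ← Finset.sum_add_distrib, kronSym]
          refine Finset.sum_congr rfl fun k _ => Finset.sum_congr rfl fun l _ => ?_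
          rw [kron_comm l j, kron_comm l k]
          ring
      _ = (∑ k, (b k * (r k m i j + r k m j i) + b j * (r k m i k + r k m k i)
            + b i * (r k m j k + r k m k j))) + (∑ l, r j m i l * b l + ∑ l, r i m j l * b l
            + kron i j * ∑ k, ∑ l, r k m k l * b l) := by
          simp only [sum_kron_mul]
          simp only [mul_add, Finset.sum_add_distrib, ← Finset.mul_sum]
          ring
      _ = _ := by
          have : ∀ k, b k * (r k m i j + r k m j i) + b j * (r k m i k + r k m k i)
            + b i * (r k m j k + r k m k j) = 0 := by
            intro k
            rw [h34 k m i j, h34 k m i k, h34 k m j k]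
            ring
          simp only [this, Finset.sum_const_zero, zero_add]
  -- Here t is symmetric in j, m while r is antisymmetric in them. The next sum is the same with i
  -- and j exchanged, and the last vanishes by the trace condition.
  have e2 : ∑ i, ∑ j, ∑ m, t i j m * ∑ l, r j m i l * b l = 0 := by
    refine Finset.sum_eq_zero fun i _ => ?_
    have : ∑ j, ∑ m, t i j m * ∑ l, r j m i l * b l =
        - ∑ j, ∑ m, t i j m * ∑ l, r j m i l * b l := by
      conv_lhs => rw [Finset.sum_comm]
      simp only [← Finset.sum_neg_distrib]
      refine Finset.sum_congr rfl fun j _ => Finset.sum_congr rfl fun m _ => ?_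
      rw [h.swap23 i m j, ← mul_neg, ← Finset.sum_neg_distrib]
      congr 1
      exact Finset.sum_congr rfl fun l _ => by rw [h12 m j i l]; ring
    linarith
  have e3 : ∑ i, ∑ j, ∑ m, t i j m * ∑ l, r i m j l * b l = 0 := by
    rw [← e2, Finset.sum_comm]
    exact Finset.sum_congr rfl fun i _ => Finset.sum_congr rfl fun j _ =>
      Finset.sum_congr rfl fun m _ => by rw [h.swap12]
  have e4 : ∑ i, ∑ j, ∑ m, t i j m * (kron i j * ∑ k, ∑ l, r k m k l * b l) = 0 := by
    have : ∀ i j, ∑ m, t i j m * (kron i j * ∑ k, ∑ l, r k m k l * b l) =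
        kron i j * ∑ m, t i j m * ∑ k, ∑ l, r k m k l * b l := by
      intro i j
      rw [Finset.mul_sum]
      exact Finset.sum_congr rfl fun m _ => by ring
    simp only [this, sum_kron_mul]
    rw [Finset.sum_comm]
    simp only [← Finset.sum_mul, h.trace, zero_mul, Finset.sum_const_zero]
  simp only [curvContraction, e1]
  simp only [mul_add, Finset.sum_add_distrib, e2, e3, e4, add_zero]

lemma frobSq_slice (t : Fin n → Fin n → Fin n → ℝ) (m : Fin n) :
    frobSq (slice t m) = sliceGram t m m := by
  simp [frobSq, slice, sliceGram, sq]

/-- Sum the Gram bound over all pairs of slices: Σ S_mm S_kk is the square of the trace of S. -/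
lemma IsTracefree.sum_commutator_le (h : IsTracefree t) :
    ∑ m, ∑ k, frobSq (slice t m * slice t k - slice t k * slice t m) ≤
      2 * ((∑ m, sliceGram t m m) ^ 2 - ∑ m, ∑ l, sliceGram t m l ^ 2) := by
  have hs : ∀ m, (slice t m).transpose = slice t m := by
    intro m
    ext i j
    simp [slice, h.swap23 m i j]
  have : 2 * ((∑ m, sliceGram t m m) ^ 2 - ∑ m, ∑ l, sliceGram t m l ^ 2) =
      ∑ m, ∑ k, 2 * (sliceGram t m m * sliceGram t k k - sliceGram t m k ^ 2) := by
    rw [sq, Finset.sum_mul_sum]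
    simp only [← Finset.mul_sum, Finset.sum_sub_distrib]
  rw [this]
  refine Finset.sum_le_sum fun m _ => Finset.sum_le_sum fun k _ => ?_
  rw [← frobSq_slice, ← frobSq_slice]
  exact frobSq_commutator_le_gram (hs m) (slice t k)

/-- The lower bound for the curvature term in Simons' identity. -/
theorem IsTracefree.curvContraction_bound (h : IsTracefree t) (hn : 2 ≤ n) (c : ℝ)
    (b : Fin n → ℝ) {r : Fin n → Fin n → Fin n → Fin n → ℝ} {C : Fin n → Fin n → Fin n → ℝ}
    (hC : ∀ i j k, C i j k = t i j k + kronSym b i j k)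
    (hr : ∀ k m i l, r k m i l =
      c * (kron m i * kron k l - kron k i * kron m l) + gaussTerm C k m i l) :
    - curvContraction r t C ≥
      ((n : ℝ) + 1) * c * (∑ m, sliceGram t m m)
        + ((n : ℝ) + 2) * (∑ a, b a ^ 2) * (∑ m, sliceGram t m m)
        - ((n : ℝ) + 3) / 2 * (∑ m, sliceGram t m m) ^ 2 := by
  obtain rfl : C = fun i j k => t i j k + kronSym b i j k := by
    funext i j k
    exact hC i j k
  have h12 : ∀ k m i l, r k m i l = - r m k i l := by
    intro k m i l
    simp only [hr, gaussTerm, Finset.sum_sub_distrib]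
    ring
  obtain ⟨B, hB⟩ : ∃ B : Fin n → Fin n → ℝ, ∀ i j, B i j = ∑ a, t i j a * b a := ⟨_, fun _ _ => rfl⟩
  -- The space form part is the Kulkarni–Nomizu product of ½cδ with δ, so c simply joins |b|² in the
  -- multiple of δ.
  have hr' : r = fun k m i l => gaussTerm t k m i l + kulkarniNomizu
      (fun i j => B i j + b i * b j + (1 / 2) * (c + ∑ a, b a ^ 2) * kron i j)
        k m i l := by
    funext k m i l
    rw [hr, gaussTerm_add_kronSym h]
    simp only [kulkarniNomizu, hB]
    ring
  have hBs : ∀ i j, B i j = B j i := fun i j => by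
    rw [hB, hB]
    exact Finset.sum_congr rfl fun a _ => by rw [h.swap12]
  have h34 : ∀ k m i l, r k m i l = - r k m l i := by
    intro k m i l
    simp only [hr', gaussTerm, kulkarniNomizu, Finset.sum_sub_distrib]
    have e1 : ∀ p q, ∑ a, t p l a * t q i a = ∑ a, t q i a * t p l a := fun p q =>
      Finset.sum_congr rfl fun a _ => mul_comm _ _
    rw [e1 m k, e1 k m]
    ring
  rw [curvContraction_add_right, h.curvContraction_kronSym h12 h34, add_zero]
  rw [hr', curvContraction_add, h.curvContraction_gaussTerm, h.curvContraction_kulkarniNomizu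
    (fun i j => by rw [kron_comm i j, hBs i j]; ring)]
  set N := ∑ m, sliceGram t m m with hN
  set q := ∑ m, ∑ l, sliceGram t m l ^ 2 with hq
  have hcom := h.sum_commutator_le
  have hN0 : 0 ≤ N := Finset.sum_nonneg fun m _ => by
    rw [← frobSq_slice]
    exact frobSq_nonneg _
  have hq1 : q ≤ N ^ 2 := by
    have : 0 ≤ ∑ m, ∑ k, frobSq (slice t m * slice t k - slice t k * slice t m) :=
      Finset.sum_nonneg fun _ _ => Finset.sum_nonneg fun _ _ => frobSq_nonneg _
    linarith
  -- The b⊗b part of P contributes exactly |B|², which is what allows ⟨S, B⟩ to be completed to a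
  -- square.
  have hSb : ∑ m, ∑ l, sliceGram t m l * (b m * b l) = ∑ i, ∑ j, B i j ^ 2 := by
    have e1 : ∀ i j, B i j ^ 2 = ∑ m, ∑ l, t m i j * t l i j * (b m * b l) := by
      intro i j
      rw [sq, hB, Finset.sum_mul_sum]
      refine Finset.sum_congr rfl fun m _ => Finset.sum_congr rfl fun l _ => ?_
      rw [h.swap13 m i j, h.swap12 j i m, h.swap13 l i j, h.swap12 j i l]
      ring
    simp only [e1, sliceGram, Finset.sum_mul]
    calc _ = ∑ m, ∑ i, ∑ l, ∑ j, t m i j * t l i j * (b m * b l) :=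
          Finset.sum_congr rfl fun m _ => Finset.sum_comm
      _ = ∑ i, ∑ m, ∑ l, ∑ j, t m i j * t l i j * (b m * b l) := Finset.sum_comm
      _ = ∑ i, ∑ m, ∑ j, ∑ l, t m i j * t l i j * (b m * b l) :=
          Finset.sum_congr rfl fun i _ => Finset.sum_congr rfl fun m _ => Finset.sum_comm
      _ = _ := Finset.sum_congr rfl fun i _ => Finset.sum_comm
  have hSP : ∑ m, ∑ l, sliceGram t m l *
      (B m l + b m * b l + (1 / 2) * (c + ∑ a, b a ^ 2) * kron m l) =
      ∑ m, ∑ l, sliceGram t m l * B m l + ∑ i, ∑ j, B i j ^ 2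
        + (1 / 2) * (c + ∑ a, b a ^ 2) * N := by
    rw [← hSb, hN]
    have : ∀ m, sliceGram t m m = ∑ l, kron m l * sliceGram t m l := fun m => by
      rw [sum_kron_mul]
    simp only [this, Finset.mul_sum, ← Finset.sum_add_distrib]
    exact Finset.sum_congr rfl fun m _ => Finset.sum_congr rfl fun l _ => by ring
  have htrP : ∑ i, (B i i + b i * b i + (1 / 2) * (c + ∑ a, b a ^ 2) * kron i i) =
      ∑ a, b a ^ 2 + (n : ℝ) / 2 * (c + ∑ a, b a ^ 2) := by
    have : ∑ i, B i i = 0 := by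
      simp only [hB]
      rw [Finset.sum_comm]
      simp only [← Finset.sum_mul, h.trace, zero_mul, Finset.sum_const_zero]
    simp only [Finset.sum_add_distrib, this, kron_self, mul_one, Finset.sum_const,
      Finset.card_univ, Fintype.card_fin, nsmul_eq_mul, ← sq]
    ring
  -- This is |S + 2B|² ≥ 0, that is ⟨S, B⟩ + |B|² ≥ −q/4.
  have hsq : 0 ≤ q + 4 * (∑ m, ∑ l, sliceGram t m l * B m l) + 4 * ∑ i, ∑ j, B i j ^ 2 := by
    simp only [hq, Finset.mul_sum, ← Finset.sum_add_distrib]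
    exact Finset.sum_nonneg fun m _ => Finset.sum_nonneg fun l _ => by
      nlinarith [sq_nonneg (sliceGram t m l + 2 * B m l)]
  simp only [hSP, htrP]
  have hn' : (2 : ℝ) ≤ n := by exact_mod_cast hn
  -- After the commutator bound the quartic part is at least −2N² + q − (n+2)q/4 = −2N² − (n−2)q/4.
  -- As n ≥ 2 and q ≤ N², it is at least −(n+6)/4 N²; the surplus n/4 N² is discarded.
  nlinarith [mul_nonneg (by linarith : (0 : ℝ) ≤ (n : ℝ) + 2) hsq,
    mul_nonneg (by linarith : (0 : ℝ) ≤ (n : ℝ) - 2) (sub_nonneg.2 hq1),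
    mul_nonneg (by linarith : (0 : ℝ) ≤ (n : ℝ)) (sq_nonneg N)]

end AlgebraicInequality

/-! ### Curvature of the ambient metric -/

section ProductRules

variable {E X Y Z : Type*} [NormedAddCommGroup E] [NormedSpace ℝ E]
  [NormedAddCommGroup X] [NormedSpace ℝ X] [NormedAddCommGroup Y] [NormedSpace ℝ Y]
  [NormedAddCommGroup Z] [NormedSpace ℝ Z] {x : E}

lemma fderiv_linear_apply {L : E → X →L[ℝ] Z} {f : E → X} (hL : DifferentiableAt ℝ L x)
    (hf : DifferentiableAt ℝ f x) (p : E) :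
    fderiv ℝ (fun y => L y (f y)) x p = fderiv ℝ L x p (f x) + L x (fderiv ℝ f x p) := by
  rw [fderiv_clm_apply hL hf]
  simp [add_comm]

lemma fderiv_bilinear_apply {B : E → X →L[ℝ] Y →L[ℝ] Z} {f : E → X} {k : E → Y}
    (hB : DifferentiableAt ℝ B x) (hf : DifferentiableAt ℝ f x) (hk : DifferentiableAt ℝ k x)
    (p : E) :
    fderiv ℝ (fun y => B y (f y) (k y)) x p = fderiv ℝ B x p (f x) (k x)
      + B x (fderiv ℝ f x p) (k x) + B x (f x) (fderiv ℝ k x p) := by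
  rw [fderiv_linear_apply (hB.clm_apply hf) hk, fderiv_linear_apply hB hf]
  simp

end ProductRules

/-! ### Symmetries of the curvature tensor and its form under constant holomorphic sectional
curvature -/

section AmbientCurvature

variable {m : ℕ} {G : Coord m → Coord m →L[ℝ] Coord m →L[ℝ] ℝ} {V : Set (Coord m)} {x : Coord m}

lemma IsMetricOn.curvature_eq (h : IsMetricOn G V) (hx : x ∈ V) (u v w : Coord m) :
    curvature G x u v w = fderiv ℝ (christoffelL G) x u v w - fderiv ℝ (christoffelL G) x v u w
      + christoffelL G x u (christoffelL G x v w) - christoffelL G x v (christoffelL G x u w) := by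
  have hG := h.differentiableAt_christoffelL hx
  simp only [curvature, fderiv_christoffel_apply hG, christoffelL_apply]

lemma IsMetricOn.fderiv_christoffelL_symm (h : IsMetricOn G V) (hx : x ∈ V) (u v w : Coord m) :
    fderiv ℝ (christoffelL G) x u v w = fderiv ℝ (christoffelL G) x u w v := by
  have hG := h.differentiableAt_christoffelL hx
  rw [← fderiv_christoffel_apply hG, ← fderiv_christoffel_apply hG]
  congr 1
  refine Filter.EventuallyEq.fderiv_eq ?_
  filter_upwards [h.isOpen.mem_nhds hx] with y hy using h.christoffel_symm hy v w

/-- Γ and its derivative are symmetric in the two vector arguments, so the cyclic sum cancels in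
pairs. -/
lemma IsMetricOn.curvature_bianchi (h : IsMetricOn G V) (hx : x ∈ V) (u v w : Coord m) :
    curvature G x u v w + curvature G x v w u + curvature G x w u v = 0 := by
  simp only [h.curvature_eq hx]
  rw [h.fderiv_christoffelL_symm hx u w v, h.fderiv_christoffelL_symm hx v w u,
    h.fderiv_christoffelL_symm hx w v u]
  simp only [christoffelL_apply, h.christoffel_symm hx w u, h.christoffel_symm hx w v,
    h.christoffel_symm hx v u]
  abel

/-- Differentiate the metric condition ∇G = 0 once more and antisymmetrise: the second derivatives
of G commute, and what is left is the skewness of curvature. -/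
lemma IsMetricOn.curvature_skew (h : IsMetricOn G V) (hx : x ∈ V) (u v w z : Coord m) :
    G x (curvature G x u v w) z = - G x (curvature G x u v z) w := by
  have hd := h.differentiableAt hx
  have hG := h.differentiableAt_christoffelL hx
  have hdd := h.differentiableAt_of_contDiffOn hx h.contDiffOn_fderiv
  have hΓ : ∀ a b, DifferentiableAt ℝ (fun y => christoffelL G y a b) x := fun a b =>
    (hG.clm_apply (by fun_prop)).clm_apply (by fun_prop)
  have hΓ' : ∀ p a b, fderiv ℝ (fun y => christoffelL G y a b) x p =
      fderiv ℝ (christoffelL G) x p a b := fun p a b => by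
    rw [← fderiv_christoffel_apply hG]
    rfl
  have key : ∀ p q, fderiv ℝ (fderiv ℝ G) x p q w z =
      fderiv ℝ G x p (christoffelL G x q w) z + G x (fderiv ℝ (christoffelL G) x p q w) z
      + (fderiv ℝ G x p w (christoffelL G x q z) + G x w (fderiv ℝ (christoffelL G) x p q z)) := by
    intro p q
    have h1 : fderiv ℝ (fun y => fderiv ℝ G y q w z) x p = fderiv ℝ (fderiv ℝ G) x p q w z := by
      have := fderiv_bilinear_apply (B := fun y => fderiv ℝ G y q) (f := fun _ => w)
        (k := fun _ => z) (hdd.clm_apply (by fun_prop)) (by fun_prop) (by fun_prop) p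
      rw [this, fderiv_linear_apply hdd (by fun_prop)]
      simp
    have h2 : (fun y => fderiv ℝ G y q w z) =ᶠ[nhds x] fun y =>
        G y (christoffelL G y q w) z + G y w (christoffelL G y q z) := by
      filter_upwards [h.isOpen.mem_nhds hx] with y hy using h.fderiv_metric hy q w z
    rw [← h1, h2.fderiv_eq, fderiv_fun_add
      ((hd.clm_apply (hΓ q w)).clm_apply (by fun_prop))
      ((hd.clm_apply (by fun_prop)).clm_apply (hΓ q z)), add_apply,
      fderiv_bilinear_apply hd (hΓ q w) (by fun_prop),
      fderiv_bilinear_apply hd (by fun_prop) (hΓ q z), hΓ', hΓ']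
    simp
  have k1 := key u v
  have k2 := key v u
  rw [fderiv_fderiv_comm h.isOpen hx h.smooth u v] at k1
  simp only [h.fderiv_metric hx, christoffelL_apply] at k1 k2
  rw [h.symm x hx (curvature G x u v z) w]
  simp only [h.curvature_eq hx, map_add, map_sub, add_apply, sub_apply, christoffelL_apply]
  linarith

lemma IsMetricOn.curvature_add_fst (h : IsMetricOn G V) (hx : x ∈ V) (u u' v w : Coord m) :
    curvature G x (u + u') v w = curvature G x u v w + curvature G x u' v w := by
  simp only [h.curvature_eq hx, map_add, add_apply]
  abel

lemma curvature_anti (u v w : Coord m) : curvature G x u v w = - curvature G x v u w := by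
  simp only [curvature]
  abel

/-- The same argument with ∇J = 0: the second derivatives of J commute, so curvature commutes with
J. -/
lemma IsMetricOn.curvature_J (h : IsMetricOn G V) (hx : x ∈ V)
    {J : Coord m → Coord m →L[ℝ] Coord m} (hJ : ContDiffOn ℝ ∞ J V)
    (hpar : ∀ y ∈ V, ∀ u v, covEnd G J y u v = 0) (u v w : Coord m) :
    curvature G x u v (J x w) = J x (curvature G x u v w) := by
  have hG := h.differentiableAt_christoffelL hx
  have hJd := h.differentiableAt_of_contDiffOn hx hJ
  have hJdd := h.differentiableAt_of_contDiffOn hx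
    (hJ.fderiv_of_isOpen h.isOpen (m := ∞) (by simp))
  have hΓ1 : ∀ a, DifferentiableAt ℝ (fun y => christoffelL G y a) x := fun a =>
    hG.clm_apply (by fun_prop)
  have hΓ1' : ∀ p a, fderiv ℝ (fun y => christoffelL G y a) x p =
      fderiv ℝ (christoffelL G) x p a := fun p a => by
    rw [fderiv_linear_apply hG (by fun_prop)]
    simp
  have hΓ : ∀ a b, DifferentiableAt ℝ (fun y => christoffelL G y a b) x := fun a b =>
    (hΓ1 a).clm_apply (by fun_prop)
  have hΓ' : ∀ p a b, fderiv ℝ (fun y => christoffelL G y a b) x p =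
      fderiv ℝ (christoffelL G) x p a b := fun p a b => by
    rw [← fderiv_christoffel_apply hG]
    rfl
  have hDJ : ∀ y ∈ V, ∀ a b, fderiv ℝ J y a b =
      J y (christoffelL G y a b) - christoffelL G y a (J y b) := by
    intro y hy a b
    have := hpar y hy a b
    rw [covEnd, fderiv_linear_apply (h.differentiableAt_of_contDiffOn hy hJ) (by fun_prop)] at this
    simp only [fderiv_fun_const, Pi.zero_apply, zero_apply, map_zero, add_zero] at this
    rw [christoffelL_apply, christoffelL_apply]
    rw [← sub_eq_zero, ← this]
    abel
  have key : ∀ p q, fderiv ℝ (fderiv ℝ J) x p q w =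
      fderiv ℝ J x p (christoffelL G x q w) + J x (fderiv ℝ (christoffelL G) x p q w)
      - (fderiv ℝ (christoffelL G) x p q (J x w) + christoffelL G x q (fderiv ℝ J x p w)) := by
    intro p q
    have h1 : fderiv ℝ (fun y => fderiv ℝ J y q w) x p = fderiv ℝ (fderiv ℝ J) x p q w := by
      rw [fderiv_linear_apply (hJdd.clm_apply (by fun_prop)) (by fun_prop),
        fderiv_linear_apply hJdd (by fun_prop)]
      simp
    have h2 : (fun y => fderiv ℝ J y q w) =ᶠ[nhds x] fun y =>
        J y (christoffelL G y q w) - christoffelL G y q (J y w) := by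
      filter_upwards [h.isOpen.mem_nhds hx] with y hy using hDJ y hy q w
    have hJw : DifferentiableAt ℝ (fun y => J y w) x := hJd.clm_apply (by fun_prop)
    rw [← h1, h2.fderiv_eq, fderiv_fun_sub (hJd.clm_apply (hΓ q w)) ((hΓ1 q).clm_apply hJw),
      sub_apply, fderiv_linear_apply hJd (hΓ q w), fderiv_linear_apply (hΓ1 q) hJw, hΓ', hΓ1',
      fderiv_linear_apply hJd (by fun_prop)]
    simp
  have k1 := key u v
  have k2 := key v u
  rw [fderiv_fderiv_comm h.isOpen hx hJ u v, k2] at k1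
  simp only [hDJ x hx, map_sub] at k1
  simp only [h.curvature_eq hx, map_add, map_sub]
  rw [← sub_eq_zero] at k1 ⊢
  rw [← k1]
  abel

/-- The curvature of a Kähler metric of constant holomorphic sectional curvature. -/
theorem IsMetricOn.curvature_eq_model (h : IsMetricOn G V) (hx : x ∈ V)
    {J : Coord m → Coord m →L[ℝ] Coord m} (hJ : ContDiffOn ℝ ∞ J V)
    (hsq : ∀ v, J x (J x v) = -v) (horth : ∀ v w, G x (J x v) (J x w) = G x v w)
    (hpar : ∀ y ∈ V, ∀ u v, covEnd G J y u v = 0) {c : ℝ}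
    (hol : ∀ v, G x (curvature G x v (J x v) (J x v)) v = 4 * c * (G x v v) ^ 2)
    (u v w z : Coord m) :
    G x (curvature G x u v w) z =
      c * modelCurvature (fun a b => G x a b) (fun a => J x a) u v w z := by
  have hK : IsKaehlerCurvature (fun a => J x a) (fun u v w z => G x (curvature G x u v w) z) := by
    refine ⟨by simp, hsq, ?_, ?_, ?_, ?_, ?_⟩
    · intro a a' b d e
      simp [h.curvature_add_fst hx]
    · intro a b d e
      rw [curvature_anti, map_neg]
      rfl
    · intro a b d e
      exact h.curvature_skew hx a b d e
    · intro a b d e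
      rw [← add_apply, ← add_apply, ← map_add, ← map_add, h.curvature_bianchi hx]
      simp
    · intro a b d e
      simp only [h.curvature_J hx hJ hpar, horth]
  exact hK.eq_model (b := fun a b => G x a b) (h.symm x hx) (by simp) horth hol u v w z

end AmbientCurvature

/-! ### Lagrangian immersions in coordinates -/

section LagrangianCharts

variable {n m : ℕ}

/-- The coordinate expression `F` on `U` of a Lagrangian immersion into a Kähler manifold of
constant holomorphic sectional curvature `4c`, given by `G` and `J` on the coordinate domain `V`. -/
structure IsLagrangianChart (c : ℝ) (G : Coord m → Coord m →L[ℝ] Coord m →L[ℝ] ℝ)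
    (J : Coord m → Coord m →L[ℝ] Coord m) (F : Coord n → Coord m) (U : Set (Coord n))
    (V : Set (Coord m)) : Prop where
  metric : IsMetricOn G V
  J_smooth : ContDiffOn ℝ ∞ J V
  J_sq : ∀ y ∈ V, ∀ v, J y (J y v) = -v
  J_orth : ∀ y ∈ V, ∀ v w, G y (J y v) (J y w) = G y v w
  J_parallel : ∀ y ∈ V, ∀ u v, covEnd G J y u v = 0
  hol : ∀ y ∈ V, ∀ v, G y (curvature G y v (J y v) (J y v)) v = 4 * c * (G y v v) ^ 2
  isOpen : IsOpen U
  smooth : ContDiffOn ℝ ∞ F U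
  mapsTo : ∀ y ∈ U, F y ∈ V
  injective : ∀ y ∈ U, Function.Injective (fderiv ℝ F y)
  isotropic : ∀ y ∈ U, ∀ u v, G (F y) (fderiv ℝ F y u) (J (F y) (fderiv ℝ F y v)) = 0
  normal : ∀ y ∈ U, ∀ w, (∀ u, G (F y) (fderiv ℝ F y u) w = 0) →
    ∃ v, J (F y) (fderiv ℝ F y v) = w

variable {c : ℝ} {G : Coord m → Coord m →L[ℝ] Coord m →L[ℝ] ℝ}
  {J : Coord m → Coord m →L[ℝ] Coord m} {F : Coord n → Coord m} {U : Set (Coord n)}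
  {V : Set (Coord m)} {x : Coord n}

@[simp]
lemma indMetric_apply (y u v : Coord n) :
    indMetric G F y u v = G (F y) (fderiv ℝ F y u) (fderiv ℝ F y v) := rfl

namespace IsLagrangianChart

lemma contDiffOn_fderiv (h : IsLagrangianChart c G J F U V) : ContDiffOn ℝ ∞ (fderiv ℝ F) U :=
  h.smooth.fderiv_of_isOpen h.isOpen (by simp)

lemma contDiffOn_comp {W : Type*} [NormedAddCommGroup W] [NormedSpace ℝ W] {P : Coord m → W}
    (h : IsLagrangianChart c G J F U V) (hP : ContDiffOn ℝ ∞ P V) :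
    ContDiffOn ℝ ∞ (fun y => P (F y)) U := hP.comp h.smooth h.mapsTo

lemma diffAt {W : Type*} [NormedAddCommGroup W] [NormedSpace ℝ W] {P : Coord n → W}
    (h : IsLagrangianChart c G J F U V) (hx : x ∈ U) (hP : ContDiffOn ℝ ∞ P U) :
    DifferentiableAt ℝ P x :=
  (hP.contDiffAt (h.isOpen.mem_nhds hx)).differentiableAt (by simp)

lemma fderiv_comp_apply {W : Type*} [NormedAddCommGroup W] [NormedSpace ℝ W] {P : Coord m → W}
    (h : IsLagrangianChart c G J F U V) (hP : ContDiffOn ℝ ∞ P V) (hx : x ∈ U) (u : Coord n) :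
    fderiv ℝ (fun y => P (F y)) x u = fderiv ℝ P (F x) (fderiv ℝ F x u) := by
  have h1 := h.metric.differentiableAt_of_contDiffOn (h.mapsTo x hx) hP
  have := fderiv_comp x h1 (h.diffAt hx h.smooth)
  rw [show (fun y => P (F y)) = P ∘ F from rfl, this]
  rfl

lemma contDiffOn_metric_apply (h : IsLagrangianChart c G J F U V) {Y Z : Coord n → Coord m}
    (hY : ContDiffOn ℝ ∞ Y U) (hZ : ContDiffOn ℝ ∞ Z U) :
    ContDiffOn ℝ ∞ (fun y => G (F y) (Y y) (Z y)) U :=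
  ((h.contDiffOn_comp h.metric.smooth).clm_apply hY).clm_apply hZ

lemma contDiffOn_J_apply (h : IsLagrangianChart c G J F U V) {Y : Coord n → Coord m}
    (hY : ContDiffOn ℝ ∞ Y U) : ContDiffOn ℝ ∞ (fun y => J (F y) (Y y)) U :=
  (h.contDiffOn_comp h.J_smooth).clm_apply hY

lemma contDiffOn_dF (h : IsLagrangianChart c G J F U V) (u : Coord n) :
    ContDiffOn ℝ ∞ (fun y => fderiv ℝ F y u) U := h.contDiffOn_fderiv.clm_apply contDiffOn_const

lemma isMetricOn (h : IsLagrangianChart c G J F U V) : IsMetricOn (indMetric G F) U where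
  isOpen := h.isOpen
  smooth := contDiffOn_clm_apply.2 fun u => contDiffOn_clm_apply.2 fun v =>
    h.contDiffOn_metric_apply (h.contDiffOn_dF u) (h.contDiffOn_dF v)
  symm := fun y hy _ _ => h.metric.symm _ (h.mapsTo y hy) _ _
  pos := fun y hy _ hu => h.metric.pos _ (h.mapsTo y hy) _ fun h0 =>
    hu (h.injective y hy (h0.trans (map_zero _).symm))

lemma contDiffOn_covAlong (h : IsLagrangianChart c G J F U V) {Y : Coord n → Coord m}
    (hY : ContDiffOn ℝ ∞ Y U) (u : Coord n) : ContDiffOn ℝ ∞ (fun y => covAlong G F Y y u) U :=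
  ((hY.fderiv_of_isOpen h.isOpen (by simp)).clm_apply contDiffOn_const).add
    (((h.contDiffOn_comp h.metric.contDiffOn_christoffelL).clm_apply (h.contDiffOn_dF u)).clm_apply
      hY)

/-- Differentiation of the inner product of fields along the immersion. -/
lemma fderiv_metric_along (h : IsLagrangianChart c G J F U V) (hx : x ∈ U) {Y Z : Coord n → Coord m}
    (hY : ContDiffOn ℝ ∞ Y U) (hZ : ContDiffOn ℝ ∞ Z U) (u : Coord n) :
    fderiv ℝ (fun y => G (F y) (Y y) (Z y)) x u =
      G (F x) (covAlong G F Y x u) (Z x) + G (F x) (Y x) (covAlong G F Z x u) := by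
  rw [fderiv_bilinear_apply (B := fun y => G (F y)) (h.diffAt hx (h.contDiffOn_comp h.metric.smooth))
    (h.diffAt hx hY) (h.diffAt hx hZ), h.fderiv_comp_apply h.metric.smooth hx,
    h.metric.fderiv_metric (h.mapsTo x hx)]
  simp only [covAlong, map_add, add_apply]
  ring

lemma covAlong_J (h : IsLagrangianChart c G J F U V) (hx : x ∈ U) {Y : Coord n → Coord m}
    (hY : ContDiffOn ℝ ∞ Y U) (u : Coord n) :
    covAlong G F (fun y => J (F y) (Y y)) x u = J (F x) (covAlong G F Y x u) := by
  have hFx := h.mapsTo x hx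
  have hp := h.J_parallel _ hFx (fderiv ℝ F x u) (Y x)
  rw [covEnd, fderiv_linear_apply (h.metric.differentiableAt_of_contDiffOn hFx h.J_smooth)
    (by fun_prop)] at hp
  simp only [fderiv_fun_const, Pi.zero_apply, zero_apply, map_zero, add_zero] at hp
  rw [covAlong, fderiv_linear_apply (L := fun y => J (F y))
    (h.diffAt hx (h.contDiffOn_comp h.J_smooth)) (h.diffAt hx hY),
    h.fderiv_comp_apply h.J_smooth hx, covAlong, map_add, ← sub_eq_zero, ← hp]
  abel

/-- The curvature as the commutator of covariant derivatives along the immersion. -/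
lemma covAlong_comm (h : IsLagrangianChart c G J F U V) (hx : x ∈ U) {Y : Coord n → Coord m}
    (hY : ContDiffOn ℝ ∞ Y U) (u v : Coord n) :
    covAlong G F (fun y => covAlong G F Y y v) x u - covAlong G F (fun y => covAlong G F Y y u) x v
      = curvature G (F x) (fderiv ℝ F x u) (fderiv ℝ F x v) (Y x) := by
  have hFx := h.mapsTo x hx
  have hΓ := h.metric.contDiffOn_christoffelL
  have key : ∀ p q, covAlong G F (fun y => covAlong G F Y y q) x p =
      fderiv ℝ (fderiv ℝ Y) x p q
      + (fderiv ℝ (christoffelL G) (F x) (fderiv ℝ F x p) (fderiv ℝ F x q) (Y x)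
      + christoffelL G (F x) (fderiv ℝ (fderiv ℝ F) x p q) (Y x)
      + christoffelL G (F x) (fderiv ℝ F x q) (fderiv ℝ Y x p))
      + christoffelL G (F x) (fderiv ℝ F x p) (fderiv ℝ Y x q
        + christoffelL G (F x) (fderiv ℝ F x q) (Y x)) := by
    intro p q
    have hY' := h.diffAt hx (hY.fderiv_of_isOpen h.isOpen (m := ∞) (by simp))
    have hΓF := h.diffAt hx (h.contDiffOn_comp hΓ)
    have hdF := h.diffAt hx (h.contDiffOn_dF q)
    have hYx := h.diffAt hx hY
    have h1 : fderiv ℝ (fun y => covAlong G F Y y q) x p = fderiv ℝ (fderiv ℝ Y) x p q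
        + (fderiv ℝ (christoffelL G) (F x) (fderiv ℝ F x p) (fderiv ℝ F x q) (Y x)
        + christoffelL G (F x) (fderiv ℝ (fderiv ℝ F) x p q) (Y x)
        + christoffelL G (F x) (fderiv ℝ F x q) (fderiv ℝ Y x p)) := by
      simp only [covAlong, ← christoffelL_apply]
      rw [fderiv_fun_add (hY'.clm_apply (by fun_prop)) ((hΓF.clm_apply hdF).clm_apply hYx),
        add_apply, fderiv_linear_apply hY' (by fun_prop),
        fderiv_bilinear_apply (B := fun y => christoffelL G (F y)) hΓF hdF hYx,
        h.fderiv_comp_apply hΓ hx,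
        fderiv_linear_apply (h.diffAt hx h.contDiffOn_fderiv) (by fun_prop)]
      simp
    rw [covAlong, h1]
    rfl
  rw [key, key, h.metric.curvature_eq hFx, fderiv_fderiv_comm h.isOpen hx hY u v,
    fderiv_fderiv_comm h.isOpen hx h.smooth u v]
  simp only [map_add]
  abel

end IsLagrangianChart

/-- The ambient derivative `∇̄_u (dF v)` as a bilinear map. -/
def fullHess (G : Coord m → Coord m →L[ℝ] Coord m →L[ℝ] ℝ) (F : Coord n → Coord m)
    (y : Coord n) : Coord n →L[ℝ] Coord n →L[ℝ] Coord m :=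
  fderiv ℝ (fderiv ℝ F) y + (christoffelL G (F y)).bilinearComp (fderiv ℝ F y) (fderiv ℝ F y)

/-- The cubic form `⟨∇̄_u (dF v), J dF w⟩`. -/
def cubicForm (G : Coord m → Coord m →L[ℝ] Coord m →L[ℝ] ℝ)
    (J : Coord m → Coord m →L[ℝ] Coord m) (F : Coord n → Coord m) (y : Coord n) : Cubic n :=
  (ContinuousLinearMap.compL ℝ (Coord n) (Coord m) (Coord n →L[ℝ] ℝ)
    (((ContinuousLinearMap.compL ℝ (Coord n) (Coord m) ℝ).flip
      ((J (F y)).comp (fderiv ℝ F y))).comp (G (F y)))).comp (fullHess G F y)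

lemma cubicForm_apply (y u v w : Coord n) : cubicForm G J F y u v w =
    G (F y) (fullHess G F y u v) (J (F y) (fderiv ℝ F y w)) := rfl

namespace IsLagrangianChart

lemma covAlong_dF (h : IsLagrangianChart c G J F U V) (hx : x ∈ U) (u v : Coord n) :
    covAlong G F (fun y => fderiv ℝ F y v) x u = fullHess G F x u v := by
  rw [covAlong, fderiv_linear_apply (h.diffAt hx h.contDiffOn_fderiv) (by fun_prop)]
  simp [fullHess]

lemma fullHess_symm (h : IsLagrangianChart c G J F U V) (hx : x ∈ U) (u v : Coord n) :
    fullHess G F x u v = fullHess G F x v u := by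
  simp only [fullHess, add_apply, ContinuousLinearMap.bilinearComp_apply, christoffelL_apply]
  rw [fderiv_fderiv_comm h.isOpen hx h.smooth u v, h.metric.christoffel_symm (h.mapsTo x hx)]

lemma contDiffOn_fullHess (h : IsLagrangianChart c G J F U V) (u v : Coord n) :
    ContDiffOn ℝ ∞ (fun y => fullHess G F y u v) U :=
  (h.contDiffOn_covAlong (h.contDiffOn_dF v) u).congr fun _ hy => (h.covAlong_dF hy u v).symm

lemma contDiffOn_cubicForm (h : IsLagrangianChart c G J F U V) :
    ContDiffOn ℝ ∞ (cubicForm G J F) U :=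
  contDiffOn_clm_apply.2 fun u => contDiffOn_clm_apply.2 fun v => contDiffOn_clm_apply.2 fun w =>
    h.contDiffOn_metric_apply (h.contDiffOn_fullHess u v) (h.contDiffOn_J_apply (h.contDiffOn_dF w))

/-- The tangential part of `∇̄_u (dF v)` is the Levi-Civita derivative of the induced metric. -/
lemma inner_fullHess (h : IsLagrangianChart c G J F U V) (hx : x ∈ U) (u v w : Coord n) :
    G (F x) (fullHess G F x u v) (fderiv ℝ F x w) =
      indMetric G F x (christoffel (indMetric G F) x u v) w := by
  have hd : ∀ p a b, fderiv ℝ (indMetric G F) x p a b =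
      G (F x) (fullHess G F x p a) (fderiv ℝ F x b)
        + G (F x) (fderiv ℝ F x a) (fullHess G F x p b) := by
    intro p a b
    have h1 := h.fderiv_metric_along hx (h.contDiffOn_dF a) (h.contDiffOn_dF b) p
    rw [h.covAlong_dF hx, h.covAlong_dF hx] at h1
    rw [← h1]
    have := fderiv_bilinear_apply (B := indMetric G F) (f := fun _ => a) (k := fun _ => b)
      (h.isMetricOn.differentiableAt hx) (by fun_prop) (by fun_prop) p
    simp only [fderiv_fun_const, Pi.zero_apply, zero_apply, map_zero, add_zero] at this
    rw [← this]
    rfl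
  rw [h.isMetricOn.inner_christoffel hx, koszul]
  simp only [hd]
  have hs := h.metric.symm _ (h.mapsTo x hx)
  rw [hs (fderiv ℝ F x v) (fullHess G F x u w), hs (fderiv ℝ F x u) (fullHess G F x v w),
    hs (fderiv ℝ F x u) (fullHess G F x w v), h.fullHess_symm hx v u, h.fullHess_symm hx w u,
    h.fullHess_symm hx w v]
  ring

/-- Gauss' formula. -/
lemma normalProj_eq (h : IsLagrangianChart c G J F U V) (hx : x ∈ U) (w : Coord m) {s : Coord n}
    (hs : ∀ z, G (F x) w (fderiv ℝ F x z) = indMetric G F x s z) :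
    normalProj G F x w = w - fderiv ℝ F x s := by
  have h1 : ∑ k, ∑ l, (invMetric (indMetric G F) x k l * indMetric G F x s (basisVec l)) •
      basisVec k = s :=
    h.isMetricOn.ext_inner hx fun z => h.isMetricOn.inner_sharp hx (indMetric G F x s) z
  rw [normalProj]
  conv_rhs => rw [← h1]
  simp only [hs, map_sum, map_smul]

lemma exists_sharp (h : IsLagrangianChart c G J F U V) (hx : x ∈ U) (w : Coord m) :
    ∃ s, ∀ z, G (F x) w (fderiv ℝ F x z) = indMetric G F x s z :=
  ⟨_, fun z => (h.isMetricOn.inner_sharp hx ((G (F x) w).comp (fderiv ℝ F x)) z).symm⟩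

lemma inner_normalProj_tangent (h : IsLagrangianChart c G J F U V) (hx : x ∈ U) (w : Coord m)
    (z : Coord n) : G (F x) (normalProj G F x w) (fderiv ℝ F x z) = 0 := by
  obtain ⟨s, hs⟩ := h.exists_sharp hx w
  rw [h.normalProj_eq hx w hs, map_sub, sub_apply, hs, indMetric_apply, sub_self]

lemma inner_normalProj_normal (h : IsLagrangianChart c G J F U V) (hx : x ∈ U) (w : Coord m)
    (z : Coord n) : G (F x) (normalProj G F x w) (J (F x) (fderiv ℝ F x z)) =
      G (F x) w (J (F x) (fderiv ℝ F x z)) := by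
  obtain ⟨s, hs⟩ := h.exists_sharp hx w
  rw [h.normalProj_eq hx w hs, map_sub, sub_apply, h.isotropic x hx, sub_zero]

lemma secondFF_eq (h : IsLagrangianChart c G J F U V) (hx : x ∈ U) (u v : Coord n) :
    secondFF G F x u v =
      fullHess G F x u v - fderiv ℝ F x (christoffel (indMetric G F) x u v) := by
  rw [secondFF, h.covAlong_dF hx, h.normalProj_eq hx _ fun z => h.inner_fullHess hx u v z]

/-- By isotropy J dF is normal, so against it the tangential part of ∇̄ dF is invisible. The cubic
form can therefore be studied without the normal projection. -/
lemma inner_secondFF (h : IsLagrangianChart c G J F U V) (hx : x ∈ U) (u v w : Coord n) :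
    G (F x) (secondFF G F x u v) (J (F x) (fderiv ℝ F x w)) = cubicForm G J F x u v w := by
  rw [secondFF, h.inner_normalProj_normal hx, h.covAlong_dF hx, cubicForm_apply]

lemma inner_secondFF_tangent (h : IsLagrangianChart c G J F U V) (hx : x ∈ U) (u v w : Coord n) :
    G (F x) (secondFF G F x u v) (fderiv ℝ F x w) = 0 := h.inner_normalProj_tangent hx _ _

lemma J_skew (h : IsLagrangianChart c G J F U V) (hx : x ∈ U) (a b : Coord m) :
    G (F x) (J (F x) a) b = - G (F x) a (J (F x) b) := by
  rw [← h.J_orth _ (h.mapsTo x hx) (J (F x) a) b, h.J_sq _ (h.mapsTo x hx), map_neg]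
  rfl

lemma cubicForm_symm12 (h : IsLagrangianChart c G J F U V) (hx : x ∈ U) (u v w : Coord n) :
    cubicForm G J F x u v w = cubicForm G J F x v u w := by
  rw [cubicForm_apply, h.fullHess_symm hx, cubicForm_apply]

/-- Differentiate the isotropy ⟨dF v, J dF w⟩ = 0; J is parallel and skew. -/
lemma cubicForm_symm23 (h : IsLagrangianChart c G J F U V) (hx : x ∈ U) (u v w : Coord n) :
    cubicForm G J F x u v w = cubicForm G J F x u w v := by
  have h0 : fderiv ℝ (fun y => G (F y) (fderiv ℝ F y v) (J (F y) (fderiv ℝ F y w))) x u = 0 := by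
    have : (fun y => G (F y) (fderiv ℝ F y v) (J (F y) (fderiv ℝ F y w))) =ᶠ[nhds x]
        fun _ => 0 := by
      filter_upwards [h.isOpen.mem_nhds hx] with y hy using h.isotropic y hy v w
    rw [this.fderiv_eq]
    simp
  rw [h.fderiv_metric_along hx (h.contDiffOn_dF v) (h.contDiffOn_J_apply (h.contDiffOn_dF w)),
    h.covAlong_J hx (h.contDiffOn_dF w), h.covAlong_dF hx, h.covAlong_dF hx] at h0
  rw [cubicForm_apply, cubicForm_apply, h.metric.symm _ (h.mapsTo x hx) (fullHess G F x u w),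
    h.J_skew hx]
  linarith

/-- Inner products of normal vectors in terms of their components with respect to `J dF`. -/
lemma inner_normal (h : IsLagrangianChart c G J F U V) (hx : x ∈ U) {a b : Coord m}
    (hb : ∀ z, G (F x) b (fderiv ℝ F x z) = 0) :
    G (F x) a b = metricTrace (indMetric G F) x fun k l =>
      G (F x) a (J (F x) (fderiv ℝ F x k)) * G (F x) b (J (F x) (fderiv ℝ F x l)) := by
  obtain ⟨e, he⟩ := h.isMetricOn.exists_frame hx
  rw [he.trace_eq _ ⟨by intros; simp; ring, by intros; simp; ring, by intros; simp; ring,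
    by intros; simp; ring⟩]
  obtain ⟨s, rfl⟩ := h.normal x hx b fun u => by rw [h.metric.symm _ (h.mapsTo x hx), hb]
  conv_lhs => rw [he.expand s]
  simp only [h.J_orth _ (h.mapsTo x hx), map_sum, map_smul, smul_eq_mul, indMetric_apply]
  exact Finset.sum_congr rfl fun i _ => by
    rw [h.metric.symm _ (h.mapsTo x hx) (fderiv ℝ F x (e i)), mul_comm]

/-- Every normal vector is J of a tangent vector, so J maps it to a tangent vector. -/
lemma J_normal (h : IsLagrangianChart c G J F U V) (hx : x ∈ U) {a b : Coord m}
    (ha : ∀ z, G (F x) a (fderiv ℝ F x z) = 0) (hb : ∀ z, G (F x) b (fderiv ℝ F x z) = 0) :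
    G (F x) a (J (F x) b) = 0 := by
  obtain ⟨s, rfl⟩ := h.normal x hx b fun u => by rw [h.metric.symm _ (h.mapsTo x hx), hb]
  rw [h.J_sq _ (h.mapsTo x hx), map_neg, ha, neg_zero]

/-- The Codazzi equation. -/
lemma codazzi (h : IsLagrangianChart c G J F U V) (hx : x ∈ U) (u v w z : Coord n) :
    cubicCov (indMetric G F) (cubicForm G J F) x u v w z =
      cubicCov (indMetric G F) (cubicForm G J F) x v u w z := by
  have hFx := h.mapsTo x hx
  have hC := h.diffAt hx h.contDiffOn_cubicForm
  -- Differentiate the cubic form along p. The derivative of the factor J dF z meets ∇̄ dF again,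
  -- and only the mixed tangential–normal products survive, which are the two Christoffel
  -- corrections.
  have key : ∀ p q, G (F x) (covAlong G F (fun y => fullHess G F y q w) x p)
      (J (F x) (fderiv ℝ F x z)) = fderiv ℝ (fun y => cubicForm G J F y q w z) x p
        + cubicForm G J F x p z (christoffel (indMetric G F) x q w)
        - cubicForm G J F x q w (christoffel (indMetric G F) x p z) := by
    intro p q
    have h1 := h.fderiv_metric_along hx (h.contDiffOn_fullHess q w)
      (h.contDiffOn_J_apply (h.contDiffOn_dF z)) p
    rw [h.covAlong_J hx (h.contDiffOn_dF z), h.covAlong_dF hx] at h1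
    have e1 : fullHess G F x p z =
        secondFF G F x p z + fderiv ℝ F x (christoffel (indMetric G F) x p z) := by
      rw [h.secondFF_eq hx]; abel
    have e2 : fullHess G F x q w =
        secondFF G F x q w + fderiv ℝ F x (christoffel (indMetric G F) x q w) := by
      rw [h.secondFF_eq hx]; abel
    have h2 : G (F x) (fullHess G F x q w) (J (F x) (fullHess G F x p z)) =
        cubicForm G J F x q w (christoffel (indMetric G F) x p z)
          - cubicForm G J F x p z (christoffel (indMetric G F) x q w) := by
      rw [e1, e2]
      simp only [map_add, add_apply]
      rw [h.J_normal hx (h.inner_secondFF_tangent hx q w) (h.inner_secondFF_tangent hx p z),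
        h.isotropic x hx, h.inner_secondFF hx, h.metric.symm _ hFx
          (fderiv ℝ F x (christoffel (indMetric G F) x q w)), h.J_skew hx, h.inner_secondFF hx]
      ring
    rw [h2] at h1
    have h3 : fderiv ℝ (fun y => cubicForm G J F y q w z) x p =
        fderiv ℝ (fun y => G (F y) (fullHess G F y q w) (J (F y) (fderiv ℝ F y z))) x p := rfl
    rw [h3, h1]
    ring
  have hcurv := h.metric.curvature_eq_model hFx h.J_smooth (h.J_sq _ hFx) (h.J_orth _ hFx)
    h.J_parallel (h.hol _ hFx) (fderiv ℝ F x u) (fderiv ℝ F x v) (fderiv ℝ F x w)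
    (J (F x) (fderiv ℝ F x z))
  have h0 : ∀ a b, G (F x) (J (F x) (fderiv ℝ F x a)) (fderiv ℝ F x b) = 0 := fun a b => by
    rw [h.metric.symm _ hFx, h.isotropic x hx]
  -- Paired with J dF z, every term of the model curvature has a factor ⟨dF a, J dF b⟩ = 0: the
  -- curvature of tangent vectors is tangent.
  simp only [modelCurvature, h.isotropic x hx, h0, mul_zero, zero_mul, sub_zero, add_zero] at hcurv
  rw [← h.covAlong_comm hx (h.contDiffOn_dF w), map_sub, sub_apply] at hcurv
  have hcongr : ∀ p q, covAlong G F (fun y => covAlong G F (fun y => fderiv ℝ F y w) y q) x p =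
      covAlong G F (fun y => fullHess G F y q w) x p := by
    intro p q
    have : (fun y => covAlong G F (fun y => fderiv ℝ F y w) y q) =ᶠ[nhds x]
        fun y => fullHess G F y q w := by
      filter_upwards [h.isOpen.mem_nhds hx] with y hy using h.covAlong_dF hy q w
    rw [covAlong, this.fderiv_eq, h.covAlong_dF hx]
    rfl
  rw [hcongr, hcongr, key, key] at hcurv
  rw [cubicCov_apply hC, cubicCov_apply hC, h.isMetricOn.christoffel_symm hx v u]
  -- Symmetry of C moves the Christoffel vector to the last slot, where the correction in `key` has
  -- it.
  rw [h.cubicForm_symm23 hx u (christoffel (indMetric G F) x v w) z,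
    h.cubicForm_symm23 hx v (christoffel (indMetric G F) x u w) z]
  linarith

/-- The Gauss equation. -/
lemma gauss (h : IsLagrangianChart c G J F U V) (hx : x ∈ U) (u v w z : Coord n) :
    indMetric G F x (curvature (indMetric G F) x u v w) z =
      c * (indMetric G F x v w * indMetric G F x u z - indMetric G F x u w * indMetric G F x v z)
      + (G (F x) (secondFF G F x v w) (secondFF G F x u z)
        - G (F x) (secondFF G F x u w) (secondFF G F x v z)) := by
  have hFx := h.mapsTo x hx
  have hM := h.isMetricOn
  have hΓd := hM.differentiableAt_christoffelL hx
  -- Differentiating the tangential component of ∇̄ dF reproduces the intrinsic second derivative;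
  -- the product of the normal parts is the defect.
  have ext : ∀ p q, G (F x) (covAlong G F (fun y => fullHess G F y q w) x p) (fderiv ℝ F x z) =
      indMetric G F x (fderiv ℝ (christoffelL (indMetric G F)) x p q w
        + christoffel (indMetric G F) x p (christoffel (indMetric G F) x q w)) z
      - G (F x) (secondFF G F x q w) (secondFF G F x p z) := by
    intro p q
    have h1 := h.fderiv_metric_along hx (h.contDiffOn_fullHess q w) (h.contDiffOn_dF z) p
    have h2 : (fun y => G (F y) (fullHess G F y q w) (fderiv ℝ F y z)) =ᶠ[nhds x]
        fun y => indMetric G F y (christoffelL (indMetric G F) y q w) z := by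
      filter_upwards [h.isOpen.mem_nhds hx] with y hy using h.inner_fullHess hy q w z
    have hΓ : DifferentiableAt ℝ (fun y => christoffelL (indMetric G F) y q w) x :=
      (hΓd.clm_apply (by fun_prop)).clm_apply (by fun_prop)
    rw [h2.fderiv_eq, fderiv_bilinear_apply (hM.differentiableAt hx) hΓ (by fun_prop),
      hM.fderiv_metric hx, h.covAlong_dF hx] at h1
    have h3 : fderiv ℝ (fun y => christoffelL (indMetric G F) y q w) x p =
        fderiv ℝ (christoffelL (indMetric G F)) x p q w := by
      rw [← fderiv_christoffel_apply hΓd]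
      rfl
    rw [h3] at h1
    simp only [fderiv_fun_const, Pi.zero_apply, zero_apply, map_zero, add_zero,
      christoffelL_apply] at h1
    have e1 : fullHess G F x p z =
        secondFF G F x p z + fderiv ℝ F x (christoffel (indMetric G F) x p z) := by
      rw [h.secondFF_eq hx]; abel
    have e2 : fullHess G F x q w =
        secondFF G F x q w + fderiv ℝ F x (christoffel (indMetric G F) x q w) := by
      rw [h.secondFF_eq hx]; abel
    have h4 : G (F x) (fullHess G F x q w) (fullHess G F x p z) =
        G (F x) (secondFF G F x q w) (secondFF G F x p z)
        + indMetric G F x (christoffel (indMetric G F) x q w)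
          (christoffel (indMetric G F) x p z) := by
      rw [e1, e2]
      simp only [map_add, add_apply, indMetric_apply]
      rw [h.inner_secondFF_tangent hx, h.metric.symm _ hFx (fderiv ℝ F x _) (secondFF G F x p z),
        h.inner_secondFF_tangent hx]
      ring
    rw [h4] at h1
    rw [map_add, add_apply]
    linarith
  have hcurv := h.metric.curvature_eq_model hFx h.J_smooth (h.J_sq _ hFx) (h.J_orth _ hFx)
    h.J_parallel (h.hol _ hFx) (fderiv ℝ F x u) (fderiv ℝ F x v) (fderiv ℝ F x w) (fderiv ℝ F x z)
  have h0 : ∀ a b, G (F x) (J (F x) (fderiv ℝ F x a)) (fderiv ℝ F x b) = 0 := fun a b => by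
    rw [h.metric.symm _ hFx, h.isotropic x hx]
  -- On tangent vectors all terms of the model involving J vanish, leaving constant sectional
  -- curvature c.
  simp only [modelCurvature, h.isotropic x hx, h0, mul_zero, sub_zero, add_zero] at hcurv
  rw [← h.covAlong_comm hx (h.contDiffOn_dF w), map_sub, sub_apply] at hcurv
  have hcongr : ∀ p q, covAlong G F (fun y => covAlong G F (fun y => fderiv ℝ F y w) y q) x p =
      covAlong G F (fun y => fullHess G F y q w) x p := by
    intro p q
    have : (fun y => covAlong G F (fun y => fderiv ℝ F y w) y q) =ᶠ[nhds x]
        fun y => fullHess G F y q w := by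
      filter_upwards [h.isOpen.mem_nhds hx] with y hy using h.covAlong_dF hy q w
    rw [covAlong, this.fderiv_eq, h.covAlong_dF hx]
    rfl
  rw [hcongr, hcongr, ext, ext] at hcurv
  rw [hM.curvature_eq hx]
  simp only [christoffelL_apply, map_sub, map_add, sub_apply, add_apply] at hcurv ⊢
  simp only [← indMetric_apply (G := G) (F := F)] at hcurv
  linarith

end IsLagrangianChart
end LagrangianCharts

/-! ### The geometric quantities as contractions of the trace-free cubic form -/

section Invariants

variable {n m : ℕ} {c : ℝ} {G : Coord m → Coord m →L[ℝ] Coord m →L[ℝ] ℝ}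
  {J : Coord m → Coord m →L[ℝ] Coord m} {F : Coord n → Coord m} {U : Set (Coord n)}
  {V : Set (Coord m)} {x : Coord n}

/-- The trace-free part of the cubic form. -/
def tfCubicForm (G : Coord m → Coord m →L[ℝ] Coord m →L[ℝ] ℝ)
    (J : Coord m → Coord m →L[ℝ] Coord m) (F : Coord n → Coord m) (y : Coord n) : Cubic n :=
  tracefreePart (indMetric G F) y (cubicForm G J F y)

namespace IsLagrangianChart

lemma contDiffOn_tfCubicForm (h : IsLagrangianChart c G J F U V) :
    ContDiffOn ℝ ∞ (tfCubicForm G J F) U :=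
  h.isMetricOn.contDiffOn_tracefreePart h.contDiffOn_cubicForm

lemma inner_meanCurv (h : IsLagrangianChart c G J F U V) (hx : x ∈ U) (w : Coord n) :
    G (F x) (meanCurv G F x) (J (F x) (fderiv ℝ F x w)) =
      (1 / (n : ℝ)) * cubicTrace (indMetric G F) x (cubicForm G J F x) w := by
  simp only [meanCurv, map_smul, map_sum, smul_apply, sum_apply, smul_eq_mul,
    h.inner_secondFF hx, cubicTrace]

lemma inner_meanCurv_tangent (h : IsLagrangianChart c G J F U V) (hx : x ∈ U) (w : Coord n) :
    G (F x) (meanCurv G F x) (fderiv ℝ F x w) = 0 := by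
  simp only [meanCurv, map_smul, map_sum, smul_apply, sum_apply, smul_eq_mul,
    h.inner_secondFF_tangent hx, mul_zero, Finset.sum_const_zero]

/-- The factor n/(n+2) times the 1/n in the mean curvature is the 1/(n+2) of `tracefreePart`; this
cancellation is where n ≠ 0 is needed. -/
lemma inner_tfSecondFF (h : IsLagrangianChart c G J F U V) (hn : n ≠ 0) (hx : x ∈ U)
    (u v w : Coord n) :
    G (F x) (tfSecondFF G J F x u v) (J (F x) (fderiv ℝ F x w)) = tfCubicForm G J F x u v w := by
  have hFx := h.mapsTo x hx
  have hn' : (n : ℝ) ≠ 0 := by exact_mod_cast hn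
  have hn2 : (n : ℝ) + 2 ≠ 0 := by positivity
  simp only [tfSecondFF, tfCubicForm, tracefreePart, map_sub, map_smul, map_add, sub_apply,
    smul_apply, add_apply, smul_eq_mul, h.inner_secondFF hx, h.inner_meanCurv hx,
    h.J_orth _ hFx, symProd_apply]
  rw [h.metric.symm _ hFx (J (F x) (fderiv ℝ F x u)), h.metric.symm _ hFx (J (F x) (fderiv ℝ F x v)),
    h.inner_meanCurv hx, h.inner_meanCurv hx]
  simp only [indMetric_apply]
  field_simp

lemma inner_tfSecondFF_tangent (h : IsLagrangianChart c G J F U V) (hx : x ∈ U)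
    (u v w : Coord n) : G (F x) (tfSecondFF G J F x u v) (fderiv ℝ F x w) = 0 := by
  have hFx := h.mapsTo x hx
  have h0 : ∀ a b, G (F x) (J (F x) (fderiv ℝ F x a)) (fderiv ℝ F x b) = 0 := fun a b => by
    rw [h.metric.symm _ hFx, h.isotropic x hx]
  simp only [tfSecondFF, map_sub, map_smul, map_add, sub_apply, smul_apply, add_apply, smul_eq_mul,
    h.inner_secondFF_tangent hx, h.inner_meanCurv_tangent hx, h0, mul_zero, add_zero, sub_zero]

lemma contDiffOn_secondFF (h : IsLagrangianChart c G J F U V) (u v : Coord n) :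
    ContDiffOn ℝ ∞ (fun y => secondFF G F y u v) U :=
  ((h.contDiffOn_fullHess u v).sub (h.contDiffOn_fderiv.clm_apply
    ((h.isMetricOn.contDiffOn_christoffelL.clm_apply (contDiffOn_const (c := u))).clm_apply
      (contDiffOn_const (c := v))))).congr fun _ hy => h.secondFF_eq hy u v

lemma contDiffOn_meanCurv (h : IsLagrangianChart c G J F U V) :
    ContDiffOn ℝ ∞ (fun y => meanCurv G F y) U := by
  unfold meanCurv
  exact (ContDiffOn.sum fun i _ => ContDiffOn.sum fun j _ =>
    (h.isMetricOn.contDiffOn_invMetric i j).smul (h.contDiffOn_secondFF _ _)).const_smul _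

lemma contDiffOn_tfSecondFF (h : IsLagrangianChart c G J F U V) (u v : Coord n) :
    ContDiffOn ℝ ∞ (fun y => tfSecondFF G J F y u v) U := by
  unfold tfSecondFF
  have hJ : ∀ w, ContDiffOn ℝ ∞ (fun y => J (F y) (fderiv ℝ F y w)) U := fun w =>
    h.contDiffOn_J_apply (h.contDiffOn_dF w)
  have hH := h.contDiffOn_meanCurv
  have h1 : ContDiffOn ℝ ∞ (fun y => indMetric G F y u v) U :=
    h.contDiffOn_metric_apply (h.contDiffOn_dF u) (h.contDiffOn_dF v)
  exact (h.contDiffOn_secondFF u v).sub (((((h1.smul hH).add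
    ((h.contDiffOn_metric_apply (hJ u) hH).smul (hJ v))).add
    ((h.contDiffOn_metric_apply (hJ v) hH).smul (hJ u)))).const_smul _)

/-- Because J is parallel, differentiating J dF z gives J applied to ∇̄ dF z. Its normal part
becomes tangent and drops out against h̃, leaving the Levi-Civita correction of the third slot. -/
lemma inner_covTfSecondFF (h : IsLagrangianChart c G J F U V) (hn : n ≠ 0) (hx : x ∈ U)
    (u v w z : Coord n) :
    G (F x) (covTfSecondFF G J F x u v w) (J (F x) (fderiv ℝ F x z)) =
      cubicCov (indMetric G F) (tfCubicForm G J F) x u v w z := by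
  rw [cubicCov_apply (h.diffAt hx h.contDiffOn_tfCubicForm)]
  simp only [covTfSecondFF, map_sub, sub_apply, h.inner_tfSecondFF hn hx, normalCov,
    h.inner_normalProj_normal hx]
  have h1 := h.fderiv_metric_along hx (h.contDiffOn_tfSecondFF v w)
    (h.contDiffOn_J_apply (h.contDiffOn_dF z)) u
  have h2 : (fun y => G (F y) (tfSecondFF G J F y v w) (J (F y) (fderiv ℝ F y z))) =ᶠ[nhds x]
      fun y => tfCubicForm G J F y v w z := by
    filter_upwards [h.isOpen.mem_nhds hx] with y hy using h.inner_tfSecondFF hn hy v w z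
  have e1 : fullHess G F x u z =
      secondFF G F x u z + fderiv ℝ F x (christoffel (indMetric G F) x u z) := by
    rw [h.secondFF_eq hx]; abel
  rw [h2.fderiv_eq, h.covAlong_J hx (h.contDiffOn_dF z), h.covAlong_dF hx, e1, map_add, map_add,
    h.J_normal hx (h.inner_tfSecondFF_tangent hx v w) (h.inner_secondFF_tangent hx u z),
    h.inner_tfSecondFF hn hx] at h1
  rw [h1]
  ring

lemma inner_covTfSecondFF_tangent (h : IsLagrangianChart c G J F U V) (hx : x ∈ U)
    (u v w z : Coord n) : G (F x) (covTfSecondFF G J F x u v w) (fderiv ℝ F x z) = 0 := by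
  simp only [covTfSecondFF, map_sub, sub_apply, h.inner_tfSecondFF_tangent hx, normalCov,
    h.inner_normalProj_tangent hx, sub_zero]

/-- Expanding the normal inner product in the components along J dF supplies the third trace. -/
lemma normSqTf_eq (h : IsLagrangianChart c G J F U V) (hn : n ≠ 0) (hx : x ∈ U) :
    normSqTf G J F x =
      cubicInner (indMetric G F) x (tfCubicForm G J F x) (tfCubicForm G J F x) := by
  have h1 : ∀ a b a' b', G (F x) (tfSecondFF G J F x a b) (tfSecondFF G J F x a' b') =
      metricTrace (indMetric G F) x fun k k' =>
        tfCubicForm G J F x a b k * tfCubicForm G J F x a' b' k' := by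
    intro a b a' b'
    rw [h.inner_normal hx (h.inner_tfSecondFF_tangent hx a' b')]
    simp only [h.inner_tfSecondFF hn hx]
  unfold normSqTf
  simp only [h1, cubicInner, metricTrace, Finset.mul_sum, mul_assoc]

lemma normSqCovTf_eq (h : IsLagrangianChart c G J F U V) (hn : n ≠ 0) (hx : x ∈ U) :
    normSqCovTf G J F x = metricTrace (indMetric G F) x fun k k' =>
      cubicInner (indMetric G F) x (cubicCov (indMetric G F) (tfCubicForm G J F) x k)
        (cubicCov (indMetric G F) (tfCubicForm G J F) x k') := by
  have h1 : ∀ a b d a' b' d', G (F x) (covTfSecondFF G J F x a b d)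
      (covTfSecondFF G J F x a' b' d') = metricTrace (indMetric G F) x fun k k' =>
        cubicCov (indMetric G F) (tfCubicForm G J F) x a b d k *
        cubicCov (indMetric G F) (tfCubicForm G J F) x a' b' d' k' := by
    intro a b d a' b' d'
    rw [h.inner_normal hx (h.inner_covTfSecondFF_tangent hx a' b' d')]
    simp only [h.inner_covTfSecondFF hn hx]
  unfold normSqCovTf
  simp only [h1, cubicInner, metricTrace, Finset.mul_sum, mul_assoc]

lemma tensorT_eq (h : IsLagrangianChart c G J F U V) (hn : n ≠ 0) (hx : x ∈ U) (v w : Coord n) :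
    tensorT G J F x v w = (1 / (n : ℝ)) * metricTrace (indMetric G F) x fun k l =>
      cubicCov (indMetric G F) (tfCubicForm G J F) x k v w l := by
  simp only [tensorT, h.inner_covTfSecondFF hn hx, metricTrace]

lemma innerTfCovT_eq (h : IsLagrangianChart c G J F U V) (hn : n ≠ 0) (hx : x ∈ U) :
    innerTfCovT G J F x = metricTrace (indMetric G F) x fun k k' =>
      metricTrace (indMetric G F) x fun i i' => metricTrace (indMetric G F) x fun j j' =>
        tfCubicForm G J F x i j k *
          covTwoTensor (indMetric G F) (tensorT G J F) x k' i' j' := by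
  unfold innerTfCovT
  simp only [h.inner_tfSecondFF hn hx, metricTrace, Finset.mul_sum, mul_assoc]

lemma normSqMeanCurv_eq (h : IsLagrangianChart c G J F U V) (hx : x ∈ U) :
    normSqMeanCurv G F x = metricTrace (indMetric G F) x fun k l =>
      ((1 / (n : ℝ)) * cubicTrace (indMetric G F) x (cubicForm G J F x) k) *
        ((1 / (n : ℝ)) * cubicTrace (indMetric G F) x (cubicForm G J F x) l) := by
  rw [normSqMeanCurv, h.inner_normal hx (h.inner_meanCurv_tangent hx)]
  simp only [h.inner_meanCurv hx]

end IsLagrangianChart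

/-! ### Second covariant derivatives: bilinearity, Bochner's formula, symmetries and divergence -/

variable {g : Coord n → Coord n →L[ℝ] Coord n →L[ℝ] ℝ} {P : Coord n → Cubic n}

/-- Makes the bilinear dependence on u and v visible, as required for tracing in an orthonormal
frame. -/
lemma IsMetricOn.cubicHess_eq (h : IsMetricOn g U) (hx : x ∈ U) (hP : ContDiffOn ℝ ∞ P U)
    (u v : Coord n) :
    cubicHess g P x u v = fderiv ℝ (fderiv ℝ P) x u v
      - (cubicAct (christoffelL g x v) (fderiv ℝ P x u)
      + cubicAct (fderiv ℝ (christoffelL g) x u v) (P x))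
      - cubicAct (christoffelL g x u) (cubicCov g P x v)
      - cubicCov g P x (christoffelL g x u v) := by
  rw [cubicHess, cubicCov, h.fderiv_cubicCov hx hP]
  rfl

lemma IsMetricOn.cubicHess_add_left (h : IsMetricOn g U) (hx : x ∈ U) (hP : ContDiffOn ℝ ∞ P U)
    (u u' v : Coord n) :
    cubicHess g P x (u + u') v = cubicHess g P x u v + cubicHess g P x u' v := by
  simp only [h.cubicHess_eq hx hP, map_add, add_apply, cubicCov_add]
  abel

lemma IsMetricOn.cubicHess_smul_left (h : IsMetricOn g U) (hx : x ∈ U) (hP : ContDiffOn ℝ ∞ P U)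
    (r : ℝ) (u v : Coord n) : cubicHess g P x (r • u) v = r • cubicHess g P x u v := by
  simp only [h.cubicHess_eq hx hP, map_smul, smul_apply, cubicCov_smul, smul_sub, smul_add]

lemma IsMetricOn.cubicHess_add_right (h : IsMetricOn g U) (hx : x ∈ U) (hP : ContDiffOn ℝ ∞ P U)
    (u v v' : Coord n) :
    cubicHess g P x u (v + v') = cubicHess g P x u v + cubicHess g P x u v' := by
  simp only [h.cubicHess_eq hx hP, map_add, add_apply, cubicCov_add]
  abel

lemma IsMetricOn.cubicHess_smul_right (h : IsMetricOn g U) (hx : x ∈ U) (hP : ContDiffOn ℝ ∞ P U)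
    (r : ℝ) (u v : Coord n) : cubicHess g P x u (r • v) = r • cubicHess g P x u v := by
  simp only [h.cubicHess_eq hx hP, map_smul, smul_apply, cubicCov_smul, smul_sub, smul_add]

lemma cubicInner_add_left (A B Q : Cubic n) :
    cubicInner g x (A + B) Q = cubicInner g x A Q + cubicInner g x B Q := by
  simp only [cubicInner, add_apply, add_mul, metricTrace_add]

lemma cubicInner_sub_left (A B Q : Cubic n) :
    cubicInner g x (A - B) Q = cubicInner g x A Q - cubicInner g x B Q := by
  simp only [cubicInner, sub_apply, sub_mul, metricTrace_sub]

lemma cubicInner_add_right (Q A B : Cubic n) :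
    cubicInner g x Q (A + B) = cubicInner g x Q A + cubicInner g x Q B := by
  simp only [cubicInner, add_apply, mul_add, metricTrace_add]

lemma cubicInner_smul_left (r : ℝ) (A Q : Cubic n) :
    cubicInner g x (r • A) Q = r * cubicInner g x A Q := by
  simp only [cubicInner, smul_apply, smul_eq_mul, mul_assoc, metricTrace_mul_left]

lemma cubicInner_smul_right (r : ℝ) (Q A : Cubic n) :
    cubicInner g x Q (r • A) = r * cubicInner g x Q A := by
  simp only [cubicInner, smul_apply, smul_eq_mul, mul_left_comm _ r, metricTrace_mul_left]

/-- The Bochner formula for `|P|²`. -/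
lemma IsMetricOn.laplacian_cubicInner (h : IsMetricOn g U) (hx : x ∈ U) (hP : ContDiffOn ℝ ∞ P U)
    {φ : Coord n → ℝ} (hφ : ∀ y ∈ U, φ y = cubicInner g y (P y) (P y)) {e : Fin n → Coord n}
    (he : IsFrame g x e) :
    laplacian g φ x = 2 * ∑ k, (cubicInner g x (cubicHess g P x (e k) (e k)) (P x) +
      cubicInner g x (cubicCov g P x (e k)) (cubicCov g P x (e k))) := by
  have symm : ∀ y ∈ U, ∀ A B : Cubic n, cubicInner g y A B = cubicInner g y B A := by
    intro y hy A B
    obtain ⟨f, hf⟩ := h.exists_frame hy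
    simp only [hf.cubicInner_eq, mul_comm]
  have d1 : ∀ y ∈ U, ∀ v, fderiv ℝ φ y v = 2 * cubicInner g y (cubicCov g P y v) (P y) := by
    intro y hy v
    have : φ =ᶠ[nhds y] fun y => cubicInner g y (P y) (P y) := by
      filter_upwards [h.isOpen.mem_nhds hy] with z hz using hφ z hz
    have hPy := h.differentiableAt_of_contDiffOn hy hP
    rw [this.fderiv_eq, h.fderiv_cubicInner hy hPy hPy, symm y hy (P y)]
    ring
  have hPx := h.differentiableAt_of_contDiffOn hx hP
  have dI : ∀ v, DifferentiableAt ℝ (fun y => cubicInner g y (cubicCov g P y v) (P y)) x := by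
    intro v
    have hc := h.differentiableAt_of_contDiffOn hx (h.contDiffOn_cubicCov hP v)
    unfold cubicInner
    refine h.differentiableAt_metricTrace hx (β := fun y i i' => metricTrace g y fun j j' =>
      metricTrace g y fun k k' => cubicCov g P y v i j k * P y i' j' k') fun i i' => ?_
    refine h.differentiableAt_metricTrace hx (β := fun y j j' =>
      metricTrace g y fun k k' => cubicCov g P y v _ j k * P y _ j' k') fun j j' => ?_
    refine h.differentiableAt_metricTrace hx (β := fun y k k' =>
      cubicCov g P y v _ _ k * P y _ _ k') fun k k' => ?_
    exact (differentiableAt_cubic_apply hc _ _ _).fun_mul (differentiableAt_cubic_apply hPx _ _ _)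
  have d2 : ∀ u v, fderiv ℝ (fun y => fderiv ℝ φ y v) x u - fderiv ℝ φ x (christoffel g x u v) =
      2 * (cubicInner g x (cubicHess g P x u v) (P x)
        + cubicInner g x (cubicCov g P x v) (cubicCov g P x u)) := by
    intro u v
    have hc := h.differentiableAt_of_contDiffOn hx (h.contDiffOn_cubicCov hP v)
    have : (fun y => fderiv ℝ φ y v) =ᶠ[nhds x]
        fun y => 2 * cubicInner g y (cubicCov g P y v) (P y) := by
      filter_upwards [h.isOpen.mem_nhds hx] with z hz using d1 z hz v
    rw [this.fderiv_eq, fderiv_const_mul (dI v), smul_apply, smul_eq_mul,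
      h.fderiv_cubicInner hx hc hPx, d1 x hx, cubicHess]
    rw [cubicInner_sub_left]
    ring
  have h1 : laplacian g φ x = metricTrace g x fun u v =>
      2 * (cubicInner g x (cubicHess g P x u v) (P x)
        + cubicInner g x (cubicCov g P x v) (cubicCov g P x u)) := by
    simp only [laplacian, metricTrace, d2]
  rw [h1, he.trace_eq, Finset.mul_sum]
  constructor <;> intros
  · rw [h.cubicHess_add_left hx hP, cubicCov_add, cubicInner_add_left, cubicInner_add_right]
    ring
  · rw [h.cubicHess_smul_left hx hP, cubicCov_smul, cubicInner_smul_left, cubicInner_smul_right]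
    ring
  · rw [h.cubicHess_add_right hx hP, cubicCov_add, cubicInner_add_left, cubicInner_add_left]
    ring
  · rw [h.cubicHess_smul_right hx hP, cubicCov_smul, cubicInner_smul_left, cubicInner_smul_left]
    ring

/-- Symmetry in the first two arguments passes to the covariant derivative. -/
lemma IsMetricOn.cubicCov_symm12 (h : IsMetricOn g U) (hx : x ∈ U) (hP : ContDiffOn ℝ ∞ P U)
    (hs : ∀ y ∈ U, ∀ a b d, P y a b d = P y b a d) (u a b d : Coord n) :
    cubicCov g P x u a b d = cubicCov g P x u b a d := by
  have hPx := h.differentiableAt_of_contDiffOn hx hP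
  have : (fun y => P y a b d) =ᶠ[nhds x] fun y => P y b a d := by
    filter_upwards [h.isOpen.mem_nhds hx] with y hy using hs y hy a b d
  rw [cubicCov_apply hPx, cubicCov_apply hPx, this.fderiv_eq, hs x hx _ b d, hs x hx a _ d,
    hs x hx a b]
  ring

/-- Symmetry in the last two arguments passes to the covariant derivative. -/
lemma IsMetricOn.cubicCov_symm23 (h : IsMetricOn g U) (hx : x ∈ U) (hP : ContDiffOn ℝ ∞ P U)
    (hs : ∀ y ∈ U, ∀ a b d, P y a b d = P y a d b) (u a b d : Coord n) :
    cubicCov g P x u a b d = cubicCov g P x u a d b := by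
  have hPx := h.differentiableAt_of_contDiffOn hx hP
  have : (fun y => P y a b d) =ᶠ[nhds x] fun y => P y a d b := by
    filter_upwards [h.isOpen.mem_nhds hx] with y hy using hs y hy a b d
  rw [cubicCov_apply hPx, cubicCov_apply hPx, this.fderiv_eq, hs x hx _ b d, hs x hx a _ d,
    hs x hx a b]
  ring

lemma IsMetricOn.cubicHess_symm12 (h : IsMetricOn g U) (hx : x ∈ U) (hP : ContDiffOn ℝ ∞ P U)
    (hs : ∀ y ∈ U, ∀ a b d, P y a b d = P y b a d) (u v a b d : Coord n) :
    cubicHess g P x u v a b d = cubicHess g P x u v b a d := by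
  simp only [cubicHess, sub_apply]
  rw [h.cubicCov_symm12 hx (h.contDiffOn_cubicCov hP v)
      (fun y hy => h.cubicCov_symm12 hy hP hs v) u, h.cubicCov_symm12 hx hP hs]

lemma IsMetricOn.cubicHess_symm23 (h : IsMetricOn g U) (hx : x ∈ U) (hP : ContDiffOn ℝ ∞ P U)
    (hs : ∀ y ∈ U, ∀ a b d, P y a b d = P y a d b) (u v a b d : Coord n) :
    cubicHess g P x u v a b d = cubicHess g P x u v a d b := by
  simp only [cubicHess, sub_apply]
  rw [h.cubicCov_symm23 hx (h.contDiffOn_cubicCov hP v)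
      (fun y hy => h.cubicCov_symm23 hy hP hs v) u, h.cubicCov_symm23 hx hP hs]

/-- The Codazzi symmetry passes to the second covariant derivative. -/
lemma IsMetricOn.cubicHess_codazzi (h : IsMetricOn g U) (hx : x ∈ U) (hP : ContDiffOn ℝ ∞ P U)
    (hs : ∀ y ∈ U, ∀ v a b d, cubicCov g P y v a b d = cubicCov g P y a v b d)
    (u v a b d : Coord n) : cubicHess g P x u v a b d = cubicHess g P x u a v b d := by
  have hc := fun v => h.differentiableAt_of_contDiffOn hx (h.contDiffOn_cubicCov hP v)
  have : (fun y => cubicCov g P y v a b d) =ᶠ[nhds x] fun y => cubicCov g P y a v b d := by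
    filter_upwards [h.isOpen.mem_nhds hx] with y hy using hs y hy v a b d
  simp only [cubicHess, sub_apply]
  rw [cubicCov_apply (hc v), cubicCov_apply (hc a), this.fderiv_eq, hs x hx v _ b d,
    hs x hx v a _ d, hs x hx v a b, hs x hx _ a b d]
  ring

/-- Covariant differentiation of the divergence of a field of trilinear forms. -/
lemma IsMetricOn.covTwoTensor_divergence (h : IsMetricOn g U) (hx : x ∈ U)
    (hP : ContDiffOn ℝ ∞ P U) {S : Coord n → Coord n → Coord n → ℝ} {r : ℝ}
    (hS : ∀ y ∈ U, ∀ v w, S y v w = r * metricTrace g y fun k l => cubicCov g P y k v w l)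
    (u v w : Coord n) :
    covTwoTensor g S x u v w = r * metricTrace g x fun k l => cubicHess g P x u k v w l := by
  have hc := fun v => h.differentiableAt_of_contDiffOn hx (h.contDiffOn_cubicCov hP v)
  have h1 : (fun y => S y v w) =ᶠ[nhds x]
      fun y => r * metricTrace g y fun k l => cubicCov g P y k v w l := by
    filter_upwards [h.isOpen.mem_nhds hx] with y hy using hS y hy v w
  have hd : ∀ k l, DifferentiableAt ℝ
      (fun y => cubicCov g P y (basisVec k) v w (basisVec l)) x := fun k l =>
    differentiableAt_cubic_apply (hc _) _ _ _
  rw [covTwoTensor, h1.fderiv_eq, fderiv_const_mul (h.differentiableAt_metricTrace hx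
    (β := fun y k l => cubicCov g P y k v w l) hd), smul_apply, smul_eq_mul,
    h.fderiv_metricTrace hx (β := fun y k l => cubicCov g P y k v w l)
    ⟨by simp [cubicCov_add], by simp [cubicCov_smul], by simp, by simp⟩ hd, hS x hx, hS x hx,
    ← mul_sub, ← mul_sub, ← metricTrace_sub, ← metricTrace_sub]
  congr 2
  funext k l
  rw [cubicHess, sub_apply, sub_apply, sub_apply, cubicCov_apply (hc k), covTwoTensor]
  ring

end Invariants

/-! ### Simons' identity in an orthonormal frame and the resulting inequality -/

section SimonsInequality

variable {n m : ℕ} {c : ℝ} {G : Coord m → Coord m →L[ℝ] Coord m →L[ℝ] ℝ}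
  {J : Coord m → Coord m →L[ℝ] Coord m} {F : Coord n → Coord m} {U : Set (Coord n)}
  {V : Set (Coord m)} {x : Coord n} {e : Fin n → Coord n}
  {g : Coord n → Coord n →L[ℝ] Coord n →L[ℝ] ℝ}

/-- The components of a trilinear form in a frame. -/
def comp (e : Fin n → Coord n) (P : Cubic n) (i j k : Fin n) : ℝ := P (e i) (e j) (e k)

lemma IsFrame.comp_tracefreePart (he : IsFrame g x e) (P : Cubic n) (i j k : Fin n) :
    comp e (tracefreePart g x P) i j k =
      comp e P i j k - kronSym (fun a => (1 / ((n : ℝ) + 2)) * cubicTrace g x P (e a)) i j k := by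
  simp only [comp, tracefreePart, sub_apply, smul_apply, smul_eq_mul, symProd_apply,
    he.orthonormal, kronSym, kron]
  ring

/-- Pure trace forms are orthogonal to trace-free ones: each Kronecker symbol contracts two slots of
t. -/
lemma sum_kronSym_mul {t : Fin n → Fin n → Fin n → ℝ} (ht : IsTracefree t) (b : Fin n → ℝ) :
    ∑ i, ∑ j, ∑ k, kronSym b i j k * t i j k = 0 := by
  have h1 : ∀ i, ∑ j, ∑ k, kronSym b i j k * t i j k =
      ∑ k, b k * t i i k + ∑ j, b j * t i j i + b i * ∑ j, t i j j := by
    intro i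
    calc _ = ∑ j, kron i j * ∑ k, b k * t i j k + ∑ j, b j * ∑ k, kron i k * t i j k
        + b i * ∑ j, ∑ k, kron j k * t i j k := by
          simp only [Finset.mul_sum, ← Finset.sum_add_distrib, kronSym]
          exact Finset.sum_congr rfl fun j _ => Finset.sum_congr rfl fun k _ => by ring
      _ = _ := by simp only [sum_kron_mul]
  have h2 : ∀ i, ∑ j, t i j j = 0 := fun i => by
    rw [← ht.trace i]
    exact Finset.sum_congr rfl fun j _ => by rw [ht.swap12, ht.swap23]
  have h3 : ∑ i, ∑ k, b k * t i i k = 0 := by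
    rw [Finset.sum_comm]
    simp only [← Finset.mul_sum, ht.trace, mul_zero, Finset.sum_const_zero]
  have h4 : ∑ i, ∑ j, b j * t i j i = 0 := by
    rw [Finset.sum_comm]
    simp only [← Finset.mul_sum, ht.trace13, mul_zero, Finset.sum_const_zero]
  simp only [h1, h2, mul_zero, add_zero, Finset.sum_add_distrib, h3, h4]

/-- The trace of `kronSym b` is (n + 2)b, which is why subtracting with weight 1/(n + 2) removes the
trace. -/
lemma IsFrame.isTracefree_comp (he : IsFrame g x e) {P : Cubic n}
    (h12 : ∀ a b d, P a b d = P b a d) (h23 : ∀ a b d, P a b d = P a d b) :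
    IsTracefree (comp e (tracefreePart g x P)) := by
  have s12 : ∀ (b : Fin n → ℝ) i j k, kronSym b i j k = kronSym b j i k := by
    intro b i j k
    simp only [kronSym, kron_comm i j]
    ring
  have s23 : ∀ (b : Fin n → ℝ) i j k, kronSym b i j k = kronSym b i k j := by
    intro b i j k
    simp only [kronSym, kron_comm j k]
    ring
  refine ⟨fun i j k => ?_, fun i j k => ?_, fun k => ?_⟩
  · rw [he.comp_tracefreePart, he.comp_tracefreePart, s12, comp, h12, comp]
  · rw [he.comp_tracefreePart, he.comp_tracefreePart, s23, comp, h23, comp]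
  · have hn2 : (n : ℝ) + 2 ≠ 0 := by positivity
    simp only [he.comp_tracefreePart, Finset.sum_sub_distrib]
    simp only [comp, ← he.cubicTrace_eq, kronSym, kron_self, one_mul, Finset.sum_add_distrib,
      Finset.sum_const, Finset.card_univ, Fintype.card_fin, nsmul_eq_mul, sum_kron_mul']
    field_simp
    ring

/-- The terms of Simons' identity that involve second derivatives. -/
lemma simons_second_order {t : Fin n → Fin n → Fin n → ℝ} (ht : IsTracefree t)
    {H : Fin n → Fin n → Fin n → Fin n → Fin n → ℝ}
    (hC : ∀ u v i j k, H u v i j k = H u i v j k)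
    (h12 : ∀ u v i j k, H u v i j k = H u v j i k)
    (h23 : ∀ u v i j k, H u v i j k = H u v i k j) (hn : n ≠ 0)
    {τ : Fin n → Fin n → Fin n → ℝ} (hτ : ∀ u v k, τ u v k = ∑ a, H u v a a k) :
    ((n : ℝ) + 2) * ∑ k, ∑ i, ∑ j, t i j k * ((1 / (n : ℝ)) * ∑ l, (H k l i j l
      - kronSym (fun a => (1 / ((n : ℝ) + 2)) * τ k l a) i j l)) =
    ∑ i, ∑ j, ∑ m, t i j m * ∑ k, H m k i j k := by
  have hn' : (n : ℝ) ≠ 0 := by exact_mod_cast hn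
  have hn2 : (n : ℝ) + 2 ≠ 0 := by positivity
  -- By Codazzi the divergence of C is the derivative of its trace; here this is used after one more
  -- differentiation.
  have hX : ∀ k i j, τ k j i = ∑ l, H k l i j l := by
    intro k i j
    rw [hτ]
    refine Finset.sum_congr rfl fun a _ => ?_
    rw [hC, h12, h23, h12, h23]
  -- Two of the three trace terms return the same divergence, leaving 1 − 2/(n+2) = n/(n+2) of it.
  -- The third is a multiple of δ_ij, which t annihilates.
  have hl : ∀ k i j, ∑ l, (H k l i j l - kronSym (fun a => (1 / ((n : ℝ) + 2)) * τ k l a) i j l) =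
      (n : ℝ) / ((n : ℝ) + 2) * (∑ l, H k l i j l)
        - kron i j * ((1 / ((n : ℝ) + 2)) * ∑ l, τ k l l) := by
    intro k i j
    have e1 : ∑ l, kronSym (fun a => (1 / ((n : ℝ) + 2)) * τ k l a) i j l =
        kron i j * ((1 / ((n : ℝ) + 2)) * ∑ l, τ k l l)
          + (1 / ((n : ℝ) + 2)) * (τ k i j + τ k j i) := by
      calc _ = kron i j * ((1 / ((n : ℝ) + 2)) * ∑ l, τ k l l)
          + (1 / ((n : ℝ) + 2)) * (∑ l, kron i l * τ k l j + ∑ l, kron j l * τ k l i) := by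
            simp only [kronSym, Finset.mul_sum, ← Finset.sum_add_distrib]
            exact Finset.sum_congr rfl fun l _ => by ring
        _ = _ := by rw [sum_kron_mul, sum_kron_mul]
    have e2 : ∑ l, H k l j i l = ∑ l, H k l i j l := Finset.sum_congr rfl fun l _ => h12 _ _ _ _ _
    rw [Finset.sum_sub_distrib, e1, hX k i j, hX k j i, e2]
    field_simp
    ring
  have h0 : ∑ k, ∑ i, ∑ j, t i j k * (kron i j * ((1 / ((n : ℝ) + 2)) * ∑ l, τ k l l)) = 0 := by
    refine Finset.sum_eq_zero fun k _ => ?_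
    have : ∀ i, ∑ j, t i j k * (kron i j * ((1 / ((n : ℝ) + 2)) * ∑ l, τ k l l)) =
        t i i k * ((1 / ((n : ℝ) + 2)) * ∑ l, τ k l l) := by
      intro i
      rw [← sum_kron_mul i fun j => t i j k * ((1 / ((n : ℝ) + 2)) * ∑ l, τ k l l)]
      exact Finset.sum_congr rfl fun j _ => by ring
    simp only [this, ← Finset.sum_mul, ht.trace, zero_mul]
  have h1 : ((n : ℝ) + 2) * ∑ k, ∑ i, ∑ j, t i j k * ((1 / (n : ℝ)) * ∑ l, (H k l i j l
      - kronSym (fun a => (1 / ((n : ℝ) + 2)) * τ k l a) i j l)) =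
      ∑ k, ∑ i, ∑ j, t i j k * (∑ l, H k l i j l) - (((n : ℝ) + 2) / n) *
        ∑ k, ∑ i, ∑ j, t i j k * (kron i j * ((1 / ((n : ℝ) + 2)) * ∑ l, τ k l l)) := by
    simp only [hl]
    simp only [Finset.mul_sum (s := Finset.univ) (a := ((n : ℝ) + 2)),
      Finset.mul_sum (s := Finset.univ) (a := ((n : ℝ) + 2) / n), ← Finset.sum_sub_distrib]
    refine Finset.sum_congr rfl fun k _ => Finset.sum_congr rfl fun i _ =>
      Finset.sum_congr rfl fun j _ => ?_
    field_simp
  rw [h1, h0, mul_zero, sub_zero]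
  calc _ = ∑ i, ∑ k, ∑ j, t i j k * (∑ l, H k l i j l) := Finset.sum_comm
    _ = _ := Finset.sum_congr rfl fun i _ => Finset.sum_comm

/-- Simons' inequality in coordinates. -/
theorem IsLagrangianChart.simons_inequality (h : IsLagrangianChart c G J F U V) (hn : 2 ≤ n)
    (hx : x ∈ U) :
    (1 / 2) * laplacian (indMetric G F) (normSqTf G J F) x ≥
      ((n : ℝ) + 2) * innerTfCovT G J F x + normSqCovTf G J F x
        + ((n : ℝ) + 1) * c * normSqTf G J F x
        + (n : ℝ) ^ 2 / ((n : ℝ) + 2) * normSqTf G J F x * normSqMeanCurv G F x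
        - ((n : ℝ) + 3) / 2 * normSqTf G J F x ^ 2 := by
  have hn0 : n ≠ 0 := by omega
  have hM := h.isMetricOn
  have hCs := h.contDiffOn_cubicForm
  have hTs := h.contDiffOn_tfCubicForm
  obtain ⟨e, he⟩ := hM.exists_frame hx
  set g := indMetric G F with hg
  set t := comp e (tfCubicForm G J F x) with ht_def
  set C := comp e (cubicForm G J F x) with hC_def
  set H : Fin n → Fin n → Fin n → Fin n → Fin n → ℝ := fun u v i j k =>
    comp e (cubicHess g (cubicForm G J F) x (e u) (e v)) i j k with hH
  set b : Fin n → ℝ := fun a =>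
    (1 / ((n : ℝ) + 2)) * cubicTrace g x (cubicForm G J F x) (e a) with hb
  have ht : IsTracefree t :=
    he.isTracefree_comp (h.cubicForm_symm12 hx) (h.cubicForm_symm23 hx)
  have hCt : ∀ i j k, C i j k = t i j k + kronSym b i j k := by
    intro i j k
    have := he.comp_tracefreePart (cubicForm G J F x) i j k
    rw [ht_def, tfCubicForm, this]
    ring
  have hHess : ∀ u v i j k, comp e (cubicHess g (tfCubicForm G J F) x (e u) (e v)) i j k =
      H u v i j k - kronSym (fun a => (1 / ((n : ℝ) + 2)) *
        cubicTrace g x (cubicHess g (cubicForm G J F) x (e u) (e v)) (e a)) i j k := by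
    intro u v i j k
    have := hM.cubicHess_tracefreePart hx hCs (e u) (e v)
    rw [hH, ← he.comp_tracefreePart, ← this]
    rfl
  have hcod : ∀ u v i j k, H u v i j k = H u i v j k := fun u v i j k =>
    hM.cubicHess_codazzi hx hCs (fun y hy => h.codazzi hy) _ _ _ _ _
  have hH12 : ∀ u v i j k, H u v i j k = H u v j i k := fun u v i j k =>
    hM.cubicHess_symm12 hx hCs (fun y hy => h.cubicForm_symm12 hy) _ _ _ _ _
  have hH23 : ∀ u v i j k, H u v i j k = H u v i k j := fun u v i j k =>
    hM.cubicHess_symm23 hx hCs (fun y hy => h.cubicForm_symm23 hy) _ _ _ _ _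
  have hnorm : normSqTf G J F x = ∑ k, sliceGram t k k := by
    rw [h.normSqTf_eq hn0 hx, he.cubicInner_eq]
    rfl
  have hcov : normSqCovTf G J F x = ∑ k, cubicInner g x (cubicCov g (tfCubicForm G J F) x (e k))
      (cubicCov g (tfCubicForm G J F) x (e k)) := by
    rw [h.normSqCovTf_eq hn0 hx, he.trace_eq]
    constructor <;> intros <;>
      simp only [cubicCov_add, cubicCov_smul, cubicInner_add_left, cubicInner_add_right,
        cubicInner_smul_left, cubicInner_smul_right]
  -- The trace of C is n times the components of H, so b is n/(n+2) times them.
  have hmean : (n : ℝ) ^ 2 / ((n : ℝ) + 2) * normSqMeanCurv G F x =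
      ((n : ℝ) + 2) * ∑ a, b a ^ 2 := by
    have hn' : (n : ℝ) ≠ 0 := by exact_mod_cast hn0
    have hn2 : (n : ℝ) + 2 ≠ 0 := by positivity
    rw [h.normSqMeanCurv_eq hx, he.trace_eq _ ⟨by intros; simp; ring, by intros; simp; ring,
      by intros; simp; ring, by intros; simp; ring⟩, Finset.mul_sum, Finset.mul_sum]
    refine Finset.sum_congr rfl fun a _ => ?_
    simp only [hb]
    field_simp
    rfl
  have hdiv : ((n : ℝ) + 2) * innerTfCovT G J F x = ∑ i, ∑ j, ∑ m, t i j m * ∑ k, H m k i j k := by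
    rw [← simons_second_order ht hcod hH12 hH23 hn0 (τ := fun u v a =>
      cubicTrace g x (cubicHess g (cubicForm G J F) x (e u) (e v)) (e a))
      (fun u v k => he.cubicTrace_eq _ _)]
    congr 1
    have hT : ∀ u v w, covTwoTensor g (tensorT G J F) x u v w = (1 / (n : ℝ)) *
        ∑ l, cubicHess g (tfCubicForm G J F) x u (e l) v w (e l) := by
      intro u v w
      rw [hM.covTwoTensor_divergence hx hTs (fun y hy => h.tensorT_eq hn0 hy), he.trace_eq]
      exact ⟨by simp [hM.cubicHess_add_right hx hTs], by simp [hM.cubicHess_smul_right hx hTs],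
        by simp, by simp⟩
    rw [h.innerTfCovT_eq hn0 hx]
    simp only [← hg, hT]
    have f1 : ∀ k k' i i', metricTrace g x (fun j j' => tfCubicForm G J F x i j k * ((1 / (n : ℝ)) *
        ∑ l, cubicHess g (tfCubicForm G J F) x k' (e l) i' j' (e l))) =
        ∑ j, tfCubicForm G J F x i (e j) k * ((1 / (n : ℝ)) *
        ∑ l, cubicHess g (tfCubicForm G J F) x k' (e l) i' (e j) (e l)) := fun k k' i i' =>
      he.trace_eq _ ⟨by intros; simp; ring, by intros; simp; ring,
        by intros; simp [Finset.sum_add_distrib]; ring,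
        by intros; simp [← Finset.mul_sum]; ring⟩
    have f2 : ∀ k k', metricTrace g x (fun i i' => ∑ j, tfCubicForm G J F x i (e j) k *
        ((1 / (n : ℝ)) * ∑ l, cubicHess g (tfCubicForm G J F) x k' (e l) i' (e j) (e l))) =
        ∑ i, ∑ j, tfCubicForm G J F x (e i) (e j) k * ((1 / (n : ℝ)) *
        ∑ l, cubicHess g (tfCubicForm G J F) x k' (e l) (e i) (e j) (e l)) := fun k k' =>
      he.trace_eq _ ⟨by intros; simp [add_mul, Finset.sum_add_distrib],
        by intros; simp [mul_assoc, Finset.mul_sum],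
        by intros; simp [mul_add, Finset.sum_add_distrib],
        by intros; simp only [map_smul, smul_apply, smul_eq_mul, ← Finset.mul_sum]
           rw [Finset.mul_sum]; exact Finset.sum_congr rfl fun _ _ => by ring⟩
    simp only [f1, f2]
    rw [he.trace_eq]
    · refine Finset.sum_congr rfl fun k _ => Finset.sum_congr rfl fun i _ =>
        Finset.sum_congr rfl fun j _ => ?_
      congr 2
      exact Finset.sum_congr rfl fun l _ => hHess k l i j l
    · exact ⟨by intros; simp [add_mul, Finset.sum_add_distrib],
        by intros; simp [mul_assoc, Finset.mul_sum],
        by intros; simp [hM.cubicHess_add_left hx hTs, mul_add, Finset.sum_add_distrib],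
        by intros; simp only [hM.cubicHess_smul_left hx hTs, smul_apply, smul_eq_mul,
             ← Finset.mul_sum]
           rw [Finset.mul_sum]; refine Finset.sum_congr rfl fun _ _ => ?_
           rw [Finset.mul_sum]; exact Finset.sum_congr rfl fun _ _ => by ring⟩
  have hlap : (1 / 2) * laplacian g (normSqTf G J F) x =
      ∑ i, ∑ j, ∑ m, t i j m * ∑ k, H k m i j k + normSqCovTf G J F x := by
    rw [hM.laplacian_cubicInner hx hTs (fun y hy => h.normSqTf_eq hn0 hy) he, hcov,
      Finset.sum_add_distrib]
    have e1 : ∀ k, cubicInner g x (cubicHess g (tfCubicForm G J F) x (e k) (e k))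
        (tfCubicForm G J F x) = ∑ i, ∑ j, ∑ m, H k m i j k * t i j m := by
      intro k
      rw [he.cubicInner_eq]
      -- ∇²t differs from ∇²C by a pure trace form, which is orthogonal to t.
      have e2 := sum_kronSym_mul ht (fun a => (1 / ((n : ℝ) + 2)) *
        cubicTrace g x (cubicHess g (cubicForm G J F) x (e k) (e k)) (e a))
      rw [← sub_zero (∑ i, ∑ j, ∑ m, H k m i j k * t i j m), ← e2]
      simp only [← Finset.sum_sub_distrib]
      refine Finset.sum_congr rfl fun i _ => Finset.sum_congr rfl fun j _ =>
        Finset.sum_congr rfl fun m _ => ?_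
      have e3 := hHess k k i j m
      -- The last four indices of H are freely permutable; this brings m into the derivative slot,
      -- ready for the Ricci identity.
      have e4 : H k k i j m = H k m i j k := by
        rw [hH23, hH12, hH23, hcod, hH12, hH23, hH12]
      rw [← sub_mul, ← e4, ← e3]
      rfl
    simp only [e1]
    have e5 : ∑ i, ∑ j, ∑ m, t i j m * ∑ k, H k m i j k =
        ∑ k, ∑ i, ∑ j, ∑ m, H k m i j k * t i j m := by
      simp only [Finset.mul_sum]
      calc _ = ∑ i, ∑ j, ∑ k, ∑ m, H k m i j k * t i j m :=
            Finset.sum_congr rfl fun i _ => Finset.sum_congr rfl fun j _ => by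
              rw [Finset.sum_comm]
              simp only [mul_comm]
        _ = ∑ i, ∑ k, ∑ j, ∑ m, H k m i j k * t i j m :=
            Finset.sum_congr rfl fun i _ => Finset.sum_comm
        _ = _ := Finset.sum_comm
    rw [e5]
    ring
  set r : Fin n → Fin n → Fin n → Fin n → ℝ := fun k m i l =>
    g x (curvature g x (e k) (e m) (e i)) (e l) with hr_def
  have hexp : ∀ k m i, curvature g x (e k) (e m) (e i) = ∑ l, r k m i l • e l := by
    intro k m i
    conv_lhs => rw [he.expand (curvature g x (e k) (e m) (e i))]
    exact Finset.sum_congr rfl fun l _ => by rw [hM.symm x hx]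
  -- One derivative index k is also a slot of C, so the third of the curvature terms is a Ricci
  -- contraction.
  have hricci : ∑ i, ∑ j, ∑ m, t i j m * ∑ k, H k m i j k =
      ∑ i, ∑ j, ∑ m, t i j m * ∑ k, H m k i j k - curvContraction r t C := by
    simp only [curvContraction, ← Finset.sum_sub_distrib, ← mul_sub]
    refine Finset.sum_congr rfl fun i _ => Finset.sum_congr rfl fun j _ =>
      Finset.sum_congr rfl fun m _ => ?_
    congr 1
    refine Finset.sum_congr rfl fun k _ => ?_
    have h1 := hM.cubicHess_comm hx hCs (e k) (e m) (e i) (e j) (e k)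
    simp only [hexp, map_sum, map_smul, sum_apply, smul_apply, smul_eq_mul,
      ← Finset.sum_add_distrib] at h1
    simp only [hH, hC_def, comp]
    linarith
  have hr : ∀ k m i l, r k m i l =
      c * (kron m i * kron k l - kron k i * kron m l) + gaussTerm C k m i l := by
    have hin : ∀ i j k l, G (F x) (secondFF G F x (e i) (e j)) (secondFF G F x (e k) (e l)) =
        ∑ a, C i j a * C k l a := by
      intro i j k l
      rw [h.inner_normal hx (h.inner_secondFF_tangent hx _ _), he.trace_eq _ ⟨by intros; simp; ring,
        by intros; simp; ring, by intros; simp; ring, by intros; simp; ring⟩]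
      simp only [h.inner_secondFF hx]
      rfl
    intro k m i l
    have h1 := h.gauss hx (e k) (e m) (e i) (e l)
    rw [hin, hin, ← hg, he.orthonormal, he.orthonormal, he.orthonormal, he.orthonormal] at h1
    rw [gaussTerm, Finset.sum_sub_distrib]
    exact h1
  have hbound := ht.curvContraction_bound hn c b hCt hr
  have hmean' : (n : ℝ) ^ 2 / ((n : ℝ) + 2) * normSqTf G J F x * normSqMeanCurv G F x =
      ((n : ℝ) + 2) * (∑ a, b a ^ 2) * normSqTf G J F x := by
    rw [← hmean]
    ring
  rw [hlap, hricci, hdiv, hmean', hnorm]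
  linarith

end SimonsInequality

/-! ### Coordinate expressions -/

section Charts

variable {m : ℕ} {N : Type*} [TopologicalSpace N] [ChartedSpace (Coord m) N]
  {ψ : OpenPartialHomeomorph N (Coord m)} {y : Coord m} {q : N}

lemma mdifferentiable_of_mem_maximalAtlas (hψ : ψ ∈ IsManifold.maximalAtlas (𝓡 m) ∞ N) :
    ψ.MDifferentiable (𝓡 m) (𝓡 m) :=
  ⟨(contMDiffOn_of_mem_maximalAtlas hψ).mdifferentiableOn (by simp),
    (contMDiffOn_symm_of_mem_maximalAtlas hψ).mdifferentiableOn (by simp)⟩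

lemma chartDeriv_chartSymmDeriv (hψ : ψ ∈ IsManifold.maximalAtlas (𝓡 m) ∞ N) (hy : y ∈ ψ.target)
    (v : Coord m) : chartDeriv ψ (ψ.symm y) (chartSymmDeriv ψ y v) = v :=
  DFunLike.congr_fun ((mdifferentiable_of_mem_maximalAtlas hψ).comp_symm_deriv hy) v

lemma chartSymmDeriv_chartDeriv (hψ : ψ ∈ IsManifold.maximalAtlas (𝓡 m) ∞ N) (hy : y ∈ ψ.target)
    (v : TangentSpace (𝓡 m) (ψ.symm y)) :
    chartSymmDeriv ψ y (chartDeriv ψ (ψ.symm y) v) = v := by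
  have h1 := (mdifferentiable_of_mem_maximalAtlas hψ).symm_comp_deriv (ψ.map_target hy)
  rw [ψ.right_inv hy] at h1
  exact DFunLike.congr_fun h1 v

lemma chartSymmDeriv_injective (hψ : ψ ∈ IsManifold.maximalAtlas (𝓡 m) ∞ N) (hy : y ∈ ψ.target) :
    Function.Injective (chartSymmDeriv ψ y) :=
  Function.LeftInverse.injective (chartDeriv_chartSymmDeriv hψ hy)

lemma endInChart_chartDeriv (hψ : ψ ∈ IsManifold.maximalAtlas (𝓡 m) ∞ N) (hq : q ∈ ψ.source)
    (J : ∀ q : N, TangentSpace (𝓡 m) q →L[ℝ] TangentSpace (𝓡 m) q) (a : TangentSpace (𝓡 m) q) :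
    endInChart J ψ (ψ q) (chartDeriv ψ q a) = chartDeriv ψ q (J q a) := by
  -- Writing q as ψ⁻¹ y keeps the tangent spaces definitionally aligned, with no transport along
  -- ψ⁻¹(ψ q) = q.
  obtain ⟨y, hy, rfl⟩ : ∃ y ∈ ψ.target, ψ.symm y = q := ⟨ψ q, ψ.map_source hq, ψ.left_inv hq⟩
  rw [ψ.right_inv hy]
  exact congrArg (fun w => chartDeriv ψ (ψ.symm y) (J (ψ.symm y) w))
    (chartSymmDeriv_chartDeriv hψ hy a)

variable [IsManifold (𝓡 m) ∞ N]

/-- The coordinate vector fields are smooth. -/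
lemma contMDiffOn_chartSymmDeriv (hψ : ψ ∈ IsManifold.maximalAtlas (𝓡 m) ∞ N) (v : Coord m) :
    ContMDiffOn 𝓘(ℝ, Coord m) (𝓡 m).tangent ∞ (fun y => Bundle.TotalSpace.mk' (Coord m)
      (E := fun q : N => TangentSpace (𝓡 m) q) (ψ.symm y) (chartSymmDeriv ψ y v)) ψ.target := by
  have h1 := (contMDiffOn_symm_of_mem_maximalAtlas hψ).contMDiffOn_tangentMapWithin (m := ∞)
    (by simp) ψ.open_target.uniqueMDiffOn
  have h2 : ContMDiffOn 𝓘(ℝ, Coord m) (𝓡 m).tangent ∞ (fun y => Bundle.TotalSpace.mk' (Coord m)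
      (E := fun q : Coord m => TangentSpace (𝓡 m) q) y v) ψ.target :=
    contMDiffOn_vectorSpace_iff_contDiffOn.2 contDiffOn_const
  refine (h1.comp h2 fun y hy => hy).congr fun y hy => ?_
  simp only [Function.comp_apply, tangentMapWithin, chartSymmDeriv,
    mfderivWithin_of_isOpen ψ.open_target hy]
  rfl

/-- Evaluate the smooth bundle section on the smooth coordinate fields; the result is a section of
the trivial line bundle, hence a smooth function. -/
lemma contDiffOn_metricInChart (hψ : ψ ∈ IsManifold.maximalAtlas (𝓡 m) ∞ N)
    (g : Bundle.ContMDiffRiemannianMetric (𝓡 m) ∞ (Coord m) (fun q : N => TangentSpace (𝓡 m) q)) :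
    ContDiffOn ℝ ∞ (metricInChart g ψ) ψ.target := by
  refine contDiffOn_clm_apply.2 fun u => contDiffOn_clm_apply.2 fun v => ?_
  rw [← contMDiffOn_iff_contDiffOn]
  intro y hy
  have h1 : ContMDiffWithinAt 𝓘(ℝ, Coord m) ((𝓡 m).prod 𝓘(ℝ)) ∞
      (fun y => Bundle.TotalSpace.mk' ℝ (E := Bundle.Trivial N ℝ) (ψ.symm y)
        (g.inner (ψ.symm y) (chartSymmDeriv ψ y u) (chartSymmDeriv ψ y v))) ψ.target y := by
    apply ContMDiffWithinAt.clm_bundle_apply₂ (F₁ := Coord m) (F₂ := Coord m)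
    · exact ContMDiffAt.comp_contMDiffWithinAt y g.contMDiff.contMDiffAt
        (contMDiffOn_symm_of_mem_maximalAtlas hψ y hy)
    · exact contMDiffOn_chartSymmDeriv hψ u y hy
    · exact contMDiffOn_chartSymmDeriv hψ v y hy
  simp only [Bundle.contMDiffWithinAt_totalSpace] at h1
  exact h1.2

lemma metricInChart_apply
    (g : Bundle.ContMDiffRiemannianMetric (𝓡 m) ∞ (Coord m) (fun q : N => TangentSpace (𝓡 m) q))
    (y u v : Coord m) : metricInChart g ψ y u v =
      g.inner (ψ.symm y) (chartSymmDeriv ψ y u) (chartSymmDeriv ψ y v) := rfl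

lemma metricInChart_chartDeriv (hψ : ψ ∈ IsManifold.maximalAtlas (𝓡 m) ∞ N) (hq : q ∈ ψ.source)
    (g : Bundle.ContMDiffRiemannianMetric (𝓡 m) ∞ (Coord m) (fun q : N => TangentSpace (𝓡 m) q))
    (a b : TangentSpace (𝓡 m) q) :
    metricInChart g ψ (ψ q) (chartDeriv ψ q a) (chartDeriv ψ q b) = g.inner q a b := by
  obtain ⟨y, hy, rfl⟩ : ∃ y ∈ ψ.target, ψ.symm y = q := ⟨ψ q, ψ.map_source hq, ψ.left_inv hq⟩
  rw [ψ.right_inv hy, metricInChart_apply, chartSymmDeriv_chartDeriv hψ hy,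
    chartSymmDeriv_chartDeriv hψ hy]

lemma isMetricOn_metricInChart (hψ : ψ ∈ IsManifold.maximalAtlas (𝓡 m) ∞ N)
    (g : Bundle.ContMDiffRiemannianMetric (𝓡 m) ∞ (Coord m) (fun q : N => TangentSpace (𝓡 m) q)) :
    IsMetricOn (metricInChart g ψ) ψ.target := by
  refine ⟨ψ.open_target, contDiffOn_metricInChart hψ g, fun y _ u v => ?_, fun y hy u hu => ?_⟩
  · rw [metricInChart_apply, metricInChart_apply, g.symm]
  · rw [metricInChart_apply]
    refine g.pos _ _ fun h0 => hu ?_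
    rw [← chartDeriv_chartSymmDeriv hψ hy u, h0, map_zero]

/-- J applied to a coordinate field is a smooth field along ψ⁻¹, and the tangent map of ψ reads off
its coordinates. -/
lemma contDiffOn_endInChart (hψ : ψ ∈ IsManifold.maximalAtlas (𝓡 m) ∞ N)
    {J : ∀ q : N, TangentSpace (𝓡 m) q →L[ℝ] TangentSpace (𝓡 m) q}
    (hJ : ContMDiff (𝓡 m) ((𝓡 m).prod 𝓘(ℝ, Coord m →L[ℝ] Coord m)) ∞
      (fun q : N => Bundle.TotalSpace.mk' (Coord m →L[ℝ] Coord m)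
        (E := fun q : N => TangentSpace (𝓡 m) q →L[ℝ] TangentSpace (𝓡 m) q) q (J q))) :
    ContDiffOn ℝ ∞ (endInChart J ψ) ψ.target := by
  refine contDiffOn_clm_apply.2 fun v => ?_
  rw [← contMDiffOn_iff_contDiffOn]
  have h1 : ContMDiffOn 𝓘(ℝ, Coord m) (𝓡 m).tangent ∞ (fun y => Bundle.TotalSpace.mk' (Coord m)
      (E := fun q : N => TangentSpace (𝓡 m) q) (ψ.symm y)
      (J (ψ.symm y) (chartSymmDeriv ψ y v))) ψ.target := by
    intro y hy
    apply ContMDiffWithinAt.clm_bundle_apply (F₁ := Coord m) (F₂ := Coord m)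
    · exact ContMDiffAt.comp_contMDiffWithinAt y hJ.contMDiffAt
        (contMDiffOn_symm_of_mem_maximalAtlas hψ y hy)
    · exact contMDiffOn_chartSymmDeriv hψ v y hy
  have h2 := (contMDiffOn_of_mem_maximalAtlas hψ).contMDiffOn_tangentMapWithin (m := ∞)
    (by simp) ψ.open_source.uniqueMDiffOn
  have h3 := h2.comp h1 fun y hy => ψ.map_target hy
  have h4 := (contMDiff_snd_tangentBundle_modelSpace (n := ∞) (Coord m) (𝓡 m)).comp_contMDiffOn h3
  refine h4.congr fun y hy => ?_
  have h5 := mfderivWithin_of_isOpen (I := 𝓡 m) (I' := 𝓡 m) (f := ψ) ψ.open_source (ψ.map_target hy)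
  exact (DFunLike.congr_fun h5 (J (ψ.symm y) (chartSymmDeriv ψ y v))).symm

end Charts

/-! ### From Lagrangian immersions of manifolds to Lagrangian charts -/

section Immersions

variable {n : ℕ} {c : ℝ} {N : Type*} [TopologicalSpace N] [ChartedSpace (Coord (2 * n)) N]
  {M : Type*} [TopologicalSpace M] [ChartedSpace (Coord n) M]
  {f : M → N} {φ : OpenPartialHomeomorph M (Coord n)}
  {ψ : OpenPartialHomeomorph N (Coord (2 * n))}

/-- The domain of the coordinate expression of `f`. -/
def chartDomain (f : M → N) (φ : OpenPartialHomeomorph M (Coord n))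
    (ψ : OpenPartialHomeomorph N (Coord (2 * n))) : Set (Coord n) :=
  φ.target ∩ φ.symm ⁻¹' (f ⁻¹' ψ.source)

lemma fderiv_coordinate_expression (hf : ContMDiff (𝓡 n) (𝓡 (2 * n)) ∞ f)
    (hφ : φ ∈ IsManifold.maximalAtlas (𝓡 n) ∞ M)
    (hψ : ψ ∈ IsManifold.maximalAtlas (𝓡 (2 * n)) ∞ N) {y : Coord n} (hy : y ∈ chartDomain f φ ψ)
    (v : Coord n) : fderiv ℝ (ψ ∘ f ∘ φ.symm) y v =
      chartDeriv ψ (f (φ.symm y)) (mfderiv (𝓡 n) (𝓡 (2 * n)) f (φ.symm y)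
        (chartSymmDeriv φ y v)) := by
  have h1 := (mdifferentiable_of_mem_maximalAtlas hφ).mdifferentiableAt_symm hy.1
  have h2 := (mdifferentiable_of_mem_maximalAtlas hψ).mdifferentiableAt hy.2
  have h3 := hf.mdifferentiableAt (x := φ.symm y) (by simp)
  rw [← mfderiv_eq_fderiv]
  rw [mfderiv_comp y (g := ψ) (f := f ∘ φ.symm) h2 (h3.comp y h1), mfderiv_comp y h3 h1]
  rfl

variable [IsManifold (𝓡 (2 * n)) ∞ N] {S : ComplexSpaceForm n c N}

/-- The coordinate expression of a Lagrangian immersion. -/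
theorem IsLagrangianImmersion.isLagrangianChart (hf : IsLagrangianImmersion S f)
    (hφ : φ ∈ IsManifold.maximalAtlas (𝓡 n) ∞ M)
    (hψ : ψ ∈ IsManifold.maximalAtlas (𝓡 (2 * n)) ∞ N) :
    IsLagrangianChart c (metricInChart S.metric ψ) (endInChart S.J ψ) (ψ ∘ f ∘ φ.symm)
      (chartDomain f φ ψ) ψ.target := by
  have hd := fun y hy v => fderiv_coordinate_expression hf.smooth hφ hψ (y := y) hy v
  have hJ : ∀ y ∈ ψ.target, ∀ v, chartSymmDeriv ψ y (endInChart S.J ψ y v) =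
      S.J (ψ.symm y) (chartSymmDeriv ψ y v) :=
    fun y hy v => chartSymmDeriv_chartDeriv hψ hy _
  have hmaps : ∀ y ∈ chartDomain f φ ψ, (ψ ∘ f ∘ φ.symm) y ∈ ψ.target :=
    fun y hy => ψ.map_source hy.2
  refine ⟨isMetricOn_metricInChart hψ _, contDiffOn_endInChart hψ S.J_smooth, ?_, ?_,
    S.J_parallel ψ hψ, S.holomorphic_sectional_curvature ψ hψ, ?_, ?_, hmaps, ?_, ?_, ?_⟩
  · intro y hy v
    apply chartSymmDeriv_injective hψ hy
    rw [hJ y hy, hJ y hy, S.J_sq, map_neg]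
  · intro y hy v w
    rw [metricInChart_apply, hJ y hy, hJ y hy, S.J_orthogonal, metricInChart_apply]
  · exact φ.isOpen_inter_preimage_symm (ψ.open_source.preimage hf.smooth.continuous)
  · rw [← contMDiffOn_iff_contDiffOn]
    exact (contMDiffOn_of_mem_maximalAtlas hψ).comp (hf.smooth.comp_contMDiffOn
      ((contMDiffOn_symm_of_mem_maximalAtlas hφ).mono Set.inter_subset_left)) fun y hy => hy.2
  · intro y hy u v huv
    rw [hd y hy, hd y hy] at huv
    exact chartSymmDeriv_injective hφ hy.1 (hf.immersion _
      ((mdifferentiable_of_mem_maximalAtlas hψ).mfderiv_injective hy.2 huv))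
  · intro y hy u v
    rw [hd y hy, hd y hy, Function.comp_apply, Function.comp_apply,
      endInChart_chartDeriv hψ hy.2, metricInChart_chartDeriv hψ hy.2]
    -- One direction of the Lagrangian condition is isotropy. The other, used in the next case, says
    -- that J dF exhausts the normal space.
    exact (hf.lagrangian _ _).1 ⟨_, rfl⟩ _
  · intro y hy w hw
    obtain ⟨w, rfl⟩ := (mdifferentiable_of_mem_maximalAtlas hψ).mfderiv_surjective hy.2 w
    obtain ⟨v, rfl⟩ := (hf.lagrangian (φ.symm y) w).2 fun u => by
      have h1 := hw (chartDeriv φ (φ.symm y) u)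
      rw [hd y hy, chartSymmDeriv_chartDeriv hφ hy.1] at h1
      rw [← h1]
      exact (metricInChart_chartDeriv hψ hy.2 _ _ _).symm
    refine ⟨chartDeriv φ (φ.symm y) v, ?_⟩
    rw [hd y hy, chartSymmDeriv_chartDeriv hφ hy.1]
    exact endInChart_chartDeriv hψ hy.2 _ _

end Immersions

end LagrangianSimons

end

open LagrangianSimons in
/-- Simons' type inequality for Lagrangian submanifolds of complex space forms, at every point `p`
and in all local coordinates `φ` around `p` and `ψ` around `f p`. -/
theorem mainTheorem3 (n : ℕ) (hn : 2 ≤ n) (c : ℝ)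
    {N : Type*} [TopologicalSpace N] [ChartedSpace (Coord (2 * n)) N]
    [IsManifold (𝓡 (2 * n)) ∞ N] (S : ComplexSpaceForm n c N)
    {M : Type*} [TopologicalSpace M] [ChartedSpace (Coord n) M] [IsManifold (𝓡 n) ∞ M]
    (f : M → N) (hf : IsLagrangianImmersion S f) (p : M)
    (φ : OpenPartialHomeomorph M (Coord n)) (hφ : φ ∈ IsManifold.maximalAtlas (𝓡 n) ∞ M)
    (hpφ : p ∈ φ.source)
    (ψ : OpenPartialHomeomorph N (Coord (2 * n)))
    (hψ : ψ ∈ IsManifold.maximalAtlas (𝓡 (2 * n)) ∞ N) (hpψ : f p ∈ ψ.source)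
    (G : Coord (2 * n) → Coord (2 * n) →L[ℝ] Coord (2 * n) →L[ℝ] ℝ)
    (hG : G = metricInChart S.metric ψ)
    (J : Coord (2 * n) → Coord (2 * n) →L[ℝ] Coord (2 * n)) (hJ : J = endInChart S.J ψ)
    (F : Coord n → Coord (2 * n)) (hF : F = ψ ∘ f ∘ φ.symm)
    (x : Coord n) (hx : x = φ p) :
    (1 / 2) * laplacian (indMetric G F) (normSqTf G J F) x ≥
      ((n : ℝ) + 2) * innerTfCovT G J F x + normSqCovTf G J F x
        + ((n : ℝ) + 1) * c * normSqTf G J F x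
        + (n : ℝ) ^ 2 / ((n : ℝ) + 2) * normSqTf G J F x * normSqMeanCurv G F x
        - ((n : ℝ) + 3) / 2 * normSqTf G J F x ^ 2 := by
  subst hG hJ hF hx
  exact (hf.isLagrangianChart hφ hψ).simons_inequality hn
    ⟨φ.map_source hpφ, by simpa [φ.left_inv hpφ] using hpψ⟩
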